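/- Let $\Omega=(0,1)$ and, for $T>0$, $Q_T=\Omega\times(0,T)$. Let $H^1_{(0)}(\Omega)=\{z\in H^1(\Omega): z(0)=0\}$ with norm $\|z\|_{H^1_{(0)}}=\|\partial_x z\|_{L^2(\Omega)}$, and let $H^{-1}_{(0)}(\Omega)$ be its dual with the dual norm; $L^2(\Omega)$ is embedded in $H^{-1}_{(0)}(\Omega)$ by $\langle f,z\rangle=\int_\Omega fz\,dx$. All functions are real-valued. For $A\in L^\infty(Q_T)$, $B\in L^2(Q_T)$ and $(\varphi_0,\varphi_1)\in L^2(\Omega)\times H^{-1}_{(0)}(\Omega)$ consider $$\partial_{tt}\varphi-\partial_{xx}\varphi+A\varphi=B \text{ in } Q_T,\qquad \varphi(0,\cdot)=0,\ \partial_x\varphi(1,\cdot)=0 \text{ in } (0,T),\qquad (\varphi,\partial_t\varphi)(\cdot,0)=(\varphi_0,\varphi_1) \text{ in } \Omega. \tag{$\star$}$$ A function $\varphi\in L^2(Q_T)$ is a solution of $(\star)$ in the sense of transposition if for every $g\in L^2(Q_T)$ $$\int_{Q_T}\varphi g\,dx\,dt=\int_{Q_T}Bw\,dx\,dt+\langle\varphi_1,w(\cdot,0)\rangle_{H^{-1}_{(0)},H^1_{(0)}}-\int_\Omega\varphi_0\,\partial_tw(\cdot,0)\,dx,$$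 where $w\in C^0([0,T];H^1_{(0)}(\Omega))\cap C^1([0,T];L^2(\Omega))\cap H^2(0,T;H^{-1}_{(0)}(\Omega))$ is the weak solution of the backward problem $\partial_{tt}w-\partial_{xx}w+Aw=g$ in $Q_T$, $w(0,\cdot)=0$, $\partial_xw(1,\cdot)=0$, $(w,\partial_tw)(\cdot,T)=(0,0)$, that is, for a.e. $t\in(0,T)$ and all $z\in H^1_{(0)}(\Omega)$, $$\langle\partial_{tt}w(\cdot,t),z\rangle_{H^{-1}_{(0)},H^1_{(0)}}+\int_\Omega\partial_xw\,\partial_xz\,dx+\int_\Omega Awz\,dx=\int_\Omega gz\,dx .$$ **Theorem.** Let $T>2$. There exists a constant $C=C(T)>0$ such that for all $A\in L^\infty(Q_T)$, $B\in L^2(Q_T)$, $(\varphi_0,\varphi_1)\in L^2(\Omega)\times H^{-1}_{(0)}(\Omega)$ and every solution $\varphi$ of $(\star)$ in the sense of transposition the following holds. The function $\varphi$ has a representative in $C^0([0,T];L^2(\Omega))\cap C^1([0,T];H^{-1}_{(0)}(\Omega))$, with $(\varphi(\cdot,0),\partial_t\varphi(\cdot,0))=(\varphi_0,\varphi_1)$;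 the trace $\varphi(1,\cdot)=\lim_{\varepsilon\to0^+}\frac1\varepsilon\int_{1-\varepsilon}^1\varphi(x,\cdot)\,dx$ exists in $L^2(0,T)$; $\partial_{tt}\varphi-\partial_{xx}\varphi+A\varphi=B$ in the sense of distributions in $Q_T$; and $$\|\varphi(\cdot,0)\|^2_{L^2(\Omega)}+\|\partial_t\varphi(\cdot,0)\|^2_{H^{-1}_{(0)}(\Omega)}\le C_{\mathrm{obs}}\Big(\|\varphi(1,\cdot)\|^2_{L^2(0,T)}+\|\partial_{tt}\varphi-\partial_{xx}\varphi+A\varphi\|^2_{L^2(Q_T)}\Big),\qquad C_{\mathrm{obs}}=C\,e^{C\sqrt{\|A\|_{L^\infty(Q_T)}}}.$$ -/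

import Mathlib

open MeasureTheory Set Filter Topology
open scoped ENNReal ContDiff

noncomputable section

/-- Lebesgue measure on `Ω = (0,1)`. -/
abbrev muOm : Measure ℝ := volume.restrict (Ioo 0 1)

/-- Lebesgue measure on `(0,T)`. -/
abbrev muT (T : ℝ) : Measure ℝ := volume.restrict (Ioo 0 T)

/-- Lebesgue measure on `Q_T = Ω × (0,T)`; points are written `(x, t)`. -/
abbrev muQ (T : ℝ) : Measure (ℝ × ℝ) := volume.restrict (Ioo 0 1 ×ˢ Ioo 0 T)

/-- `L²(Ω)`. -/
abbrev L2Om : Type := Lp ℝ 2 muOm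

/-- `L²(0,T)`. -/
abbrev L2T (T : ℝ) : Type := Lp ℝ 2 (muT T)

/-- `L²(Q_T)`. -/
abbrev L2Q (T : ℝ) : Type := Lp ℝ 2 (muQ T)

/-- `L^∞(Q_T)`. -/
abbrev LinfQ (T : ℝ) : Type := Lp ℝ ∞ (muQ T)

theorem L2Om.integrable (f : L2Om) : Integrable (f : ℝ → ℝ) muOm :=
  (Lp.memLp f).integrable (by norm_num)

theorem L2Om.intervalIntegrable (f : L2Om) {x : ℝ} (hx : x ∈ Ioo (0 : ℝ) 1) :
    IntervalIntegrable (f : ℝ → ℝ) volume 0 x := by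
  rw [intervalIntegrable_iff_integrableOn_Ioo_of_le hx.1.le]
  have h : IntegrableOn (f : ℝ → ℝ) (Ioo 0 1) volume := f.integrable
  exact h.mono_set (Ioo_subset_Ioo_right hx.2.le)

/-- Equality almost everywhere in `Ω` restricts to equality of the primitives vanishing at `0`. -/
theorem L2Om.primitive_congr {f g : ℝ → ℝ} (h : f =ᵐ[muOm] g) {x : ℝ}
    (hx : x ∈ Ioo (0 : ℝ) 1) : (∫ s in (0 : ℝ)..x, f s) = ∫ s in (0 : ℝ)..x, g s := by
  rw [intervalIntegral.integral_of_le hx.1.le, intervalIntegral.integral_of_le hx.1.le,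
    integral_Ioc_eq_integral_Ioo, integral_Ioc_eq_integral_Ioo]
  exact integral_congr_ae (ae_mono
    (Measure.restrict_mono (Ioo_subset_Ioo_right hx.2.le) le_rfl) h)

/-- The pairs `(z, ∂ₓz)` with `z ∈ H¹(Ω)` and `z(0) = 0`: both components are in `L²(Ω)`, and
(the continuous representative of) `z` is the primitive of `∂ₓz` that vanishes at `0`. -/
def H10Sub : Submodule ℝ (L2Om × L2Om) where
  carrier := {p | (p.1 : ℝ → ℝ) =ᵐ[muOm] fun x => ∫ s in (0 : ℝ)..x, p.2 s}
  zero_mem' := by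
    filter_upwards [Lp.coeFn_zero ℝ 2 muOm, ae_restrict_mem measurableSet_Ioo] with x h hx
    have h2 := L2Om.primitive_congr (Lp.coeFn_zero ℝ 2 muOm) hx
    change (0 : L2Om) x = ∫ s in (0 : ℝ)..x, (0 : L2Om) s
    rw [h, h2]
    simp
  add_mem' := by
    intro p q hp hq
    have hp' : (p.1 : ℝ → ℝ) =ᵐ[muOm] fun x => ∫ s in (0 : ℝ)..x, p.2 s := hp
    have hq' : (q.1 : ℝ → ℝ) =ᵐ[muOm] fun x => ∫ s in (0 : ℝ)..x, q.2 s := hq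
    filter_upwards [Lp.coeFn_add p.1 q.1, hp', hq', ae_restrict_mem measurableSet_Ioo]
      with x h h1 h2 hx
    have h3 := L2Om.primitive_congr (Lp.coeFn_add p.2 q.2) hx
    change (p.1 + q.1 : L2Om) x = ∫ s in (0 : ℝ)..x, (p.2 + q.2 : L2Om) s
    rw [h, h3, Pi.add_apply, h1, h2]
    exact (intervalIntegral.integral_add (p.2.intervalIntegrable hx)
      (q.2.intervalIntegrable hx)).symm
  smul_mem' := by
    intro c p hp
    have hp' : (p.1 : ℝ → ℝ) =ᵐ[muOm] fun x => ∫ s in (0 : ℝ)..x, p.2 s := hp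
    filter_upwards [Lp.coeFn_smul c p.1, hp', ae_restrict_mem measurableSet_Ioo] with x h h1 hx
    have h3 := L2Om.primitive_congr (Lp.coeFn_smul c p.2) hx
    change (c • p.1 : L2Om) x = ∫ s in (0 : ℝ)..x, (c • p.2 : L2Om) s
    rw [h, h3, Pi.smul_apply, h1]
    exact (intervalIntegral.integral_smul c (fun s => p.2 s)).symm

/-- The space `H¹₍₀₎(Ω) = {z ∈ H¹(Ω) : z(0) = 0}`. -/
def H10 : Type := ↥H10Sub

namespace H10

instance : AddCommGroup H10 := inferInstanceAs (AddCommGroup ↥H10Sub)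

instance : Module ℝ H10 := inferInstanceAs (Module ℝ ↥H10Sub)

/-- The underlying function `z` as an element of `L²(Ω)`. -/
def fn : H10 →ₗ[ℝ] L2Om := (LinearMap.fst ℝ L2Om L2Om).comp H10Sub.subtype

/-- The weak derivative `∂ₓz ∈ L²(Ω)`. -/
def dx : H10 →ₗ[ℝ] L2Om := (LinearMap.snd ℝ L2Om L2Om).comp H10Sub.subtype

theorem fn_ae (z : H10) : (fn z : ℝ → ℝ) =ᵐ[muOm] fun x => ∫ s in (0 : ℝ)..x, dx z s := z.2

theorem dx_injective : Function.Injective dx := by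
  intro y z h
  have h1 : fn y = fn z := by
    apply Lp.ext
    filter_upwards [fn_ae y, fn_ae z] with x hy hz
    rw [hy, hz, h]
  exact Subtype.ext (Prod.ext h1 h)

/-- The norm of `H¹₍₀₎(Ω)` is `‖z‖ = ‖∂ₓz‖` in `L²(Ω)`. -/
instance : NormedAddCommGroup H10 := NormedAddCommGroup.induced H10 L2Om dx dx_injective

instance : NormedSpace ℝ H10 := NormedSpace.induced ℝ H10 L2Om dx

theorem norm_def (z : H10) : ‖z‖ = ‖dx z‖ := rfl

/-- The Poincaré inequality, which makes the inclusion in `L²(Ω)` continuous. -/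
theorem norm_fn_le (z : H10) : ‖fn z‖ ≤ 1 * ‖z‖ := by
  rw [one_mul, norm_def]
  have hvol : muOm univ = 1 := by simp
  have : IsProbabilityMeasure muOm := ⟨hvol⟩
  have hL1 : (∫ s, ‖dx z s‖ ∂muOm) ≤ ‖dx z‖ := by
    have h1 : eLpNorm (dx z : ℝ → ℝ) 1 muOm ≤ eLpNorm (dx z : ℝ → ℝ) 2 muOm :=
      eLpNorm_le_eLpNorm_of_exponent_le (by norm_num) (Lp.memLp (dx z)).1
    rw [Lp.norm_def, integral_norm_eq_lintegral_enorm (Lp.memLp (dx z)).1,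
      ← eLpNorm_one_eq_lintegral_enorm]
    exact ENNReal.toReal_mono (Lp.memLp (dx z)).2.ne h1
  have hb : ∀ᵐ x ∂muOm, ‖fn z x‖ ≤ ‖dx z‖ := by
    filter_upwards [fn_ae z, ae_restrict_mem measurableSet_Ioo] with x hz hx
    rw [hz]
    refine (intervalIntegral.norm_integral_le_integral_norm hx.1.le).trans (le_trans ?_ hL1)
    rw [intervalIntegral.integral_of_le hx.1.le, integral_Ioc_eq_integral_Ioo]
    exact setIntegral_mono_set (L2Om.integrable (dx z)).norm
      (Eventually.of_forall fun s => norm_nonneg _)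
      (Ioo_subset_Ioo_right hx.2.le).eventuallyLE
  have h := Lp.norm_le_of_ae_bound (f := fn z) (norm_nonneg _) hb
  have hv : measureUnivNNReal muOm = 1 := by simp [measureUnivNNReal]
  simpa [hv] using h

/-- The continuous inclusion `H¹₍₀₎(Ω) ↪ L²(Ω)`. -/
def toL2 : H10 →L[ℝ] L2Om := fn.mkContinuous 1 norm_fn_le

end H10

/-- `H⁻¹₍₀₎(Ω)`, the dual of `H¹₍₀₎(Ω)` with the dual norm. -/
abbrev Hm1 : Type := H10 →L[ℝ] ℝ

/-- The inclusion `L²(Ω) ↪ H⁻¹₍₀₎(Ω)`, `f ↦ (z ↦ ∫_Ω f z)`. -/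
def L2toHm1 (f : L2Om) : Hm1 := (innerSL ℝ f).comp H10.toL2

/-- `w` (with time derivatives `w₁ = ∂ₜw`, `w₂ = ∂ₜₜw`) is the weak solution of the backward problem
`∂ₜₜw - ∂ₓₓw + A w = g` in `Q_T`, `w(0,·) = 0`, `∂ₓw(1,·) = 0`, `(w, ∂ₜw)(·,T) = (0,0)`,
of class `C⁰([0,T]; H¹₍₀₎) ∩ C¹([0,T]; L²) ∩ H²(0,T; H⁻¹₍₀₎)`.
Only the values at times in `[0,T]` matter. -/
structure IsBackwardWeakSolution (T : ℝ) (A : LinfQ T) (g : L2Q T)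
    (w : ℝ → H10) (w₁ : ℝ → L2Om) (w₂ : ℝ → Hm1) : Prop where
  continuousOn : ContinuousOn w (Icc 0 T)
  hasDeriv : ∀ t ∈ Icc 0 T, HasDerivWithinAt (fun s => H10.toL2 (w s)) (w₁ t) (Icc 0 T) t
  continuousOn_deriv : ContinuousOn w₁ (Icc 0 T)
  /-- `∂ₜₜw ∈ L²(0,T; H⁻¹₍₀₎)` -/
  memLp_deriv2 : MemLp w₂ 2 (muT T)
  /-- `w₂` is the time derivative of `∂ₜw` in `H⁻¹₍₀₎`. -/
  deriv2_eq : ∀ t ∈ Icc 0 T, L2toHm1 (w₁ t) = L2toHm1 (w₁ 0) + ∫ s in (0 : ℝ)..t, w₂ s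
  equation : ∀ᵐ t ∂(muT T), ∀ z : H10,
    w₂ t z + (∫ x, H10.dx (w t) x * H10.dx z x ∂muOm)
      + (∫ x, A (x, t) * H10.toL2 (w t) x * H10.toL2 z x ∂muOm)
      = ∫ x, g (x, t) * H10.toL2 z x ∂muOm
  final : w T = 0
  final_deriv : w₁ T = 0

/-- `φ ∈ L²(Q_T)` is a solution in the sense of transposition of
`∂ₜₜφ - ∂ₓₓφ + A φ = B` in `Q_T`, `φ(0,·) = 0`, `∂ₓφ(1,·) = 0`, `(φ, ∂ₜφ)(·,0) = (φ₀, φ₁)`. -/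
def IsTranspositionSolution (T : ℝ) (A : LinfQ T) (B : L2Q T) (φ₀ : L2Om) (φ₁ : Hm1)
    (φ : L2Q T) : Prop :=
  ∀ (g : L2Q T) (w : ℝ → H10) (w₁ : ℝ → L2Om) (w₂ : ℝ → Hm1),
    IsBackwardWeakSolution T A g w w₁ w₂ →
      (∫ p, φ p * g p ∂(muQ T))
        = (∫ t, (∫ x, B (x, t) * H10.toL2 (w t) x ∂muOm) ∂(muT T))
          + φ₁ (w 0) - ∫ x, φ₀ x * w₁ 0 x ∂muOm

/-- `t ↦ Φ t` is the representative of `φ` in `C⁰([0,T]; L²(Ω)) ∩ C¹([0,T]; H⁻¹₍₀₎(Ω))`, and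
`t ↦ Φ' t` is its time derivative in `H⁻¹₍₀₎(Ω)`. Both are determined by `φ` on `[0,T]`. -/
structure IsTimeRepresentative (T : ℝ) (φ : L2Q T) (Φ : ℝ → L2Om) (Φ' : ℝ → Hm1) : Prop where
  ae_eq : ∀ᵐ t ∂(muT T), (Φ t : ℝ → ℝ) =ᵐ[muOm] fun x => φ (x, t)
  continuousOn : ContinuousOn Φ (Icc 0 T)
  hasDeriv : ∀ t ∈ Icc 0 T, HasDerivWithinAt (fun s => L2toHm1 (Φ s)) (Φ' t) (Icc 0 T) t
  continuousOn_deriv : ContinuousOn Φ' (Icc 0 T)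

/-- `u ∈ L²(0,T)` is the trace `φ(1,·)`: the averages of `φ(x,·)` over `1 - ε < x < 1` converge
to `u` in `L²(0,T)` as `ε → 0⁺`. -/
def IsTraceAtOne (T : ℝ) (φ : L2Q T) (u : L2T T) : Prop :=
  Tendsto (fun ε : ℝ => eLpNorm (fun t => ε⁻¹ * (∫ x in (1 - ε)..1, φ (x, t)) - u t) 2 (muT T))
    (𝓝[>] 0) (𝓝 0)

/-- `∂ₜₜφ - ∂ₓₓφ + A φ = F` in the sense of distributions in `Q_T`. -/
def IsWaveOperator (T : ℝ) (A : LinfQ T) (φ F : L2Q T) : Prop :=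
  ∀ θ : ℝ × ℝ → ℝ, ContDiff ℝ ∞ θ → HasCompactSupport θ → tsupport θ ⊆ Ioo 0 1 ×ˢ Ioo 0 T →
    (∫ p, φ p * (iteratedDeriv 2 (fun t => θ (p.1, t)) p.2
        - iteratedDeriv 2 (fun x => θ (x, p.2)) p.1 + A p * θ p) ∂(muQ T))
      = ∫ p, F p * θ p ∂(muQ T)

end

noncomputable section

/-! ### Continuous functions as elements of the `L²` spaces -/

theorem Continuous.memLp_restrict_of_subset_isCompact {X E : Type*} [TopologicalSpace X]
    [MeasurableSpace X] [OpensMeasurableSpace X] [NormedAddCommGroup E]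
    [SecondCountableTopologyEither X E] {μ : Measure X} [IsFiniteMeasureOnCompacts μ] {f : X → E}
    (hf : Continuous f) {s K : Set X} (hK : IsCompact K) (hs : s ⊆ K) (hm : MeasurableSet s)
    (p : ℝ≥0∞) : MemLp f p (μ.restrict s) := by
  have : IsFiniteMeasure (μ.restrict s) :=
    ⟨by simpa using (measure_mono hs).trans_lt hK.measure_lt_top⟩
  obtain ⟨C, hC⟩ := hK.exists_bound_of_continuousOn hf.continuousOn
  refine MemLp.of_bound hf.aestronglyMeasurable C ?_
  filter_upwards [ae_restrict_mem hm] with x hx using hC x (hs hx)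

theorem Continuous.memLp_muOm {f : ℝ → ℝ} (hf : Continuous f) (p : ℝ≥0∞) : MemLp f p muOm :=
  hf.memLp_restrict_of_subset_isCompact isCompact_Icc Ioo_subset_Icc_self measurableSet_Ioo p

theorem Continuous.memLp_muT {E : Type*} [NormedAddCommGroup E] {f : ℝ → E} (hf : Continuous f)
    (T : ℝ) (p : ℝ≥0∞) : MemLp f p (muT T) :=
  hf.memLp_restrict_of_subset_isCompact isCompact_Icc Ioo_subset_Icc_self measurableSet_Ioo p

theorem Continuous.memLp_muQ {f : ℝ × ℝ → ℝ} (hf : Continuous f) (T : ℝ) (p : ℝ≥0∞) :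
    MemLp f p (muQ T) :=
  hf.memLp_restrict_of_subset_isCompact (isCompact_Icc.prod isCompact_Icc)
    (prod_mono Ioo_subset_Icc_self Ioo_subset_Icc_self)
    (measurableSet_Ioo.prod measurableSet_Ioo) p

theorem Continuous.integrable_muQ {f : ℝ × ℝ → ℝ} (hf : Continuous f) (T : ℝ) :
    Integrable f (muQ T) := memLp_one_iff_integrable.1 (hf.memLp_muQ T 1)

/-- The class in `L²(Ω)` of a continuous function. -/
def toOm (f : ℝ → ℝ) (hf : Continuous f) : L2Om := (hf.memLp_muOm 2).toLp f

/-- The class in `L²(0,T)` of a continuous function. -/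
def toT (T : ℝ) (f : ℝ → ℝ) (hf : Continuous f) : L2T T := (hf.memLp_muT T 2).toLp f

/-- The class in `L²(Q_T)` of a continuous function. -/
def toQ (T : ℝ) (f : ℝ × ℝ → ℝ) (hf : Continuous f) : L2Q T := (hf.memLp_muQ T 2).toLp f

theorem coeFn_toOm {f : ℝ → ℝ} (hf : Continuous f) : (toOm f hf : ℝ → ℝ) =ᵐ[muOm] f :=
  MemLp.coeFn_toLp _

theorem coeFn_toT {T : ℝ} {f : ℝ → ℝ} (hf : Continuous f) : (toT T f hf : ℝ → ℝ) =ᵐ[muT T] f :=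
  MemLp.coeFn_toLp _

theorem coeFn_toQ {T : ℝ} {f : ℝ × ℝ → ℝ} (hf : Continuous f) :
    (toQ T f hf : ℝ × ℝ → ℝ) =ᵐ[muQ T] f :=
  MemLp.coeFn_toLp _

theorem integral_muOm (f : ℝ → ℝ) : ∫ x, f x ∂muOm = ∫ x in (0 : ℝ)..1, f x := by
  rw [intervalIntegral.integral_of_le zero_le_one, integral_Ioc_eq_integral_Ioo]

theorem integral_muT {T : ℝ} (hT : 0 ≤ T) (f : ℝ → ℝ) :
    ∫ x, f x ∂(muT T) = ∫ x in (0 : ℝ)..T, f x := by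
  rw [intervalIntegral.integral_of_le hT, integral_Ioc_eq_integral_Ioo]

theorem muQ_eq_prod (T : ℝ) : muQ T = muOm.prod (muT T) := by
  rw [Measure.prod_restrict]; rfl

theorem integral_muQ_eq_iterated {T : ℝ} {f : ℝ × ℝ → ℝ} (hf : Integrable f (muQ T)) :
    ∫ p, f p ∂(muQ T) = ∫ t, ∫ x, f (x, t) ∂muOm ∂(muT T) := by
  rw [muQ_eq_prod] at hf ⊢
  exact integral_prod_symm f hf

theorem integral_muQ_eq_interval {T : ℝ} (hT : 0 ≤ T) {f : ℝ × ℝ → ℝ} (hf : Continuous f) :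
    ∫ p, f p ∂(muQ T) = ∫ t in (0 : ℝ)..T, ∫ x in (0 : ℝ)..1, f (x, t) := by
  rw [integral_muQ_eq_iterated (hf.integrable_muQ T), integral_muT hT]
  simp_rw [integral_muOm]

theorem ae_muQ_slice {T : ℝ} {P : ℝ × ℝ → Prop} (h : ∀ᵐ p ∂(muQ T), P p) :
    ∀ᵐ t ∂(muT T), ∀ᵐ x ∂muOm, P (x, t) := by
  rw [muQ_eq_prod, ← Measure.prod_swap] at h
  exact Measure.ae_ae_of_ae_prod (ae_of_ae_map measurable_swap.aemeasurable h)

theorem Lp_two_norm_sq {X : Type*} [MeasurableSpace X] {μ : Measure X} (f : Lp ℝ 2 μ) :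
    ‖f‖ ^ 2 = ∫ x, f x ^ 2 ∂μ := by
  rw [← real_inner_self_eq_norm_sq, L2.inner_def]
  exact integral_congr_ae (Eventually.of_forall fun x => by simp [sq])

theorem Lp_two_inner {X : Type*} [MeasurableSpace X] {μ : Measure X} (f g : Lp ℝ 2 μ) :
    inner ℝ f g = ∫ x, f x * g x ∂μ := by
  rw [L2.inner_def]
  exact integral_congr_ae (Eventually.of_forall fun x => by simp [mul_comm])

theorem norm_sq_toOm {f : ℝ → ℝ} (hf : Continuous f) :
    ‖toOm f hf‖ ^ 2 = ∫ x in (0 : ℝ)..1, f x ^ 2 := by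
  rw [Lp_two_norm_sq, ← integral_muOm]
  exact integral_congr_ae ((coeFn_toOm hf).mono fun x hx => by simp only [hx])

theorem norm_sq_toT {T : ℝ} (hT : 0 ≤ T) {f : ℝ → ℝ} (hf : Continuous f) :
    ‖toT T f hf‖ ^ 2 = ∫ x in (0 : ℝ)..T, f x ^ 2 := by
  rw [Lp_two_norm_sq, ← integral_muT hT]
  exact integral_congr_ae ((coeFn_toT hf).mono fun x hx => by simp only [hx])

theorem norm_sq_toQ {T : ℝ} {f : ℝ × ℝ → ℝ} (hf : Continuous f) :
    ‖toQ T f hf‖ ^ 2 = ∫ p, f p ^ 2 ∂(muQ T) := by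
  rw [Lp_two_norm_sq]
  exact integral_congr_ae ((coeFn_toQ hf).mono fun x hx => by simp only [hx])

/-! ### Calculus on rectangles -/

theorem continuous_slice_left {f : ℝ × ℝ → ℝ} (hf : Continuous f) (t : ℝ) :
    Continuous fun x => f (x, t) := by fun_prop

theorem continuous_slice_right {f : ℝ × ℝ → ℝ} (hf : Continuous f) (x : ℝ) :
    Continuous fun t => f (x, t) := by fun_prop

theorem continuous_integral_slice_left {f : ℝ × ℝ → ℝ} (hf : Continuous f) (c d : ℝ) :
    Continuous fun t => ∫ x in c..d, f (x, t) :=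
  intervalIntegral.continuous_parametric_intervalIntegral_of_continuous' (f := fun t x => f (x, t))
    (by fun_prop) c d

theorem continuous_integral_slice_right {f : ℝ × ℝ → ℝ} (hf : Continuous f) (c d : ℝ) :
    Continuous fun x => ∫ t in c..d, f (x, t) :=
  intervalIntegral.continuous_parametric_intervalIntegral_of_continuous' (f := fun x t => f (x, t))
    (by fun_prop) c d

theorem intervalIntegral_swap {f : ℝ × ℝ → ℝ} (hf : Continuous f) (a b c d : ℝ) :
    ∫ t in a..b, ∫ x in c..d, f (x, t) = ∫ x in c..d, ∫ t in a..b, f (x, t) := by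
  refine intervalIntegral_intervalIntegral_swap ?_
  have h : Continuous (Function.uncurry fun t x => f (x, t)) := by
    simp only [Function.uncurry_def]; fun_prop
  exact (h.continuousOn.integrableOn_compact
    (isCompact_uIcc.prod isCompact_uIcc)).mono_set (prod_mono uIoc_subset_uIcc uIoc_subset_uIcc)

theorem integral_divergence {f g f' g' : ℝ × ℝ → ℝ} (hf' : Continuous f') (hg' : Continuous g')
    (hf : ∀ x t, HasDerivAt (fun s => f (s, t)) (f' (x, t)) x)
    (hg : ∀ x t, HasDerivAt (fun s => g (x, s)) (g' (x, t)) t) (a b c d : ℝ) :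
    ∫ t in a..b, ∫ x in c..d, (f' (x, t) + g' (x, t))
      = (∫ t in a..b, (f (d, t) - f (c, t))) + ∫ x in c..d, (g (x, b) - g (x, a)) := by
  have h1 : ∀ t, ∫ x in c..d, (f' (x, t) + g' (x, t))
      = (f (d, t) - f (c, t)) + ∫ x in c..d, g' (x, t) := by
    intro t
    rw [intervalIntegral.integral_add ((continuous_slice_left hf' t).intervalIntegrable _ _)
      ((continuous_slice_left hg' t).intervalIntegrable _ _),
      intervalIntegral.integral_eq_sub_of_hasDerivAt (fun x _ => hf x t)
        ((continuous_slice_left hf' t).intervalIntegrable _ _)]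
  have h3 : Continuous fun t => f (d, t) - f (c, t) := by
    have : (fun t => f (d, t) - f (c, t)) = fun t => ∫ x in c..d, f' (x, t) := by
      ext t
      rw [intervalIntegral.integral_eq_sub_of_hasDerivAt (fun x _ => hf x t)
        ((continuous_slice_left hf' t).intervalIntegrable _ _)]
    rw [this]
    exact continuous_integral_slice_left hf' c d
  simp_rw [h1]
  rw [intervalIntegral.integral_add (h3.intervalIntegrable _ _)
    ((continuous_integral_slice_left hg' c d).intervalIntegrable _ _), intervalIntegral_swap hg']
  congr 1
  refine intervalIntegral.integral_congr fun x _ => ?_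
  exact intervalIntegral.integral_eq_sub_of_hasDerivAt (fun t _ => hg x t)
    ((continuous_slice_right hg' x).intervalIntegrable _ _)

theorem hasDerivAt_integral_slice {f f' : ℝ × ℝ → ℝ} (hf : Continuous f) (hf' : Continuous f')
    (h : ∀ x t, HasDerivAt (fun s => f (s, t)) (f' (x, t)) x) (a b x : ℝ) :
    HasDerivAt (fun s => ∫ t in a..b, f (s, t)) (∫ t in a..b, f' (x, t)) x := by
  have h1 : (fun s => ∫ t in a..b, f (s, t))
      = fun s => (∫ t in a..b, f (0, t)) + ∫ y in (0 : ℝ)..s, ∫ t in a..b, f' (y, t) := by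
    ext s
    rw [← intervalIntegral_swap hf', ← sub_eq_iff_eq_add', ← intervalIntegral.integral_sub
      ((continuous_slice_right hf _).intervalIntegrable _ _)
      ((continuous_slice_right hf _).intervalIntegrable _ _)]
    refine intervalIntegral.integral_congr fun t _ => ?_
    exact (intervalIntegral.integral_eq_sub_of_hasDerivAt (fun y _ => h y t)
      ((continuous_slice_left hf' t).intervalIntegrable _ _)).symm
  rw [h1]
  have hc := continuous_integral_slice_right hf' a b
  exact (intervalIntegral.integral_hasDerivAt_right (hc.intervalIntegrable _ _)
    (hc.stronglyMeasurableAtFilter _ _) hc.continuousAt).const_add _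

theorem sq_intervalIntegral_le_mul {f : ℝ → ℝ} (hf : Continuous f) {c d : ℝ} (hcd : c ≤ d) :
    (∫ x in c..d, f x) ^ 2 ≤ (d - c) * ∫ x in c..d, f x ^ 2 := by
  set m := ∫ x in c..d, f x with hm
  have key : 0 ≤ ∫ x in c..d, ((d - c) * f x - m) ^ 2 :=
    intervalIntegral.integral_nonneg hcd fun x _ => sq_nonneg _
  have hexp : ∫ x in c..d, ((d - c) * f x - m) ^ 2
      = (d - c) * ((d - c) * (∫ x in c..d, f x ^ 2) - m ^ 2) := by
    have h1 : ∀ x, ((d - c) * f x - m) ^ 2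
        = (d - c) ^ 2 * f x ^ 2 - 2 * (d - c) * m * f x + m ^ 2 := fun x => by ring
    simp_rw [h1]
    rw [intervalIntegral.integral_add, intervalIntegral.integral_sub,
      intervalIntegral.integral_const_mul, intervalIntegral.integral_const_mul,
      intervalIntegral.integral_const, ← hm]
    · simp only [smul_eq_mul]; ring
    all_goals exact Continuous.intervalIntegrable (by fun_prop) _ _
  rcases hcd.eq_or_lt with h | h
  · simp [hm, ← h]
  · rw [hexp] at key
    linarith [nonneg_of_mul_nonneg_right key (sub_pos.2 h)]

theorem sq_intervalIntegral_le {f : ℝ → ℝ} (hf : Continuous f) {c d : ℝ} (hc : 0 ≤ c)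
    (hcd : c ≤ d) (hd : d ≤ 1) :
    (∫ x in c..d, f x) ^ 2 ≤ (d - c) * ∫ x in (0 : ℝ)..1, f x ^ 2 :=
  (sq_intervalIntegral_le_mul hf hcd).trans (mul_le_mul_of_nonneg_left
    (intervalIntegral.integral_mono_interval hc hcd hd
      (Eventually.of_forall fun _ => sq_nonneg _) ((hf.pow 2).intervalIntegrable _ _))
    (sub_nonneg.2 hcd))

theorem toT_add_smul {T : ℝ} {f g : ℝ → ℝ} (hf : Continuous f) (hg : Continuous g) (c : ℝ)
    (h : Continuous fun x => f x + c * g x) :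
    toT T (fun x => f x + c * g x) h = toT T f hf + c • toT T g hg := rfl

end

noncomputable section

/-! ### Classical solutions of the wave equation in first-order form -/

/-- A classical solution of `∂ₜₜφ - ∂ₓₓφ = F`, `φ(0,·) = 0`, `∂ₓφ(1,·) = 0`, written as the system
`∂ₜφ = ∂ₓG`, `∂ₜG = ∂ₓφ + H`, `∂ₓH = F` with `φ(0,·) = 0`, `G(1,·) = 0`, `H(1,·) = 0`.
The functions `p`, `q` are `∂ₜφ`, `∂ₓφ`; points are written `(x, t)`. -/
structure WaveSolution where
  (φ G H F p q : ℝ × ℝ → ℝ)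
  hφ : Continuous φ
  hG : Continuous G
  hH : Continuous H
  hF : Continuous F
  hp : Continuous p
  hq : Continuous q
  φ_dx : ∀ x t, HasDerivAt (fun s => φ (s, t)) (q (x, t)) x
  φ_dt : ∀ x t, HasDerivAt (fun s => φ (x, s)) (p (x, t)) t
  G_dx : ∀ x t, HasDerivAt (fun s => G (s, t)) (p (x, t)) x
  G_dt : ∀ x t, HasDerivAt (fun s => G (x, s)) (q (x, t) + H (x, t)) t
  H_dx : ∀ x t, HasDerivAt (fun s => H (s, t)) (F (x, t)) x
  φ_zero : ∀ t, φ (0, t) = 0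
  G_one : ∀ t, G (1, t) = 0
  H_one : ∀ t, H (1, t) = 0

namespace WaveSolution

/-- The zero solution. -/
def zero : WaveSolution where
  φ := fun _ => 0
  G := fun _ => 0
  H := fun _ => 0
  F := fun _ => 0
  p := fun _ => 0
  q := fun _ => 0
  hφ := continuous_const
  hG := continuous_const
  hH := continuous_const
  hF := continuous_const
  hp := continuous_const
  hq := continuous_const
  φ_dx := fun x _ => hasDerivAt_const x 0
  φ_dt := fun _ t => hasDerivAt_const t 0
  G_dx := fun x _ => hasDerivAt_const x 0
  G_dt := fun _ t => by simpa using hasDerivAt_const t (0 : ℝ)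
  H_dx := fun x _ => hasDerivAt_const x 0
  φ_zero := fun _ => rfl
  G_one := fun _ => rfl
  H_one := fun _ => rfl

/-- The solution `S + c S'`. -/
def addSMul (S : WaveSolution) (c : ℝ) (S' : WaveSolution) : WaveSolution where
  φ := fun z => S.φ z + c * S'.φ z
  G := fun z => S.G z + c * S'.G z
  H := fun z => S.H z + c * S'.H z
  F := fun z => S.F z + c * S'.F z
  p := fun z => S.p z + c * S'.p z
  q := fun z => S.q z + c * S'.q z
  hφ := S.hφ.add (continuous_const.mul S'.hφ)
  hG := S.hG.add (continuous_const.mul S'.hG)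
  hH := S.hH.add (continuous_const.mul S'.hH)
  hF := S.hF.add (continuous_const.mul S'.hF)
  hp := S.hp.add (continuous_const.mul S'.hp)
  hq := S.hq.add (continuous_const.mul S'.hq)
  φ_dx := fun x t => (S.φ_dx x t).add ((S'.φ_dx x t).const_mul c)
  φ_dt := fun x t => (S.φ_dt x t).add ((S'.φ_dt x t).const_mul c)
  G_dx := fun x t => (S.G_dx x t).add ((S'.G_dx x t).const_mul c)
  G_dt := fun x t => by
    convert! (S.G_dt x t).add ((S'.G_dt x t).const_mul c) using 1
    ring
  H_dx := fun x t => (S.H_dx x t).add ((S'.H_dx x t).const_mul c)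
  φ_zero := fun t => by simp [S.φ_zero, S'.φ_zero]
  G_one := fun t => by simp [S.G_one, S'.G_one]
  H_one := fun t => by simp [S.H_one, S'.H_one]

variable (S : WaveSolution)

theorem sq_H_le (t : ℝ) {x : ℝ} (h0 : 0 ≤ x) (h1 : x ≤ 1) :
    S.H (x, t) ^ 2 ≤ ∫ y in (0 : ℝ)..1, S.F (y, t) ^ 2 := by
  have hF := continuous_slice_left S.hF t
  have h := intervalIntegral.integral_eq_sub_of_hasDerivAt (a := x) (b := 1)
    (fun y _ => S.H_dx y t) (hF.intervalIntegrable _ _)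
  rw [S.H_one, zero_sub] at h
  have h2 := sq_intervalIntegral_le hF h0 h1 le_rfl
  rw [h, neg_sq] at h2
  have h3 : 0 ≤ ∫ y in (0 : ℝ)..1, S.F (y, t) ^ 2 :=
    intervalIntegral.integral_nonneg zero_le_one fun _ _ => sq_nonneg _
  nlinarith

theorem integral_sq_H_le {T : ℝ} (hT : 0 ≤ T) :
    ∫ t in (0 : ℝ)..T, ∫ x in (0 : ℝ)..1, S.H (x, t) ^ 2
      ≤ ∫ t in (0 : ℝ)..T, ∫ x in (0 : ℝ)..1, S.F (x, t) ^ 2 := by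
  have hH2 : Continuous fun z => S.H z ^ 2 := S.hH.pow 2
  have hF2 : Continuous fun z => S.F z ^ 2 := S.hF.pow 2
  refine intervalIntegral.integral_mono_on hT
    ((continuous_integral_slice_left hH2 0 1).intervalIntegrable _ _)
    ((continuous_integral_slice_left hF2 0 1).intervalIntegrable _ _) fun t _ => ?_
  calc ∫ x in (0 : ℝ)..1, S.H (x, t) ^ 2
      ≤ ∫ x in (0 : ℝ)..1, ∫ y in (0 : ℝ)..1, S.F (y, t) ^ 2 :=
        intervalIntegral.integral_mono_on zero_le_one
          ((continuous_slice_left hH2 t).intervalIntegrable _ _)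
          intervalIntegrable_const fun x hx => S.sq_H_le t hx.1 hx.2
    _ = _ := by simp

/-- The energy `∫_Ω φ² + G²` at time `t`. -/
def energy (t : ℝ) : ℝ := ∫ x in (0 : ℝ)..1, (S.φ (x, t) ^ 2 + S.G (x, t) ^ 2)

theorem energy_nonneg (t : ℝ) : 0 ≤ S.energy t :=
  intervalIntegral.integral_nonneg zero_le_one fun _ _ => by positivity

theorem energy_le {T t : ℝ} (ht : t ∈ Icc 0 T) :
    S.energy t ≤ Real.exp T * (S.energy 0
      + ∫ t in (0 : ℝ)..T, ∫ x in (0 : ℝ)..1, S.F (x, t) ^ 2) := by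
  have hφ := S.hφ; have hG := S.hG; have hH := S.hH; have hp := S.hp; have hq := S.hq
  have hdiv := integral_divergence
    (f := fun z => -(2 * Real.exp (-z.2) * (S.φ z * S.G z)))
    (f' := fun z => -(2 * Real.exp (-z.2) * (S.q z * S.G z + S.φ z * S.p z)))
    (g := fun z => Real.exp (-z.2) * (S.φ z ^ 2 + S.G z ^ 2))
    (g' := fun z => -Real.exp (-z.2) * (S.φ z ^ 2 + S.G z ^ 2)
      + Real.exp (-z.2) * (2 * S.φ z * S.p z + 2 * S.G z * (S.q z + S.H z)))
    (by fun_prop) (by fun_prop)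
    (fun x t => (((S.φ_dx x t).fun_mul (S.G_dx x t)).const_mul (2 * Real.exp (-t))).fun_neg)
    (fun x t => by
      convert! (((hasDerivAt_id' t).fun_neg.exp).fun_mul
        (((S.φ_dt x t).fun_pow 2).fun_add ((S.G_dt x t).fun_pow 2))) using 1
      push_cast
      ring) 0 t 0 1
  have hle : ∫ s in (0 : ℝ)..t, ∫ x in (0 : ℝ)..1,
        (-(2 * Real.exp (-s) * (S.q (x, s) * S.G (x, s) + S.φ (x, s) * S.p (x, s)))
        + (-Real.exp (-s) * (S.φ (x, s) ^ 2 + S.G (x, s) ^ 2) + Real.exp (-s) *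
          (2 * S.φ (x, s) * S.p (x, s) + 2 * S.G (x, s) * (S.q (x, s) + S.H (x, s)))))
      ≤ ∫ s in (0 : ℝ)..t, ∫ x in (0 : ℝ)..1, S.H (x, s) ^ 2 := by
    refine intervalIntegral.integral_mono_on ht.1
      ((continuous_integral_slice_left (f := fun z =>
        (-(2 * Real.exp (-z.2) * (S.q z * S.G z + S.φ z * S.p z))
        + (-Real.exp (-z.2) * (S.φ z ^ 2 + S.G z ^ 2) + Real.exp (-z.2) *
          (2 * S.φ z * S.p z + 2 * S.G z * (S.q z + S.H z)))))
          (by fun_prop) 0 1).intervalIntegrable _ _)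
      ((continuous_integral_slice_left (hH.pow 2) 0 1).intervalIntegrable _ _) fun s hs => ?_
    refine intervalIntegral.integral_mono_on zero_le_one
      (Continuous.intervalIntegrable (by fun_prop) _ _)
      (Continuous.intervalIntegrable (by fun_prop) _ _) fun x _ => ?_
    have he0 : 0 < Real.exp (-s) := Real.exp_pos _
    have he1 : Real.exp (-s) ≤ 1 := Real.exp_le_one_iff.2 (by linarith [hs.1])
    have e1 : -(2 * Real.exp (-s) * (S.q (x, s) * S.G (x, s) + S.φ (x, s) * S.p (x, s)))
        + (-Real.exp (-s) * (S.φ (x, s) ^ 2 + S.G (x, s) ^ 2) + Real.exp (-s) *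
          (2 * S.φ (x, s) * S.p (x, s) + 2 * S.G (x, s) * (S.q (x, s) + S.H (x, s))))
        = Real.exp (-s) * (S.H (x, s) ^ 2 - S.φ (x, s) ^ 2
          - (S.G (x, s) - S.H (x, s)) ^ 2) := by ring
    rw [e1]
    nlinarith [sq_nonneg (S.φ (x, s)), sq_nonneg (S.G (x, s) - S.H (x, s)),
      sq_nonneg (S.H (x, s)), mul_nonneg he0.le (sq_nonneg (S.φ (x, s))),
      mul_nonneg he0.le (sq_nonneg (S.G (x, s) - S.H (x, s)))]
  rw [hdiv] at hle
  simp only [S.φ_zero, S.G_one, mul_zero, zero_mul, neg_zero, sub_zero,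
    intervalIntegral.integral_zero, zero_add, Real.exp_zero, one_mul] at hle
  rw [intervalIntegral.integral_sub (Continuous.intervalIntegrable (by fun_prop) _ _)
    (Continuous.intervalIntegrable (by fun_prop) _ _), intervalIntegral.integral_const_mul] at hle
  have hHT := S.integral_sq_H_le ht.1
  have hFT : ∫ s in (0 : ℝ)..t, ∫ x in (0 : ℝ)..1, S.F (x, s) ^ 2
      ≤ ∫ s in (0 : ℝ)..T, ∫ x in (0 : ℝ)..1, S.F (x, s) ^ 2 :=
    intervalIntegral.integral_mono_interval le_rfl ht.1 ht.2
      (Eventually.of_forall fun s => intervalIntegral.integral_nonneg zero_le_one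
        fun _ _ => sq_nonneg _)
      ((continuous_integral_slice_left (S.hF.pow 2) 0 1).intervalIntegrable _ _)
  have hfin : Real.exp (-t) * S.energy t
      ≤ S.energy 0 + ∫ s in (0 : ℝ)..T, ∫ x in (0 : ℝ)..1, S.F (x, s) ^ 2 := by
    unfold energy
    linarith
  have hn : 0 ≤ S.energy 0 + ∫ s in (0 : ℝ)..T, ∫ x in (0 : ℝ)..1, S.F (x, s) ^ 2 :=
    (mul_nonneg (Real.exp_pos _).le (S.energy_nonneg t)).trans hfin
  calc S.energy t = Real.exp t * (Real.exp (-t) * S.energy t) := by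
        rw [← mul_assoc, ← Real.exp_add]; simp
    _ ≤ Real.exp t * (S.energy 0
      + ∫ s in (0 : ℝ)..T, ∫ x in (0 : ℝ)..1, S.F (x, s) ^ 2) := by gcongr
    _ ≤ _ := by gcongr; exact ht.2

/-- Hidden regularity: the `L²(0,T)` norm of `φ(x,·)` is controlled by the data. -/
theorem integral_sq_slice_le {T : ℝ} (hT : 0 ≤ T) {x₀ : ℝ} (h0 : 1 / 2 ≤ x₀) (h1 : x₀ ≤ 1) :
    ∫ t in (0 : ℝ)..T, S.φ (x₀, t) ^ 2
      ≤ (4 * T + 6) * Real.exp T * (S.energy 0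
        + ∫ t in (0 : ℝ)..T, ∫ x in (0 : ℝ)..1, S.F (x, t) ^ 2) := by
  have hφ := S.hφ; have hG := S.hG; have hH := S.hH; have hp := S.hp; have hq := S.hq
  have hH2 : Continuous fun z => S.H z ^ 2 := hH.pow 2
  set D := S.energy 0 + ∫ t in (0 : ℝ)..T, ∫ x in (0 : ℝ)..1, S.F (x, t) ^ 2 with hD
  have hdiv := integral_divergence
    (f := fun z => z.1 * (S.φ z ^ 2 + S.G z ^ 2))
    (f' := fun z => 1 * (S.φ z ^ 2 + S.G z ^ 2)
      + z.1 * (2 * S.φ z * S.q z + 2 * S.G z * S.p z))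
    (g := fun z => -(2 * z.1 * (S.φ z * S.G z)))
    (g' := fun z => -(2 * z.1 * (S.p z * S.G z + S.φ z * (S.q z + S.H z))))
    (by fun_prop) (by fun_prop)
    (fun x t => by
      convert! (hasDerivAt_id' x).fun_mul
        (((S.φ_dx x t).fun_pow 2).fun_add ((S.G_dx x t).fun_pow 2)) using 1
      push_cast
      ring)
    (fun x t => (((S.φ_dt x t).fun_mul (S.G_dt x t)).const_mul (2 * x)).fun_neg) 0 T 0 x₀
  have hx₀ : 0 ≤ x₀ := by linarith
  have hE : ∀ t ∈ Icc 0 T, S.energy t ≤ Real.exp T * D := fun t ht => S.energy_le ht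
  have hsub : ∀ t, ∫ x in (0 : ℝ)..x₀, (S.φ (x, t) ^ 2 + S.G (x, t) ^ 2) ≤ S.energy t := fun t =>
    intervalIntegral.integral_mono_interval le_rfl hx₀ h1
      (Eventually.of_forall fun x => by positivity)
      (Continuous.intervalIntegrable (by fun_prop) _ _)
  have hHs : ∀ t, ∫ x in (0 : ℝ)..x₀, S.H (x, t) ^ 2 ≤ ∫ x in (0 : ℝ)..1, S.H (x, t) ^ 2 :=
    fun t => intervalIntegral.integral_mono_interval le_rfl hx₀ h1
      (Eventually.of_forall fun x => by positivity)
      (Continuous.intervalIntegrable (by fun_prop) _ _)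
  have hexp : 1 ≤ Real.exp T := Real.one_le_exp hT
  have hFn : 0 ≤ ∫ t in (0 : ℝ)..T, ∫ x in (0 : ℝ)..1, S.F (x, t) ^ 2 :=
    intervalIntegral.integral_nonneg hT fun t _ =>
      intervalIntegral.integral_nonneg zero_le_one fun _ _ => sq_nonneg _
  have hDn : 0 ≤ D := add_nonneg (S.energy_nonneg 0) hFn
  -- the volume terms
  have hvol : ∫ t in (0 : ℝ)..T, ∫ x in (0 : ℝ)..x₀,
      ((1 * (S.φ (x, t) ^ 2 + S.G (x, t) ^ 2)
      + x * (2 * S.φ (x, t) * S.q (x, t) + 2 * S.G (x, t) * S.p (x, t)))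
      + -(2 * x * (S.p (x, t) * S.G (x, t) + S.φ (x, t) * (S.q (x, t) + S.H (x, t)))))
      ≤ ∫ t in (0 : ℝ)..T, (2 * (Real.exp T * D) + ∫ x in (0 : ℝ)..1, S.H (x, t) ^ 2) := by
    refine intervalIntegral.integral_mono_on hT
      ((continuous_integral_slice_left (f := fun z => ((1 * (S.φ z ^ 2 + S.G z ^ 2)
      + z.1 * (2 * S.φ z * S.q z + 2 * S.G z * S.p z))
      + -(2 * z.1 * (S.p z * S.G z + S.φ z * (S.q z + S.H z)))))
          (by fun_prop) 0 x₀).intervalIntegrable _ _)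
      ((continuous_const.add (continuous_integral_slice_left hH2 0 1)).intervalIntegrable _ _) fun t ht => ?_
    refine le_trans (b := ∫ x in (0 : ℝ)..x₀,
      (2 * (S.φ (x, t) ^ 2 + S.G (x, t) ^ 2) + S.H (x, t) ^ 2)) ?_ ?_
    · refine intervalIntegral.integral_mono_on hx₀
        (Continuous.intervalIntegrable (by fun_prop) _ _)
        (Continuous.intervalIntegrable (by fun_prop) _ _) fun x hx => ?_
      have hx1 : x ≤ 1 := hx.2.trans h1
      nlinarith [sq_nonneg (S.G (x, t)), sq_nonneg (S.φ (x, t) + S.H (x, t)),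
        sq_nonneg (S.φ (x, t)), sq_nonneg (S.H (x, t)), hx.1,
        mul_nonneg hx.1 (sq_nonneg (S.φ (x, t) + S.H (x, t))),
        mul_nonneg (sub_nonneg.2 hx1) (sq_nonneg (S.φ (x, t))),
        mul_nonneg (sub_nonneg.2 hx1) (sq_nonneg (S.H (x, t)))]
    · rw [intervalIntegral.integral_add (Continuous.intervalIntegrable (by fun_prop) _ _)
        (Continuous.intervalIntegrable (by fun_prop) _ _), intervalIntegral.integral_const_mul]
      linarith [hsub t, hE t ht, hHs t]
  rw [hdiv, intervalIntegral.integral_add intervalIntegrable_const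
    ((continuous_integral_slice_left hH2 0 1).intervalIntegrable _ _),
    intervalIntegral.integral_const] at hvol
  -- the terms at the initial and final times
  have hend : ∀ t ∈ Icc 0 T, |∫ x in (0 : ℝ)..x₀, 2 * x * (S.φ (x, t) * S.G (x, t))|
      ≤ Real.exp T * D := by
    intro t ht
    refine le_trans (intervalIntegral.abs_integral_le_integral_abs hx₀) ?_
    refine le_trans ?_ ((hsub t).trans (hE t ht))
    refine intervalIntegral.integral_mono_on hx₀
        (Continuous.intervalIntegrable (by fun_prop) _ _)
        (Continuous.intervalIntegrable (by fun_prop) _ _) fun x hx => ?_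
    have hx1 : x ≤ 1 := hx.2.trans h1
    rw [abs_le]
    constructor <;>
    nlinarith [sq_nonneg (S.φ (x, t) + S.G (x, t)), sq_nonneg (S.φ (x, t) - S.G (x, t)),
        mul_nonneg hx.1 (sq_nonneg (S.φ (x, t) + S.G (x, t))),
        mul_nonneg hx.1 (sq_nonneg (S.φ (x, t) - S.G (x, t))),
        mul_nonneg (sub_nonneg.2 hx1) (sq_nonneg (S.φ (x, t))),
        mul_nonneg (sub_nonneg.2 hx1) (sq_nonneg (S.G (x, t)))]
  have hbt : ∫ x in (0 : ℝ)..x₀, (-(2 * x * (S.φ (x, T) * S.G (x, T)))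
      - -(2 * x * (S.φ (x, 0) * S.G (x, 0))))
      = -(∫ x in (0 : ℝ)..x₀, 2 * x * (S.φ (x, T) * S.G (x, T)))
        - -∫ x in (0 : ℝ)..x₀, 2 * x * (S.φ (x, 0) * S.G (x, 0)) := by
    rw [intervalIntegral.integral_sub (Continuous.intervalIntegrable (by fun_prop) _ _)
      (Continuous.intervalIntegrable (by fun_prop) _ _), intervalIntegral.integral_neg,
      intervalIntegral.integral_neg]
  have hT' := abs_le.1 (hend T ⟨hT, le_rfl⟩)
  have h0' := abs_le.1 (hend 0 ⟨le_rfl, hT⟩)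
  have hmain : (1 / 2) * ∫ t in (0 : ℝ)..T, S.φ (x₀, t) ^ 2
      ≤ ∫ t in (0 : ℝ)..T, (x₀ * (S.φ (x₀, t) ^ 2 + S.G (x₀, t) ^ 2)
        - 0 * (S.φ (0, t) ^ 2 + S.G (0, t) ^ 2)) := by
    rw [← intervalIntegral.integral_const_mul]
    refine intervalIntegral.integral_mono_on hT
        (Continuous.intervalIntegrable (by fun_prop) _ _)
        (Continuous.intervalIntegrable (by fun_prop) _ _) fun t _ => ?_
    nlinarith [sq_nonneg (S.φ (x₀, t)), sq_nonneg (S.G (x₀, t))]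
  have hH1 := S.integral_sq_H_le hT
  have hHD : ∫ t in (0 : ℝ)..T, ∫ x in (0 : ℝ)..1, S.H (x, t) ^ 2 ≤ Real.exp T * D := by
    have := S.energy_nonneg 0
    nlinarith
  simp only [sub_zero, smul_eq_mul] at hvol hmain
  linarith

end WaveSolution

end

noncomputable section

namespace WaveSolution

/-! ### Green's formula -/

/-- Green's formula for a classical solution and a `C²` function `w` with `w(0,·) = 0`,
`∂ₓw(1,·) = 0` and `(w, ∂ₜw)(·,T) = (0,0)`. -/
theorem green (S : WaveSolution) {T : ℝ} (hT : 0 ≤ T) {w wt wx wtt wtx wxx : ℝ × ℝ → ℝ}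
    (hw : Continuous w) (hwt : Continuous wt) (hwx : Continuous wx) (hwtt : Continuous wtt)
    (hwtx : Continuous wtx) (hwxx : Continuous wxx)
    (w_dx : ∀ x t, HasDerivAt (fun s => w (s, t)) (wx (x, t)) x)
    (wt_dt : ∀ x t, HasDerivAt (fun s => wt (x, s)) (wtt (x, t)) t)
    (wt_dx : ∀ x t, HasDerivAt (fun s => wt (s, t)) (wtx (x, t)) x)
    (wx_dt : ∀ x t, HasDerivAt (fun s => wx (x, s)) (wtx (x, t)) t)
    (wx_dx : ∀ x t, HasDerivAt (fun s => wx (s, t)) (wxx (x, t)) x)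
    (w_zero : ∀ t, w (0, t) = 0) (wt_zero : ∀ t, wt (0, t) = 0) (wx_one : ∀ t, wx (1, t) = 0)
    (wt_T : ∀ x, wt (x, T) = 0) (wx_T : ∀ x, wx (x, T) = 0) :
    ∫ z, S.φ z * (wtt z - wxx z) ∂(muQ T) = (∫ z, S.F z * w z ∂(muQ T))
      - (∫ x in (0 : ℝ)..1, S.φ (x, 0) * wt (x, 0)) - ∫ x in (0 : ℝ)..1, S.G (x, 0) * wx (x, 0) := by
  have hφ := S.hφ; have hG := S.hG; have hH := S.hH; have hp := S.hp; have hq := S.hq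
  have hF := S.hF
  have hdiv := integral_divergence
    (f := fun z => -(S.φ z * wx z + S.H z * w z + S.G z * wt z))
    (f' := fun z => -((S.q z * wx z + S.φ z * wxx z) + (S.F z * w z + S.H z * wx z)
      + (S.p z * wt z + S.G z * wtx z)))
    (g := fun z => S.φ z * wt z + S.G z * wx z)
    (g' := fun z => (S.p z * wt z + S.φ z * wtt z)
      + ((S.q z + S.H z) * wx z + S.G z * wtx z))
    (by fun_prop) (by fun_prop)
    (fun x t => ((((S.φ_dx x t).fun_mul (wx_dx x t)).fun_add
      ((S.H_dx x t).fun_mul (w_dx x t))).fun_add ((S.G_dx x t).fun_mul (wt_dx x t))).fun_neg)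
    (fun x t => ((S.φ_dt x t).fun_mul (wt_dt x t)).fun_add ((S.G_dt x t).fun_mul (wx_dt x t)))
    0 T 0 1
  have hsub : (∫ z, S.φ z * (wtt z - wxx z) ∂(muQ T)) - ∫ z, S.F z * w z ∂(muQ T)
      = ∫ t in (0 : ℝ)..T, ∫ x in (0 : ℝ)..1,
        (-((S.q (x, t) * wx (x, t) + S.φ (x, t) * wxx (x, t))
          + (S.F (x, t) * w (x, t) + S.H (x, t) * wx (x, t))
          + (S.p (x, t) * wt (x, t) + S.G (x, t) * wtx (x, t)))
        + ((S.p (x, t) * wt (x, t) + S.φ (x, t) * wtt (x, t))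
          + ((S.q (x, t) + S.H (x, t)) * wx (x, t) + S.G (x, t) * wtx (x, t)))) := by
    rw [← integral_sub (Continuous.integrable_muQ (by fun_prop) T)
      (Continuous.integrable_muQ (by fun_prop) T),
      integral_muQ_eq_interval hT (by fun_prop)]
    refine intervalIntegral.integral_congr fun t _ => intervalIntegral.integral_congr fun x _ => ?_
    ring
  rw [hdiv] at hsub
  simp only [w_zero, wt_zero, wx_one, wt_T, wx_T, S.φ_zero, S.G_one, S.H_one, mul_zero, zero_mul,
    add_zero, neg_zero, sub_zero, intervalIntegral.integral_zero, zero_add, zero_sub,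
    intervalIntegral.integral_neg] at hsub
  rw [intervalIntegral.integral_add (Continuous.intervalIntegrable (by fun_prop) _ _)
    (Continuous.intervalIntegrable (by fun_prop) _ _)] at hsub
  linarith

end WaveSolution

/-! ### The observability inequality for classical solutions -/

theorem hasDerivAt_max_zero_sq (s : ℝ) : HasDerivAt (fun s : ℝ => max s 0 ^ 2) (2 * max s 0) s := by
  refine hasDerivAt_of_hasDerivAt_of_ne' (f := fun s : ℝ => max s 0 ^ 2)
    (g := fun s : ℝ => 2 * max s 0) (x := 0) (fun y hy => ?_)
    (by fun_prop) (by fun_prop) s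
  rcases hy.lt_or_gt with h | h
  · rw [max_eq_right h.le, mul_zero]
    refine (hasDerivAt_const y (0 : ℝ)).congr_of_eventuallyEq ?_
    filter_upwards [Iio_mem_nhds h] with z hz
    simp [max_eq_right (le_of_lt (show z < 0 from hz))]
  · rw [max_eq_left h.le]
    have h2 : HasDerivAt (fun z : ℝ => z ^ 2) (2 * y) y := by
      simpa using hasDerivAt_pow 2 y
    refine h2.congr_of_eventuallyEq ?_
    filter_upwards [Ioi_mem_nhds h] with z hz
    simp [max_eq_left (le_of_lt (show 0 < z from hz))]

theorem HasDerivAt.max_zero_sq {f : ℝ → ℝ} {f' x : ℝ} (hf : HasDerivAt f f' x) :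
    HasDerivAt (fun s => max (f s) 0 ^ 2) (2 * max (f x) 0 * f') x :=
  (hasDerivAt_max_zero_sq (f x)).comp x hf

/-- The pointwise inequality behind the energy estimates with a potential of size `m²`. -/
theorem neg_sq_le_weighted_energy {m φ H F b s : ℝ} (hm : 1 ≤ m) (hs : |s| ≤ 1)
    (hF : |F| ≤ m ^ 2 * |φ| + |b|) :
    -b ^ 2 ≤ 2 * m * φ ^ 2 + 3 * m * (H ^ 2 / m ^ 2) + 2 * H * F / m ^ 2 + 2 * s * φ * H := by
  have hm0 : 0 < m := by linarith
  obtain ⟨h, rfl⟩ : ∃ h, H = m * h := ⟨H / m, by field_simp⟩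
  obtain ⟨f, rfl⟩ : ∃ f, F = m * f := ⟨F / m, by field_simp⟩
  have e1 : (m * h) ^ 2 / m ^ 2 = h ^ 2 := by field_simp
  have e2 : 2 * (m * h) * (m * f) / m ^ 2 = 2 * (h * f) := by field_simp
  rw [e1, e2]
  have hf : |f| ≤ m * |φ| + |b| := by
    rw [abs_mul, abs_of_pos hm0] at hF
    have hb := abs_nonneg b
    have : m * |f| ≤ m * (m * |φ| + |b|) := by nlinarith
    exact le_of_mul_le_mul_left this hm0
  have h1 : -(|h| * (m * |φ| + |b|)) ≤ h * f := by
    have := neg_abs_le (h * f)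
    rw [abs_mul] at this
    nlinarith [abs_nonneg h]
  have h2 : -(m * (|φ| * |h|)) ≤ s * φ * (m * h) := by
    have h3 := neg_abs_le (s * φ * (m * h))
    have h4 : |s * φ * (m * h)| = |s| * (m * (|φ| * |h|)) := by
      rw [abs_mul, abs_mul, abs_mul, abs_of_pos hm0]; ring
    have h5 : 0 ≤ m * (|φ| * |h|) := by positivity
    nlinarith
  have e3 := sq_abs φ; have e4 := sq_abs h; have e5 := sq_abs b
  have k1 : 0 ≤ m * (|φ| - |h|) ^ 2 := by positivity
  have k2 : 0 ≤ (|h| - |b|) ^ 2 := sq_nonneg _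
  nlinarith [sq_nonneg h, mul_nonneg (sub_nonneg.2 hm) (sq_nonneg h)]

namespace WaveSolution

/-- The weight of the sideways energy estimate; it vanishes outside the sideways cone
`1 - x < t < T - 1 + x` of the observation `{1} × (0,T)`. -/
def coneWeight (T m : ℝ) (z : ℝ × ℝ) : ℝ :=
  Real.exp (4 * m * z.1) * (max (z.2 - 1 + z.1) 0 ^ 2 * max (T - 1 + z.1 - z.2) 0 ^ 2)

theorem continuous_coneWeight (T m : ℝ) : Continuous (coneWeight T m) := by
  unfold coneWeight; fun_prop

theorem coneWeight_nonneg (T m : ℝ) (z : ℝ × ℝ) : 0 ≤ coneWeight T m z := by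
  unfold coneWeight; positivity

theorem coneWeight_le {T m x t : ℝ} (hT : 2 < T) (hm : 1 ≤ m) (hx : x ∈ Icc (0 : ℝ) 1)
    (ht : t ∈ Icc 0 T) : coneWeight T m (x, t) ≤ Real.exp (4 * m) * T ^ 4 := by
  unfold coneWeight
  have h1 : max (t - 1 + x) 0 ≤ T := max_le (by linarith [hx.2, ht.2]) (by linarith)
  have h2 : max (T - 1 + x - t) 0 ≤ T := max_le (by linarith [hx.2, ht.1]) (by linarith)
  have h3 : 4 * m * x ≤ 4 * m := by nlinarith [hx.2]
  calc Real.exp (4 * m * x) * (max (t - 1 + x) 0 ^ 2 * max (T - 1 + x - t) 0 ^ 2)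
      ≤ Real.exp (4 * m) * (T ^ 2 * T ^ 2) := by gcongr
    _ = _ := by ring

/-- The sideways energy estimate. -/
theorem integral_coneWeight_le (S : WaveSolution) {T m : ℝ} (hT : 2 < T) (hm : 1 ≤ m)
    {b : ℝ × ℝ → ℝ} (hb : Integrable (fun z => b z ^ 2) (muQ T))
    (hF : ∀ᵐ z ∂(muQ T), |S.F z| ≤ m ^ 2 * |S.φ z| + |b z|) :
    ∫ z, coneWeight T m z * (S.φ z ^ 2 + S.G z ^ 2) ∂(muQ T)
      ≤ Real.exp (4 * m) * T ^ 4 *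
        ((∫ t in (0 : ℝ)..T, S.φ (1, t) ^ 2) + ∫ z, b z ^ 2 ∂(muQ T)) := by
  have hT0 : 0 ≤ T := by linarith
  have hφ := S.hφ; have hG := S.hG; have hH := S.hH; have hp := S.hp; have hq := S.hq
  have hFc := S.hF
  set e : ℝ × ℝ → ℝ := fun z => Real.exp (4 * m * z.1) with he
  set a₁ : ℝ × ℝ → ℝ := fun z => max (z.2 - 1 + z.1) 0 with ha₁
  set a₂ : ℝ × ℝ → ℝ := fun z => max (T - 1 + z.1 - z.2) 0 with ha₂
  set χ := coneWeight T m with hχ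
  have hχc : Continuous χ := continuous_coneWeight T m
  set σ : ℝ × ℝ → ℝ := fun z => e z * (2 * a₁ z * a₂ z ^ 2 + a₁ z ^ 2 * (2 * a₂ z)) with hσ
  set τ : ℝ × ℝ → ℝ := fun z => e z * (2 * a₁ z * a₂ z ^ 2 - a₁ z ^ 2 * (2 * a₂ z)) with hτ
  have hσc : Continuous σ := by fun_prop
  have hτc : Continuous τ := by fun_prop
  have χ_dx : ∀ x t, HasDerivAt (fun s => χ (s, t)) (4 * m * χ (x, t) + σ (x, t)) x := by
    intro x t
    have d1 : HasDerivAt (fun s => max (t - 1 + s) 0 ^ 2) (2 * max (t - 1 + x) 0 * 1) x :=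
      ((hasDerivAt_id' x).const_add (t - 1)).max_zero_sq
    have d2 : HasDerivAt (fun s => max (T - 1 + s - t) 0 ^ 2)
        (2 * max (T - 1 + x - t) 0 * 1) x :=
      (((hasDerivAt_id' x).const_add (T - 1)).sub_const t).max_zero_sq
    convert! (((hasDerivAt_id' x).const_mul (4 * m)).exp).fun_mul (d1.fun_mul d2) using 1
    simp only [hχ, coneWeight, hσ, he, ha₁, ha₂]
    ring
  have χ_dt : ∀ x t, HasDerivAt (fun s => χ (x, s)) (τ (x, t)) t := by
    intro x t
    have d1 : HasDerivAt (fun s => max (s - 1 + x) 0 ^ 2) (2 * max (t - 1 + x) 0 * 1) t :=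
      (((hasDerivAt_id' t).sub_const 1).add_const x).max_zero_sq
    have d2 : HasDerivAt (fun s => max (T - 1 + x - s) 0 ^ 2)
        (2 * max (T - 1 + x - t) 0 * (-1)) t :=
      ((hasDerivAt_id' t).const_sub (T - 1 + x)).max_zero_sq
    convert! (d1.fun_mul d2).const_mul (Real.exp (4 * m * x)) using 1
    simp only [hτ, he, ha₁, ha₂]
    ring
  have hστ : ∀ z, |τ z| ≤ σ z := by
    intro z
    have h1 : 0 ≤ a₁ z := le_max_right _ _
    have h2 : 0 ≤ a₂ z := le_max_right _ _
    have h3 : 0 ≤ e z := (Real.exp_pos _).le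
    have k1 : 0 ≤ e z * (2 * a₁ z * a₂ z ^ 2) := by positivity
    have k2 : 0 ≤ e z * (a₁ z ^ 2 * (2 * a₂ z)) := by positivity
    simp only [hτ, hσ]
    rw [abs_le]
    constructor <;> linarith
  set I : ℝ × ℝ → ℝ := fun z => ((4 * m * χ z + σ z) * (S.φ z ^ 2 + S.G z ^ 2 + S.H z ^ 2 / m ^ 2)
      + χ z * (2 * S.φ z * S.q z + 2 * S.G z * S.p z + 2 * S.H z * S.F z / m ^ 2))
      + -(2 * (τ z * (S.φ z * S.G z) + χ z * (S.p z * S.G z + S.φ z * (S.q z + S.H z)))) with hI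
  have hIc : Continuous I := by fun_prop
  have hdiv := integral_divergence
    (f := fun z => χ z * (S.φ z ^ 2 + S.G z ^ 2 + S.H z ^ 2 / m ^ 2))
    (f' := fun z => (4 * m * χ z + σ z) * (S.φ z ^ 2 + S.G z ^ 2 + S.H z ^ 2 / m ^ 2)
      + χ z * (2 * S.φ z * S.q z + 2 * S.G z * S.p z + 2 * S.H z * S.F z / m ^ 2))
    (g := fun z => -(2 * (χ z * (S.φ z * S.G z))))
    (g' := fun z => -(2 * (τ z * (S.φ z * S.G z)
      + χ z * (S.p z * S.G z + S.φ z * (S.q z + S.H z)))))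
    (by fun_prop) (by fun_prop)
    (fun x t => by
      convert! (χ_dx x t).fun_mul ((((S.φ_dx x t).fun_pow 2).fun_add
        ((S.G_dx x t).fun_pow 2)).fun_add (((S.H_dx x t).fun_pow 2).div_const (m ^ 2))) using 1
      push_cast
      ring)
    (fun x t => (((χ_dt x t).fun_mul ((S.φ_dt x t).fun_mul (S.G_dt x t))).const_mul 2).fun_neg)
    0 T 0 1
  have hpt : ∀ᵐ z ∂(muQ T), χ z * (S.φ z ^ 2 + S.G z ^ 2)
      - Real.exp (4 * m) * T ^ 4 * b z ^ 2 ≤ I z := by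
    filter_upwards [hF, ae_restrict_mem (measurableSet_Ioo.prod measurableSet_Ioo)] with z hz hzQ
    have hχ0 : 0 ≤ χ z := coneWeight_nonneg T m z
    have hχ1 : χ z ≤ Real.exp (4 * m) * T ^ 4 :=
      coneWeight_le hT hm ⟨hzQ.1.1.le, hzQ.1.2.le⟩ ⟨hzQ.2.1.le, hzQ.2.2.le⟩
    have hcore := neg_sq_le_weighted_energy (H := S.H z) (s := -1) hm (by simp) hz
    have h1 : 0 ≤ σ z * (S.φ z ^ 2 + S.G z ^ 2 + S.H z ^ 2 / m ^ 2) - 2 * τ z * (S.φ z * S.G z) := by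
      have h2 := abs_le.1 (hστ z)
      have h3 : 0 ≤ σ z * (S.H z ^ 2 / m ^ 2) :=
        mul_nonneg ((abs_nonneg _).trans (hστ z)) (by positivity)
      nlinarith [mul_nonneg (sub_nonneg.2 h2.2) (sq_nonneg (S.φ z + S.G z)),
        mul_nonneg (by linarith : 0 ≤ σ z + τ z) (sq_nonneg (S.φ z - S.G z))]
    have h4 : S.φ z ^ 2 + S.G z ^ 2 - b z ^ 2 ≤ 4 * m * (S.φ z ^ 2 + S.G z ^ 2 + S.H z ^ 2 / m ^ 2)
        + 2 * S.H z * S.F z / m ^ 2 - 2 * S.φ z * S.H z := by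
      have h5 : 0 ≤ S.H z ^ 2 / m ^ 2 := by positivity
      nlinarith [sq_nonneg (S.φ z), sq_nonneg (S.G z), mul_nonneg (sub_nonneg.2 hm) h5,
        mul_nonneg (sub_nonneg.2 hm) (sq_nonneg (S.φ z)),
        mul_nonneg (sub_nonneg.2 hm) (sq_nonneg (S.G z))]
    have h6 := mul_le_mul_of_nonneg_left h4 hχ0
    have h7 : χ z * b z ^ 2 ≤ Real.exp (4 * m) * T ^ 4 * b z ^ 2 := by gcongr
    have h8 : I z = χ z * (4 * m * (S.φ z ^ 2 + S.G z ^ 2 + S.H z ^ 2 / m ^ 2)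
        + 2 * S.H z * S.F z / m ^ 2 - 2 * S.φ z * S.H z)
        + (σ z * (S.φ z ^ 2 + S.G z ^ 2 + S.H z ^ 2 / m ^ 2) - 2 * τ z * (S.φ z * S.G z)) := by
      simp only [hI]; ring
    rw [h8]
    linarith
  have hint := integral_mono_ae
    ((Continuous.integrable_muQ (f := fun z => χ z * (S.φ z ^ 2 + S.G z ^ 2))
      (by fun_prop) T).sub (hb.const_mul _)) (hIc.integrable_muQ T) hpt
  rw [integral_sub' (Continuous.integrable_muQ (by fun_prop) T) (hb.const_mul _),
    integral_const_mul, integral_muQ_eq_interval hT0 hIc, hdiv] at hint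
  have hχ0 : ∀ x ∈ Icc (0 : ℝ) 1, χ (x, 0) = 0 := fun x hx => by
    have : max ((0 : ℝ) - 1 + x) 0 = 0 := max_eq_right (by linarith [hx.2])
    simp only [hχ, coneWeight, this]
    ring
  have hχT : ∀ x ∈ Icc (0 : ℝ) 1, χ (x, T) = 0 := fun x hx => by
    have : max (T - 1 + x - T) 0 = 0 := max_eq_right (by linarith [hx.2])
    simp only [hχ, coneWeight, this]
    ring
  have hz : ∫ x in (0 : ℝ)..1, (-(2 * (χ (x, T) * (S.φ (x, T) * S.G (x, T))))
      - -(2 * (χ (x, 0) * (S.φ (x, 0) * S.G (x, 0))))) = 0 := by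
    rw [intervalIntegral.integral_congr (g := fun _ => (0 : ℝ)), intervalIntegral.integral_zero]
    intro x hx
    rw [uIcc_of_le zero_le_one] at hx
    simp [hχ0 x hx, hχT x hx]
  have hbd : ∫ t in (0 : ℝ)..T, (χ (1, t) * (S.φ (1, t) ^ 2 + S.G (1, t) ^ 2 + S.H (1, t) ^ 2 / m ^ 2)
      - χ (0, t) * (S.φ (0, t) ^ 2 + S.G (0, t) ^ 2 + S.H (0, t) ^ 2 / m ^ 2))
      ≤ Real.exp (4 * m) * T ^ 4 * ∫ t in (0 : ℝ)..T, S.φ (1, t) ^ 2 := by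
    rw [← intervalIntegral.integral_const_mul]
    refine intervalIntegral.integral_mono_on hT0
        (Continuous.intervalIntegrable (by fun_prop) _ _)
        (Continuous.intervalIntegrable (by fun_prop) _ _) fun t ht => ?_
    have h1 : χ (1, t) ≤ Real.exp (4 * m) * T ^ 4 := coneWeight_le hT hm (by simp) ht
    have h2 : 0 ≤ χ (0, t) * (S.φ (0, t) ^ 2 + S.G (0, t) ^ 2 + S.H (0, t) ^ 2 / m ^ 2) :=
      mul_nonneg (coneWeight_nonneg _ _ _) (by positivity)
    have h3 : χ (1, t) * (S.φ (1, t) ^ 2 + S.G (1, t) ^ 2 + S.H (1, t) ^ 2 / m ^ 2)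
        = χ (1, t) * S.φ (1, t) ^ 2 := by
      rw [S.G_one, S.H_one]; ring
    rw [h3]
    linarith [mul_le_mul_of_nonneg_right h1 (sq_nonneg (S.φ (1, t)))]
  rw [hz] at hint
  linarith

end WaveSolution

end

noncomputable section

namespace WaveSolution

set_option maxHeartbeats 800000 in
/-- The energy at time `0` is controlled by the weighted energy in the sideways cone. -/
theorem energy_zero_le (S : WaveSolution) {T : ℝ} (hT : 2 < T) {ρ ρ' : ℝ → ℝ}
    (hρ' : Continuous ρ') (hρd : ∀ t, HasDerivAt ρ (ρ' t) t) (hρ0 : ρ 0 = 1) (hρT : ρ T = 0)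
    (hρb : ∀ t ∈ Icc 0 T, ρ t ∈ Icc (0 : ℝ) 1) {m : ℝ} (hm : 1 ≤ m) {K : ℝ}
    (hK : ∀ x ∈ Icc (0 : ℝ) 1, ∀ t ∈ Icc 0 T, ρ' t ^ 2 ≤ K * coneWeight T m (x, t))
    {b : ℝ × ℝ → ℝ} (hb : Integrable (fun z => b z ^ 2) (muQ T))
    (hF : ∀ᵐ z ∂(muQ T), |S.F z| ≤ m ^ 2 * |S.φ z| + |b z|) :
    S.energy 0 ≤ 3 * m ^ 2 * (Real.exp (4 * m * T) *
      (K * (∫ z, coneWeight T m z * (S.φ z ^ 2 + S.G z ^ 2) ∂(muQ T))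
        + ∫ z, b z ^ 2 ∂(muQ T))) := by
  have hT0 : 0 ≤ T := by linarith
  have hm0 : 0 < m := by linarith
  have hφ := S.hφ; have hG := S.hG; have hH := S.hH; have hp := S.hp; have hq := S.hq
  have hFc := S.hF
  have hρ : Continuous ρ := continuous_iff_continuousAt.2 fun t => (hρd t).continuousAt
  set J : ℝ × ℝ → ℝ := fun z => ∫ s in T..z.2, ρ s * S.F (z.1, s) with hJ
  set Z : ℝ × ℝ → ℝ := fun z => -∫ s in T..z.2, ρ s * S.H (z.1, s) with hZ
  have hJc : Continuous J := intervalIntegral.continuous_parametric_primitive_of_continuous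
    (f := fun x s => ρ s * S.F (x, s)) (by simp only [Function.uncurry_def]; fun_prop)
  have hZc : Continuous Z := (intervalIntegral.continuous_parametric_primitive_of_continuous
    (f := fun x s => ρ s * S.H (x, s)) (by simp only [Function.uncurry_def]; fun_prop)).neg
  have primitive_dt : ∀ (f : ℝ × ℝ → ℝ), Continuous f → ∀ x t,
      HasDerivAt (fun r => ∫ s in T..r, ρ s * f (x, s)) (ρ t * f (x, t)) t := by
    intro f hf x t
    have hc : Continuous fun s => ρ s * f (x, s) := by fun_prop
    exact intervalIntegral.integral_hasDerivAt_right (hc.intervalIntegrable _ _)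
      (hc.stronglyMeasurableAtFilter _ _) hc.continuousAt
  have J_dt : ∀ x t, HasDerivAt (fun s => J (x, s)) (ρ t * S.F (x, t)) t :=
    primitive_dt S.F hFc
  have Z_dt : ∀ x t, HasDerivAt (fun s => Z (x, s)) (-(ρ t * S.H (x, t))) t :=
    fun x t => (primitive_dt S.H hH x t).fun_neg
  have Z_dx : ∀ x t, HasDerivAt (fun s => Z (s, t)) (-J (x, t)) x := fun x t =>
    (hasDerivAt_integral_slice (f := fun z => ρ z.2 * S.H z) (f' := fun z => ρ z.2 * S.F z)
      (by fun_prop) (by fun_prop) (fun y s => (S.H_dx y s).const_mul (ρ s)) T t x).fun_neg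
  have Z_one : ∀ t, Z (1, t) = 0 := fun t => by simp [hZ, S.H_one]
  set g : ℝ × ℝ → ℝ := fun z => ρ z.2 * S.G z + Z z with hg
  have hgc : Continuous g := by fun_prop
  have g_dx : ∀ x t, HasDerivAt (fun s => g (s, t)) (ρ t * S.p (x, t) + -J (x, t)) x :=
    fun x t => ((S.G_dx x t).const_mul (ρ t)).fun_add (Z_dx x t)
  have g_dt : ∀ x t, HasDerivAt (fun s => g (x, s)) (ρ' t * S.G (x, t)
      + ρ t * (S.q (x, t) + S.H (x, t)) + -(ρ t * S.H (x, t))) t :=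
    fun x t => ((hρd t).fun_mul (S.G_dt x t)).fun_add (Z_dt x t)
  have ψ_dx : ∀ x t, HasDerivAt (fun s => ρ t * S.φ (s, t)) (ρ t * S.q (x, t)) x :=
    fun x t => (S.φ_dx x t).const_mul (ρ t)
  have ψ_dt : ∀ x t, HasDerivAt (fun s => ρ s * S.φ (x, s))
      (ρ' t * S.φ (x, t) + ρ t * S.p (x, t)) t :=
    fun x t => (hρd t).fun_mul (S.φ_dt x t)
  have hdiv := integral_divergence
    (f := fun z => -(2 * Real.exp (4 * m * z.2) * (ρ z.2 * S.φ z * g z)))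
    (f' := fun z => -(2 * Real.exp (4 * m * z.2) * (ρ z.2 * S.q z * g z
      + ρ z.2 * S.φ z * (ρ z.2 * S.p z + -J z))))
    (g := fun z => Real.exp (4 * m * z.2) * ((ρ z.2 * S.φ z) ^ 2 + g z ^ 2 + J z ^ 2 / m ^ 2))
    (g' := fun z => Real.exp (4 * m * z.2) * (4 * m) *
        ((ρ z.2 * S.φ z) ^ 2 + g z ^ 2 + J z ^ 2 / m ^ 2)
      + Real.exp (4 * m * z.2) * (2 * (ρ z.2 * S.φ z) * (ρ' z.2 * S.φ z + ρ z.2 * S.p z)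
        + 2 * g z * (ρ' z.2 * S.G z + ρ z.2 * (S.q z + S.H z) + -(ρ z.2 * S.H z))
        + 2 * J z * (ρ z.2 * S.F z) / m ^ 2))
    (by fun_prop) (by fun_prop)
    (fun x t => (((ψ_dx x t).fun_mul (g_dx x t)).const_mul (2 * Real.exp (4 * m * t))).fun_neg)
    (fun x t => by
      convert! (((hasDerivAt_id' t).const_mul (4 * m)).exp).fun_mul
        ((((ψ_dt x t).fun_pow 2).fun_add ((g_dt x t).fun_pow 2)).fun_add
          (((J_dt x t).fun_pow 2).div_const (m ^ 2))) using 1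
      push_cast
      ring) 0 T 0 1
  set I : ℝ × ℝ → ℝ := fun z => -(2 * Real.exp (4 * m * z.2) * (ρ z.2 * S.q z * g z
      + ρ z.2 * S.φ z * (ρ z.2 * S.p z + -J z)))
      + (Real.exp (4 * m * z.2) * (4 * m) *
        ((ρ z.2 * S.φ z) ^ 2 + g z ^ 2 + J z ^ 2 / m ^ 2)
      + Real.exp (4 * m * z.2) * (2 * (ρ z.2 * S.φ z) * (ρ' z.2 * S.φ z + ρ z.2 * S.p z)
        + 2 * g z * (ρ' z.2 * S.G z + ρ z.2 * (S.q z + S.H z) + -(ρ z.2 * S.H z))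
        + 2 * J z * (ρ z.2 * S.F z) / m ^ 2)) with hI
  have hIc : Continuous I := by fun_prop
  have hpt : ∀ᵐ z ∂(muQ T), -(Real.exp (4 * m * T) *
      (K * (coneWeight T m z * (S.φ z ^ 2 + S.G z ^ 2)) + b z ^ 2)) ≤ I z := by
    filter_upwards [hF, ae_restrict_mem (measurableSet_Ioo.prod measurableSet_Ioo)] with z hz hzQ
    have hx : z.1 ∈ Icc (0 : ℝ) 1 := ⟨hzQ.1.1.le, hzQ.1.2.le⟩
    have ht : z.2 ∈ Icc 0 T := ⟨hzQ.2.1.le, hzQ.2.2.le⟩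
    have hr := hρb z.2 ht
    have hF' : |ρ z.2 * S.F z| ≤ m ^ 2 * |ρ z.2 * S.φ z| + |b z| := by
      rw [abs_mul, abs_mul, abs_of_nonneg hr.1]
      nlinarith [abs_nonneg (b z), mul_le_mul_of_nonneg_left hz hr.1, hr.2]
    have hcore := neg_sq_le_weighted_energy (H := J z) (s := 1) hm (by simp) hF'
    have hk := hK z.1 hx z.2 ht
    have he0 : 0 < Real.exp (4 * m * z.2) := Real.exp_pos _
    have he1 : Real.exp (4 * m * z.2) ≤ Real.exp (4 * m * T) := by
      gcongr; exact ht.2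
    have h1 : -(K * (coneWeight T m z * (S.φ z ^ 2 + S.G z ^ 2)) + b z ^ 2)
        ≤ 4 * m * ((ρ z.2 * S.φ z) ^ 2 + g z ^ 2 + J z ^ 2 / m ^ 2)
          + 2 * (ρ z.2 * S.φ z) * (ρ' z.2 * S.φ z) + 2 * g z * (ρ' z.2 * S.G z)
          + 2 * (ρ z.2 * S.φ z) * J z + 2 * J z * (ρ z.2 * S.F z) / m ^ 2 := by
      have h5 : 0 ≤ J z ^ 2 / m ^ 2 := by positivity
      have h6 : ρ' z.2 ^ 2 * (S.φ z ^ 2 + S.G z ^ 2)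
          ≤ K * (coneWeight T m z * (S.φ z ^ 2 + S.G z ^ 2)) := by
        rw [← mul_assoc]
        exact mul_le_mul_of_nonneg_right hk (by positivity)
      nlinarith [mul_nonneg (sub_nonneg.2 hm) (sq_nonneg (ρ z.2 * S.φ z)),
        mul_nonneg (sub_nonneg.2 hm) (sq_nonneg (g z)), mul_nonneg (sub_nonneg.2 hm) h5,
        sq_nonneg (ρ z.2 * S.φ z + ρ' z.2 * S.φ z), sq_nonneg (g z + ρ' z.2 * S.G z),
        sq_nonneg (ρ z.2 * S.φ z), sq_nonneg (g z)]
    have h2 : I z = Real.exp (4 * m * z.2) *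
        (4 * m * ((ρ z.2 * S.φ z) ^ 2 + g z ^ 2 + J z ^ 2 / m ^ 2)
          + 2 * (ρ z.2 * S.φ z) * (ρ' z.2 * S.φ z) + 2 * g z * (ρ' z.2 * S.G z)
          + 2 * (ρ z.2 * S.φ z) * J z + 2 * J z * (ρ z.2 * S.F z) / m ^ 2) := by
      simp only [hI]; ring
    have h3 : 0 ≤ K * (coneWeight T m z * (S.φ z ^ 2 + S.G z ^ 2)) + b z ^ 2 := by
      rw [← mul_assoc]
      have : 0 ≤ K * coneWeight T m z := (sq_nonneg _).trans hk
      positivity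
    rw [h2]
    nlinarith [mul_le_mul_of_nonneg_left h1 he0.le, mul_le_mul_of_nonneg_right he1 h3]
  have hcone : Integrable (fun z => coneWeight T m z * (S.φ z ^ 2 + S.G z ^ 2)) (muQ T) := by
    have := continuous_coneWeight T m
    exact Continuous.integrable_muQ (by fun_prop) T
  have hint := integral_mono_ae (((hcone.const_mul K).add hb).const_mul (Real.exp (4 * m * T))).neg
    (hIc.integrable_muQ T) hpt
  rw [integral_neg', integral_const_mul, integral_add' (hcone.const_mul K) hb, integral_const_mul,
    integral_muQ_eq_interval hT0 hIc, hdiv] at hint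
  have hJT : ∀ x, J (x, T) = 0 := fun x => by simp [hJ]
  have hgT : ∀ x, g (x, T) = 0 := fun x => by simp [hg, hZ, hρT]
  have hg1 : ∀ t, g (1, t) = 0 := fun t => by simp [hg, Z_one, S.G_one]
  simp only [hρT, hJT, hgT, hg1, S.φ_zero, hρ0, zero_mul, mul_zero, neg_zero, sub_zero,
    intervalIntegral.integral_zero, zero_add, one_mul, Real.exp_zero, zero_sub, ne_eq,
    OfNat.ofNat_ne_zero, not_false_eq_true, zero_pow, zero_div, add_zero,
    intervalIntegral.integral_neg] at hint
  rw [intervalIntegral.integral_add (Continuous.intervalIntegrable (by fun_prop) _ _)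
    (Continuous.intervalIntegrable (by fun_prop) _ _), intervalIntegral.integral_add
    (Continuous.intervalIntegrable (by fun_prop) _ _)
    (Continuous.intervalIntegrable (by fun_prop) _ _), intervalIntegral.integral_div] at hint
  set R := Real.exp (4 * m * T) * (K * (∫ z, coneWeight T m z * (S.φ z ^ 2 + S.G z ^ 2) ∂(muQ T))
        + ∫ z, b z ^ 2 ∂(muQ T)) with hR
  set X := ∫ x in (0 : ℝ)..1, S.φ (x, 0) ^ 2 with hX
  set Y := ∫ x in (0 : ℝ)..1, g (x, 0) ^ 2 with hY
  set W := ∫ x in (0 : ℝ)..1, J (x, 0) ^ 2 with hW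
  have hX0 : 0 ≤ X := intervalIntegral.integral_nonneg zero_le_one fun _ _ => sq_nonneg _
  have hY0 : 0 ≤ Y := intervalIntegral.integral_nonneg zero_le_one fun _ _ => sq_nonneg _
  have hW0 : 0 ≤ W := intervalIntegral.integral_nonneg zero_le_one fun _ _ => sq_nonneg _
  have hZ0 : ∀ x ∈ Icc (0 : ℝ) 1, Z (x, 0) ^ 2 ≤ W := by
    intro x hx
    have hJ0 : Continuous fun y => -J (y, 0) := by fun_prop
    have h := intervalIntegral.integral_eq_sub_of_hasDerivAt (a := x) (b := 1)
      (fun y _ => Z_dx y 0) (hJ0.intervalIntegrable _ _)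
    have h2 := sq_intervalIntegral_le hJ0 hx.1 hx.2 le_rfl
    rw [h, Z_one, zero_sub, neg_sq] at h2
    simp only [neg_sq] at h2
    exact h2.trans (mul_le_of_le_one_left hW0 (by linarith [hx.1]))
  have hG0 : S.energy 0 ≤ X + (2 * Y + 2 * W) := by
    unfold energy
    rw [intervalIntegral.integral_add (Continuous.intervalIntegrable (by fun_prop) _ _)
      (Continuous.intervalIntegrable (by fun_prop) _ _)]
    refine add_le_add le_rfl ?_
    calc ∫ x in (0 : ℝ)..1, S.G (x, 0) ^ 2 ≤ ∫ x in (0 : ℝ)..1, (2 * g (x, 0) ^ 2 + 2 * W) := by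
          refine intervalIntegral.integral_mono_on zero_le_one
            (Continuous.intervalIntegrable (by fun_prop) _ _)
            (Continuous.intervalIntegrable (by fun_prop) _ _) fun x hx => ?_
          have h1 : S.G (x, 0) = g (x, 0) - Z (x, 0) := by simp [hg, hρ0]
          have h2 := hZ0 x hx
          rw [h1]
          nlinarith [sq_nonneg (g (x, 0) + Z (x, 0))]
      _ = 2 * Y + 2 * W := by
          rw [intervalIntegral.integral_add (Continuous.intervalIntegrable (by fun_prop) _ _)
            intervalIntegrable_const, intervalIntegral.integral_const_mul]
          simp [hY]
  have hm2 : 1 ≤ m ^ 2 := by nlinarith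
  have hWm : W = m ^ 2 * (W / m ^ 2) := by field_simp
  have hWd : 0 ≤ W / m ^ 2 := by positivity
  rw [hWm] at hG0
  have hsum : X + Y + W / m ^ 2 ≤ R := by linarith
  nlinarith [mul_nonneg (sub_nonneg.2 hm2) hX0, mul_nonneg (sub_nonneg.2 hm2) hY0,
    mul_le_mul_of_nonneg_left hsum (by positivity : 0 ≤ 3 * m ^ 2)]

/-- The observability inequality for classical solutions. -/
theorem observability {T : ℝ} (hT : 2 < T) : ∃ C : ℝ, 0 < C ∧ ∀ (S : WaveSolution) (a : ℝ),
    0 ≤ a → ∀ b : ℝ × ℝ → ℝ, Integrable (fun z => b z ^ 2) (muQ T) →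
      (∀ᵐ z ∂(muQ T), |S.F z| ≤ a * |S.φ z| + |b z|) →
      S.energy 0 ≤ C * Real.exp (C * Real.sqrt a) *
        ((∫ t in (0 : ℝ)..T, S.φ (1, t) ^ 2) + ∫ z, b z ^ 2 ∂(muQ T)) := by
  have hT0 : 0 ≤ T := by linarith
  set r : ℝ → ℝ := fun s => max (s - 1) 0 * max (T - 1 - s) 0 with hr
  have hrc : Continuous r := by fun_prop
  have hr0 : ∀ s, 0 ≤ r s := fun s => mul_nonneg (le_max_right _ _) (le_max_right _ _)
  set c₀ := ∫ s in (0 : ℝ)..T, r s with hc₀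
  have hc : 0 < c₀ := by
    refine intervalIntegral.integral_pos (by linarith) hrc.continuousOn (fun s _ => hr0 s)
      ⟨T / 2, ⟨by linarith, by linarith⟩, ?_⟩
    exact mul_pos (lt_max_of_lt_left (by linarith)) (lt_max_of_lt_left (by linarith))
  set ρ : ℝ → ℝ := fun t => 1 - c₀⁻¹ * ∫ s in (0 : ℝ)..t, r s with hρ
  have hρd : ∀ t, HasDerivAt ρ (-(c₀⁻¹ * r t)) t := fun t =>
    ((intervalIntegral.integral_hasDerivAt_right (hrc.intervalIntegrable _ _)
      (hrc.stronglyMeasurableAtFilter _ _) hrc.continuousAt).const_mul _).const_sub 1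
  have hρb : ∀ t ∈ Icc 0 T, ρ t ∈ Icc (0 : ℝ) 1 := by
    intro t ht
    have h1 : 0 ≤ ∫ s in (0 : ℝ)..t, r s := intervalIntegral.integral_nonneg ht.1 fun s _ => hr0 s
    have h2 : ∫ s in (0 : ℝ)..t, r s ≤ c₀ := intervalIntegral.integral_mono_interval le_rfl ht.1
      ht.2 (Eventually.of_forall hr0) (hrc.intervalIntegrable _ _)
    have h3 : c₀⁻¹ * ∫ s in (0 : ℝ)..t, r s ≤ 1 := by
      rw [inv_mul_le_iff₀ hc, mul_one]; exact h2
    have h4 : 0 ≤ c₀⁻¹ * ∫ s in (0 : ℝ)..t, r s := by positivity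
    exact ⟨by simp only [hρ]; linarith, by simp only [hρ]; linarith⟩
  have hK : ∀ m : ℝ, 1 ≤ m → ∀ x ∈ Icc (0 : ℝ) 1, ∀ t ∈ Icc 0 T,
      (-(c₀⁻¹ * r t)) ^ 2 ≤ c₀⁻¹ ^ 2 * coneWeight T m (x, t) := by
    intro m hm x hx t _
    rw [neg_sq, mul_pow]
    refine mul_le_mul_of_nonneg_left ?_ (by positivity)
    simp only [hr, coneWeight]
    have h1 : 1 ≤ Real.exp (4 * m * x) := Real.one_le_exp (by have := hx.1; positivity)
    have h2 : max (t - 1) 0 ≤ max (t - 1 + x) 0 := max_le_max (by linarith [hx.1]) le_rfl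
    have h3 : max (T - 1 - t) 0 ≤ max (T - 1 + x - t) 0 := max_le_max (by linarith [hx.1]) le_rfl
    rw [mul_pow]
    calc max (t - 1) 0 ^ 2 * max (T - 1 - t) 0 ^ 2
        ≤ max (t - 1 + x) 0 ^ 2 * max (T - 1 + x - t) 0 ^ 2 := by gcongr
      _ ≤ _ := le_mul_of_one_le_left (by positivity) h1
  set k := c₀⁻¹ ^ 2 * T ^ 4 + 1 with hk
  have hk0 : 0 < k := by positivity
  set c := 4 * T + 6 with hcdef
  refine ⟨3 * k * Real.exp c + c, by positivity, fun S a ha b hb hF => ?_⟩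
  set m := 1 + Real.sqrt a with hm
  have hsq := Real.sqrt_nonneg a
  have hm1 : 1 ≤ m := by linarith
  have ham : a ≤ m ^ 2 := by nlinarith [Real.sq_sqrt ha]
  have hF' : ∀ᵐ z ∂(muQ T), |S.F z| ≤ m ^ 2 * |S.φ z| + |b z| := by
    filter_upwards [hF] with z hz
    exact hz.trans (by gcongr)
  have h1 := S.energy_zero_le hT (by fun_prop) hρd (by simp [hρ])
    (by simp [hρ, ← hc₀, hc.ne']) hρb hm1 (hK m hm1) hb hF'
  have h2 := S.integral_coneWeight_le hT hm1 hb hF'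
  set U := ∫ t in (0 : ℝ)..T, S.φ (1, t) ^ 2
  set V := ∫ z, b z ^ 2 ∂(muQ T)
  have hU : 0 ≤ U := intervalIntegral.integral_nonneg hT0 fun _ _ => sq_nonneg _
  have hV : 0 ≤ V := integral_nonneg fun _ => sq_nonneg _
  have hexp1 : 1 ≤ Real.exp (4 * m) := Real.one_le_exp (by positivity)
  have h3 : c₀⁻¹ ^ 2 * (∫ z, coneWeight T m z * (S.φ z ^ 2 + S.G z ^ 2) ∂(muQ T)) + V
      ≤ k * Real.exp (4 * m) * (U + V) := by
    calc _ ≤ c₀⁻¹ ^ 2 * (Real.exp (4 * m) * T ^ 4 * (U + V)) + V := by gcongr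
      _ ≤ c₀⁻¹ ^ 2 * (Real.exp (4 * m) * T ^ 4 * (U + V)) + Real.exp (4 * m) * (U + V) := by
        gcongr; nlinarith
      _ = _ := by rw [hk]; ring
  have hm2 : m ^ 2 ≤ Real.exp (2 * m) := by
    have h4 : m ≤ Real.exp m := by linarith [Real.add_one_le_exp m]
    calc m ^ 2 ≤ Real.exp m ^ 2 := by gcongr
      _ = Real.exp (2 * m) := by rw [← Real.exp_nat_mul]; norm_num
  calc S.energy 0 ≤ 3 * m ^ 2 * (Real.exp (4 * m * T) * (k * Real.exp (4 * m) * (U + V))) := by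
        refine h1.trans ?_
        gcongr
    _ ≤ 3 * Real.exp (2 * m) * (Real.exp (4 * m * T) * (k * Real.exp (4 * m) * (U + V))) := by
        gcongr
    _ = 3 * k * Real.exp (c * m) * (U + V) := by
        have : Real.exp (c * m) = Real.exp (2 * m) * Real.exp (4 * m * T) * Real.exp (4 * m) := by
          rw [← Real.exp_add, ← Real.exp_add, hcdef]; congr 1; ring
        rw [this]; ring
    _ = 3 * k * Real.exp c * Real.exp (c * Real.sqrt a) * (U + V) := by
        have : c * m = c + c * Real.sqrt a := by rw [hm]; ring
        rw [this, Real.exp_add]; ring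
    _ ≤ _ := by
        have hc0 : 0 ≤ c := by positivity
        have h5 : 0 ≤ 3 * k * Real.exp c := by positivity
        gcongr
        · linarith
        · linarith

end WaveSolution

end

noncomputable section

/-! ### The spaces `H¹₍₀₎(Ω)` and `H⁻¹₍₀₎(Ω)` -/

theorem L2Om.intervalIntegrable_unit (f : L2Om) : IntervalIntegrable (f : ℝ → ℝ) volume 0 1 := by
  rw [intervalIntegrable_iff_integrableOn_Ioo_of_le zero_le_one]
  exact f.integrable

namespace H10

/-- Every `f ∈ L²(Ω)` is the derivative of an element of `H¹₍₀₎(Ω)`. -/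
theorem dx_surjective : Function.Surjective dx := by
  intro f
  have hi : Integrable ((Ioo (0 : ℝ) 1).indicator (f : ℝ → ℝ)) volume :=
    (integrable_indicator_iff measurableSet_Ioo).2 f.integrable
  have hc : Continuous fun x => ∫ s in (0 : ℝ)..x, (Ioo (0 : ℝ) 1).indicator (f : ℝ → ℝ) s :=
    intervalIntegral.continuous_primitive (fun _ _ => hi.intervalIntegrable) 0
  have hmem : (toOm _ hc, f) ∈ H10Sub := by
    change (toOm _ hc : ℝ → ℝ) =ᵐ[muOm] fun x => ∫ s in (0 : ℝ)..x, f s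
    filter_upwards [coeFn_toOm hc, ae_restrict_mem measurableSet_Ioo] with x hx hx1
    rw [hx]
    refine L2Om.primitive_congr ?_ hx1
    filter_upwards [ae_restrict_mem measurableSet_Ioo] with y hy
    rw [indicator_of_mem hy]
  exact ⟨⟨_, hmem⟩, rfl⟩

/-- The derivative as a continuous linear map `H¹₍₀₎(Ω) → L²(Ω)`. -/
def dxL : H10 →L[ℝ] L2Om := dx.mkContinuous 1 fun z => by rw [one_mul]; exact (norm_def z).ge

theorem toL2_ae (z : H10) : (toL2 z : ℝ → ℝ) =ᵐ[muOm] fun x => ∫ s in (0 : ℝ)..x, dx z s :=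
  fn_ae z

/-- Integration by parts against an element of `H¹₍₀₎(Ω)`. -/
theorem integral_deriv_mul {G p : ℝ → ℝ} (hp : Continuous p) (hG : ∀ x, HasDerivAt G (p x) x)
    (hG1 : G 1 = 0) (z : H10) :
    ∫ x, p x * toL2 z x ∂muOm = -∫ x, G x * dx z x ∂muOm := by
  have hf := (dx z).intervalIntegrable_unit
  have hdG : deriv G = p := funext fun x => (hG x).deriv
  have hGac : AbsolutelyContinuousOnInterval G 0 1 := by
    refine ContDiffOn.absolutelyContinuousOnInterval (ContDiff.contDiffOn ?_)
    exact contDiff_one_iff_deriv.2 ⟨fun x => (hG x).differentiableAt, by rwa [hdG]⟩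
  have hPac : AbsolutelyContinuousOnInterval (fun x => ∫ s in (0 : ℝ)..x, dx z s) 0 1 :=
    hf.absolutelyContinuousOnInterval_intervalIntegral (by simp)
  have hibp := hGac.integral_mul_deriv_eq_deriv_mul hPac
  rw [hG1, hdG, intervalIntegral.integral_same] at hibp
  have h1 : ∫ x, p x * toL2 z x ∂muOm = ∫ x in (0 : ℝ)..1, p x * ∫ s in (0 : ℝ)..x, dx z s := by
    rw [← integral_muOm]
    exact integral_congr_ae ((toL2_ae z).mono fun x hx => by simp only [hx])
  have h2 : ∫ x, G x * dx z x ∂muOm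
      = ∫ x in (0 : ℝ)..1, G x * deriv (fun x => ∫ s in (0 : ℝ)..x, dx z s) x := by
    rw [integral_muOm]
    refine intervalIntegral.integral_congr_ae ?_
    filter_upwards [hf.ae_hasDerivAt_integral] with x hx hx1
    rw [(hx (uIoc_subset_uIcc hx1) 0 (by simp)).deriv]
  rw [h1, h2, hibp]
  simp

end H10

/-- The map `L²(Ω) → H⁻¹₍₀₎(Ω)`, `f ↦ (z ↦ ⟨f, K z⟩)`. -/
def pairing (K : H10 →L[ℝ] L2Om) : L2Om →L[ℝ] Hm1 :=
  LinearMap.mkContinuous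
    { toFun := fun f => (innerSL ℝ f).comp K
      map_add' := fun f g => by ext z; simp
      map_smul' := fun c f => by ext z; simp } ‖K‖ fun f => by
    refine (ContinuousLinearMap.opNorm_comp_le _ _).trans ?_
    rw [innerSL_apply_norm, mul_comm]

theorem pairing_apply (K : H10 →L[ℝ] L2Om) (f : L2Om) (z : H10) :
    pairing K f z = inner ℝ f (K z) := rfl

theorem L2toHm1_eq (f : L2Om) : L2toHm1 f = pairing H10.toL2 f := rfl

/-- The functional `z ↦ -∫_Ω G ∂ₓz`, that is the derivative of `G ∈ L²(Ω)`. -/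
def dxDual : L2Om →L[ℝ] Hm1 := -pairing H10.dxL

theorem dxDual_apply (G : L2Om) (z : H10) : dxDual G z = -∫ x, G x * H10.dx z x ∂muOm := by
  rw [← Lp_two_inner]; rfl

theorem norm_dxDual_le (G : L2Om) : ‖dxDual G‖ ≤ ‖G‖ := by
  refine ContinuousLinearMap.opNorm_le_bound _ (norm_nonneg _) fun z => ?_
  change ‖-(inner ℝ G (H10.dx z))‖ ≤ _
  rw [norm_neg]
  exact norm_inner_le_norm _ _

theorem dxDual_surjective : Function.Surjective dxDual := by
  intro ψ
  let e := LinearEquiv.ofBijective H10.dx ⟨H10.dx_injective, H10.dx_surjective⟩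
  let ℓ : L2Om →L[ℝ] ℝ := LinearMap.mkContinuous (ψ.toLinearMap.comp e.symm.toLinearMap) ‖ψ‖
    fun f => by
      refine (ψ.le_opNorm _).trans (le_of_eq ?_)
      rw [H10.norm_def]
      congr 2
      exact e.apply_symm_apply f
  refine ⟨-(InnerProductSpace.toDual ℝ L2Om).symm ℓ, ?_⟩
  ext z
  change -(inner ℝ (-(InnerProductSpace.toDual ℝ L2Om).symm ℓ) (H10.dx z)) = ψ z
  rw [inner_neg_left, neg_neg, InnerProductSpace.toDual_symm_apply]
  change ψ (e.symm (H10.dx z)) = ψ z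
  exact congrArg ψ (e.symm_apply_apply z)

theorem L2toHm1_toOm_eq_dxDual {G p : ℝ → ℝ} (hp : Continuous p)
    (hG : ∀ x, HasDerivAt G (p x) x) (hGc : Continuous G) (hG1 : G 1 = 0) :
    L2toHm1 (toOm p hp) = dxDual (toOm G hGc) := by
  ext z
  rw [dxDual_apply]
  change inner ℝ (toOm p hp) (H10.toL2 z) = _
  rw [Lp_two_inner]
  have h1 : ∫ x, toOm p hp x * H10.toL2 z x ∂muOm = ∫ x, p x * H10.toL2 z x ∂muOm :=
    integral_congr_ae ((coeFn_toOm hp).mono fun x hx => by simp only [hx])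
  have h2 : ∫ x, toOm G hGc x * H10.dx z x ∂muOm = ∫ x, G x * H10.dx z x ∂muOm :=
    integral_congr_ae ((coeFn_toOm hGc).mono fun x hx => by simp only [hx])
  rw [h1, h2]
  exact H10.integral_deriv_mul hp hG hG1 z

/-! ### Separated solutions -/

/-- The frequencies `(n + 1/2) π`. -/
def freq (n : ℕ) : ℝ := (n + 1 / 2) * Real.pi

theorem freq_pos (n : ℕ) : 0 < freq n := by unfold freq; positivity

theorem cos_freq (n : ℕ) : Real.cos (freq n) = 0 := by
  rw [Real.cos_eq_zero_iff]
  exact ⟨n, by unfold freq; push_cast; ring⟩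

/-- The initial value problem for the harmonic oscillator with a forcing term. -/
theorem exists_oscillator {l : ℝ} (hl : l ≠ 0) {h : ℝ → ℝ} (hh : Continuous h) (t₀ α β : ℝ) :
    ∃ b b' : ℝ → ℝ, (∀ t, HasDerivAt b (b' t) t) ∧ (∀ t, HasDerivAt b' (h t - l ^ 2 * b t) t) ∧
      b t₀ = α ∧ b' t₀ = β := by
  set P : ℝ → ℝ := fun t => ∫ s in t₀..t, Real.cos (l * s) * h s with hP
  set R : ℝ → ℝ := fun t => ∫ s in t₀..t, Real.sin (l * s) * h s with hR
  have ftc : ∀ g : ℝ → ℝ, Continuous g → ∀ t, HasDerivAt (fun r => ∫ s in t₀..r, g s) (g t) t :=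
    fun g hg t => intervalIntegral.integral_hasDerivAt_right (hg.intervalIntegrable _ _)
      (hg.stronglyMeasurableAtFilter _ _) hg.continuousAt
  have dP : ∀ t, HasDerivAt P (Real.cos (l * t) * h t) t := ftc _ (by fun_prop)
  have dR : ∀ t, HasDerivAt R (Real.sin (l * t) * h t) t := ftc _ (by fun_prop)
  have d1 : ∀ t, HasDerivAt (fun t => l * t) l t := fun t => by
    simpa using (hasDerivAt_id' t).const_mul l
  have d2 : ∀ t, HasDerivAt (fun t => l * (t - t₀)) l t := fun t => by
    simpa using ((hasDerivAt_id' t).sub_const t₀).const_mul l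
  refine ⟨fun t => α * Real.cos (l * (t - t₀)) + β / l * Real.sin (l * (t - t₀))
      + (Real.sin (l * t) * P t - Real.cos (l * t) * R t) / l,
    fun t => -(α * l) * Real.sin (l * (t - t₀)) + β * Real.cos (l * (t - t₀))
      + (Real.cos (l * t) * P t + Real.sin (l * t) * R t), fun t => ?_, fun t => ?_, ?_, ?_⟩
  · convert! (((d2 t).cos.const_mul α).fun_add ((d2 t).sin.const_mul (β / l))).fun_add
      ((((d1 t).sin.fun_mul (dP t)).fun_sub ((d1 t).cos.fun_mul (dR t))).div_const l) using 1
    field_simp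
    ring
  · convert! (((d2 t).sin.const_mul (-(α * l))).fun_add ((d2 t).cos.const_mul β)).fun_add
      (((d1 t).cos.fun_mul (dP t)).fun_add ((d1 t).sin.fun_mul (dR t))) using 1
    have := Real.sin_sq_add_cos_sq (l * t)
    field_simp
    linear_combination (-h t) * this
  · simp [hP, hR]
  · simp [hP, hR]

/-- The classical solution `sin((n + 1/2) π x) b(t)`. -/
def WaveSolution.mode (n : ℕ) (b b' h : ℝ → ℝ) (hh : Continuous h)
    (hb : ∀ t, HasDerivAt b (b' t) t)
    (hb' : ∀ t, HasDerivAt b' (h t - freq n ^ 2 * b t) t) : WaveSolution :=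
  have cb : Continuous b := continuous_iff_continuousAt.2 fun t => (hb t).continuousAt
  have cb' : Continuous b' := continuous_iff_continuousAt.2 fun t => (hb' t).continuousAt
  have d1 : ∀ x, HasDerivAt (fun x => freq n * x) (freq n) x := fun x => by
    simpa using (hasDerivAt_id' x).const_mul (freq n)
  have hn : freq n ≠ 0 := (freq_pos n).ne'
  { φ := fun z => Real.sin (freq n * z.1) * b z.2
    G := fun z => -(Real.cos (freq n * z.1) / freq n) * b' z.2
    H := fun z => -(Real.cos (freq n * z.1) / freq n) * h z.2
    F := fun z => Real.sin (freq n * z.1) * h z.2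
    p := fun z => Real.sin (freq n * z.1) * b' z.2
    q := fun z => Real.cos (freq n * z.1) * freq n * b z.2
    hφ := by fun_prop
    hG := by fun_prop
    hH := by fun_prop
    hF := by fun_prop
    hp := by fun_prop
    hq := by fun_prop
    φ_dx := fun x t => (d1 x).sin.mul_const (b t)
    φ_dt := fun x t => (hb t).const_mul (Real.sin (freq n * x))
    G_dx := fun x t => by
      convert! (((d1 x).cos.div_const (freq n)).fun_neg).mul_const (b' t) using 1
      field_simp
    G_dt := fun x t => by
      convert! (hb' t).const_mul (-(Real.cos (freq n * x) / freq n)) using 1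
      field_simp
      ring
    H_dx := fun x t => by
      convert! (((d1 x).cos.div_const (freq n)).fun_neg).mul_const (h t) using 1
      field_simp
    φ_zero := fun t => by simp
    G_one := fun t => by simp [cos_freq]
    H_one := fun t => by simp [cos_freq] }

end

noncomputable section

/-! ### Totality of the trigonometric systems -/

theorem Integrable.mul_continuous_muOm {f g : ℝ → ℝ} (hf : Integrable f muOm)
    (hg : Continuous g) : Integrable (fun x => f x * g x) muOm :=
  hf.mul_of_top_left (hg.memLp_muOm ∞)

/-- If a family `e` of continuous functions is stable under multiplication by `sin²(πx/2)` in the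
sense of a three-term recurrence, and `e 0` does not vanish in `Ω`, then `e` is total. -/
theorem ae_eq_zero_of_integral_mul_recurrence {f : ℝ → ℝ} (hf : Integrable f muOm)
    {e : ℕ → ℝ → ℝ} (he : ∀ n, Continuous (e n)) (κ : ℕ → ℝ)
    (hrec : ∀ n x, e n x * Real.sin (Real.pi / 2 * x) ^ 2
      = 1 / 2 * e n x - 1 / 4 * e (n + 1) x - κ n * e (n - 1) x)
    (h0 : ∀ x ∈ Ioo (0 : ℝ) 1, e 0 x ≠ 0) (h : ∀ n, ∫ x, f x * e n x ∂muOm = 0) :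
    ∀ᵐ x ∂muOm, f x = 0 := by
  set y : ℝ → ℝ := fun x => Real.sin (Real.pi / 2 * x) ^ 2 with hy
  have hyc : Continuous y := by fun_prop
  have hi : ∀ g : ℝ → ℝ, Continuous g → Integrable (fun x => f x * g x) muOm :=
    fun g hg => Integrable.mul_continuous_muOm hf hg
  have hpow : ∀ k n, ∫ x, f x * (e n x * y x ^ k) ∂muOm = 0 := by
    intro k
    induction k with
    | zero => intro n; simpa using h n
    | succ k ih =>
      intro n
      have h1 : ∀ x, f x * (e n x * y x ^ (k + 1)) = 1 / 2 * (f x * (e n x * y x ^ k))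
          - 1 / 4 * (f x * (e (n + 1) x * y x ^ k)) - κ n * (f x * (e (n - 1) x * y x ^ k)) := by
        intro x
        have := hrec n x
        rw [pow_succ]
        linear_combination (f x * y x ^ k) * this
      have hk : ∀ j, Integrable (fun x => f x * (e j x * y x ^ k)) muOm :=
        fun j => hi _ ((he j).mul (hyc.pow k))
      have i1 := (hk n).const_mul (1 / 2)
      have i2 := (hk (n + 1)).const_mul (1 / 4)
      have i12 : Integrable (fun x => 1 / 2 * (f x * (e n x * y x ^ k))
          - 1 / 4 * (f x * (e (n + 1) x * y x ^ k))) muOm := i1.sub i2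
      simp_rw [h1]
      rw [integral_sub i12 ((hk (n - 1)).const_mul _),
        integral_sub i1 i2, integral_const_mul, integral_const_mul,
        integral_const_mul, ih, ih, ih]
      simp
  have hip : ∀ P : Polynomial ℝ, Integrable (fun x => f x * (e 0 x * P.eval (y x))) muOm :=
    fun P => hi _ ((he 0).mul (P.continuous.comp hyc))
  have hpoly : ∀ P : Polynomial ℝ, ∫ x, f x * (e 0 x * P.eval (y x)) ∂muOm = 0 := by
    intro P
    induction P using Polynomial.induction_on' with
    | add P R hP hR =>
      have h1 : ∀ x, f x * (e 0 x * (P + R).eval (y x))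
          = f x * (e 0 x * P.eval (y x)) + f x * (e 0 x * R.eval (y x)) := by
        intro x; rw [Polynomial.eval_add]; ring
      simp_rw [h1]
      rw [integral_add (hip P) (hip R), hP, hR, add_zero]
    | monomial k a =>
      have h1 : ∀ x, f x * (e 0 x * (Polynomial.monomial k a).eval (y x))
          = a * (f x * (e 0 x * y x ^ k)) := by
        intro x; rw [Polynomial.eval_monomial]; ring
      simp_rw [h1]
      rw [integral_const_mul, hpow, mul_zero]
  have hcont : ∀ g : ℝ → ℝ, Continuous g → ∫ x, f x * (e 0 x * g x) ∂muOm = 0 := by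
    intro g hg
    have hfe := hi _ (he 0)
    set M := ∫ x, ‖f x * e 0 x‖ ∂muOm with hM
    have hM0 : 0 ≤ M := integral_nonneg fun _ => norm_nonneg _
    have hle : ∀ ε > 0, |∫ x, f x * (e 0 x * g x) ∂muOm| ≤ ε * M := by
      intro ε hε
      obtain ⟨P, hP⟩ := exists_polynomial_near_of_continuousOn 0 1
        (fun s => g (2 / Real.pi * Real.arcsin (Real.sqrt s)))
        (hg.comp (continuous_const.mul
          (Real.continuous_arcsin.comp Real.continuous_sqrt))).continuousOn ε hε
      have h1 : ∫ x, f x * (e 0 x * g x) ∂muOm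
          = ∫ x, (f x * e 0 x) * (g x - P.eval (y x)) ∂muOm := by
        have h2 : ∀ x, (f x * e 0 x) * (g x - P.eval (y x))
            = f x * (e 0 x * g x) - f x * (e 0 x * P.eval (y x)) := fun x => by ring
        have h3 : Integrable (fun x => f x * (e 0 x * g x)) muOm := hi _ ((he 0).mul hg)
        simp_rw [h2]
        rw [integral_sub h3 (hip P), hpoly, sub_zero]
      rw [h1, ← Real.norm_eq_abs, hM, ← integral_const_mul]
      refine norm_integral_le_of_norm_le (hfe.norm.const_mul ε) ?_
      filter_upwards [ae_restrict_mem measurableSet_Ioo] with x hx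
      rw [norm_mul, mul_comm]
      refine mul_le_mul_of_nonneg_right ?_ (norm_nonneg _)
      have hpi := Real.pi_pos
      have hx0 : 0 ≤ Real.pi / 2 * x := by have := hx.1; positivity
      have hx1 : Real.pi / 2 * x ≤ Real.pi / 2 := by nlinarith [hx.2]
      have hs0 : 0 ≤ Real.sin (Real.pi / 2 * x) :=
        Real.sin_nonneg_of_nonneg_of_le_pi hx0 (by linarith)
      have hmem : y x ∈ Icc (0 : ℝ) 1 := ⟨sq_nonneg _, Real.sin_sq_le_one _⟩
      have h3 := hP (y x) hmem
      have h4 : 2 / Real.pi * Real.arcsin (Real.sqrt (y x)) = x := by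
        rw [hy, Real.sqrt_sq hs0, Real.arcsin_sin (by linarith) hx1]
        field_simp
      simp only [h4] at h3
      rw [Real.norm_eq_abs, abs_sub_comm]
      exact h3.le
    have : |∫ x, f x * (e 0 x * g x) ∂muOm| ≤ 0 := by
      refine le_of_forall_pos_le_add fun δ hδ => ?_
      have h5 := hle (δ / (M + 1)) (by positivity)
      have h6 : δ / (M + 1) * M ≤ δ := by
        rw [div_mul_eq_mul_div, div_le_iff₀ (by positivity)]
        nlinarith
      linarith
    exact abs_nonpos_iff.1 this
  have hz := isOpen_Ioo.ae_eq_zero_of_integral_contDiff_smul_eq_zero (U := Ioo (0 : ℝ) 1)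
    (μ := volume) (f := fun x => f x * e 0 x)
    (IntegrableOn.locallyIntegrableOn (hi _ (he 0))) (fun g hg _ hsupp => by
      have h1 : ∫ x, g x • (f x * e 0 x) = ∫ x in Ioo (0 : ℝ) 1, g x • (f x * e 0 x) := by
        refine (setIntegral_eq_integral_of_forall_compl_eq_zero fun x hx => ?_).symm
        rw [image_eq_zero_of_notMem_tsupport fun hx' => hx (hsupp hx'), zero_smul]
      rw [h1]
      refine Eq.trans ?_ (hcont g hg.continuous)
      refine integral_congr_ae (Eventually.of_forall fun x => ?_)
      simp only [smul_eq_mul]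
      ring)
  filter_upwards [ae_restrict_of_ae hz, ae_restrict_mem measurableSet_Ioo] with x hx hx1
  exact (mul_eq_zero.1 (hx hx1)).resolve_right (h0 x hx1)

theorem ae_eq_zero_of_integral_mul_sin {f : ℝ → ℝ} (hf : Integrable f muOm)
    (h : ∀ n, ∫ x, f x * Real.sin (freq n * x) ∂muOm = 0) : ∀ᵐ x ∂muOm, f x = 0 := by
  refine ae_eq_zero_of_integral_mul_recurrence hf (e := fun n x => Real.sin (freq n * x))
    (fun n => by fun_prop) (fun n => if n = 0 then -1 / 4 else 1 / 4) (fun n x => ?_)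
    (fun x hx => ?_) h
  · have h1 : Real.sin (Real.pi / 2 * x) ^ 2 = 1 / 2 - Real.cos (Real.pi * x) / 2 := by
      rw [Real.sin_sq_eq_half_sub]; congr 3; ring
    have h2 : Real.sin (freq (n + 1) * x) = Real.sin (freq n * x) * Real.cos (Real.pi * x)
        + Real.cos (freq n * x) * Real.sin (Real.pi * x) := by
      rw [← Real.sin_add]; congr 1; unfold freq; push_cast; ring
    rcases Nat.eq_zero_or_pos n with rfl | hn
    · have h3 : Real.sin (freq 0 * x) = -(Real.sin (freq 0 * x) * Real.cos (Real.pi * x)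
          - Real.cos (freq 0 * x) * Real.sin (Real.pi * x)) := by
        rw [← Real.sin_sub, ← Real.sin_neg]; congr 1; unfold freq; push_cast; ring
      simp only [if_true]
      rw [h1, h2]
      linear_combination (-1 / 4) * h3
    · have h3 : Real.sin (freq (n - 1) * x) = Real.sin (freq n * x) * Real.cos (Real.pi * x)
          - Real.cos (freq n * x) * Real.sin (Real.pi * x) := by
        rw [← Real.sin_sub]; congr 1; unfold freq; push_cast [Nat.cast_sub hn]; ring
      simp only [hn.ne', if_false]
      rw [h1, h2, h3]
      ring
  · have hpi := Real.pi_pos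
    refine (Real.sin_pos_of_pos_of_lt_pi ?_ ?_).ne'
    · have := hx.1; have := freq_pos 0; positivity
    · unfold freq; push_cast; nlinarith [hx.2]

theorem ae_eq_zero_of_integral_mul_cos {f : ℝ → ℝ} (hf : Integrable f muOm)
    (h : ∀ n, ∫ x, f x * Real.cos (freq n * x) ∂muOm = 0) : ∀ᵐ x ∂muOm, f x = 0 := by
  refine ae_eq_zero_of_integral_mul_recurrence hf (e := fun n x => Real.cos (freq n * x))
    (fun n => by fun_prop) (fun n => 1 / 4) (fun n x => ?_) (fun x hx => ?_) h
  · have h1 : Real.sin (Real.pi / 2 * x) ^ 2 = 1 / 2 - Real.cos (Real.pi * x) / 2 := by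
      rw [Real.sin_sq_eq_half_sub]; congr 3; ring
    have h2 : Real.cos (freq (n + 1) * x) = Real.cos (freq n * x) * Real.cos (Real.pi * x)
        - Real.sin (freq n * x) * Real.sin (Real.pi * x) := by
      rw [← Real.cos_add]; congr 1; unfold freq; push_cast; ring
    have h3 : Real.cos (freq (n - 1) * x) = Real.cos (freq n * x) * Real.cos (Real.pi * x)
        + Real.sin (freq n * x) * Real.sin (Real.pi * x) := by
      rw [← Real.cos_sub]
      rcases Nat.eq_zero_or_pos n with rfl | hn
      · rw [← Real.cos_neg]; congr 1; unfold freq; push_cast; ring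
      · congr 1; unfold freq; push_cast [Nat.cast_sub hn]; ring
    rw [h1, h2, h3]
    ring
  · have hpi := Real.pi_pos
    have h1 : 0 < freq 0 * x := mul_pos (freq_pos 0) hx.1
    refine (Real.cos_pos_of_mem_Ioo ⟨by linarith, ?_⟩).ne'
    unfold freq; push_cast; nlinarith [hx.2]

theorem L2Q.eq_zero_of_integral_mul_sin {T : ℝ} (f : L2Q T)
    (h : ∀ (n : ℕ) (η : ℝ → ℝ), Continuous η →
      ∫ p, f p * (Real.sin (freq n * p.1) * η p.2) ∂(muQ T) = 0) : f = 0 := by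
  have : IsFiniteMeasure (muQ T) := by rw [muQ_eq_prod]; infer_instance
  have hf : Integrable (f : ℝ × ℝ → ℝ) (muQ T) := (Lp.memLp f).integrable (by norm_num)
  have hi : ∀ g : ℝ × ℝ → ℝ, Continuous g → Integrable (fun p => f p * g p) (muQ T) :=
    fun g hg => hf.mul_of_top_left (hg.memLp_muQ T ∞)
  have hn : ∀ n : ℕ, ∀ᵐ t ∂(muT T), ∫ x, f (x, t) * Real.sin (freq n * x) ∂muOm = 0 := by
    intro n
    have hFn : Integrable (fun t => ∫ x, f (x, t) * Real.sin (freq n * x) ∂muOm) (muT T) := by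
      have h1 : Integrable (fun p => f p * Real.sin (freq n * p.1)) (muOm.prod (muT T)) := by
        rw [← muQ_eq_prod]
        exact hi (fun p => Real.sin (freq n * p.1)) (by fun_prop)
      exact h1.integral_prod_right
    have hz := isOpen_Ioo.ae_eq_zero_of_integral_contDiff_smul_eq_zero (U := Ioo (0 : ℝ) T)
      (μ := volume) (f := fun t => ∫ x, f (x, t) * Real.sin (freq n * x) ∂muOm)
      (IntegrableOn.locallyIntegrableOn hFn) (fun η hη _ hsupp => by
        have h1 : ∫ t, η t • ∫ x, f (x, t) * Real.sin (freq n * x) ∂muOm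
            = ∫ t in Ioo (0 : ℝ) T, η t • ∫ x, f (x, t) * Real.sin (freq n * x) ∂muOm := by
          refine (setIntegral_eq_integral_of_forall_compl_eq_zero fun x hx => ?_).symm
          rw [image_eq_zero_of_notMem_tsupport fun hx' => hx (hsupp hx'), zero_smul]
        rw [h1]
        refine Eq.trans ?_ (h n η hη.continuous)
        rw [integral_muQ_eq_iterated (hi _ (by have := hη.continuous; fun_prop))]
        refine integral_congr_ae (Eventually.of_forall fun t => ?_)
        simp only [smul_eq_mul]
        rw [← integral_const_mul]
        refine integral_congr_ae (Eventually.of_forall fun x => ?_)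
        simp only
        ring)
    filter_upwards [ae_restrict_of_ae hz, ae_restrict_mem measurableSet_Ioo] with t ht ht1
      using ht ht1
  have hslice : ∀ᵐ t ∂(muT T), Integrable (fun x => f (x, t)) muOm := by
    have h1 : Integrable (f : ℝ × ℝ → ℝ) (muOm.prod (muT T)) := by rwa [← muQ_eq_prod]
    exact h1.prod_left_ae
  have hzero : ∀ᵐ t ∂(muT T), ∀ᵐ x ∂muOm, f (x, t) = 0 := by
    filter_upwards [ae_all_iff.2 hn, hslice] with t h1 h2
    exact ae_eq_zero_of_integral_mul_sin h2 h1
  have hnorm : ‖f‖ ^ 2 = 0 := by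
    rw [Lp_two_norm_sq, integral_muQ_eq_iterated ((Lp.memLp f).integrable_sq)]
    rw [integral_congr_ae (g := fun _ => (0 : ℝ))]
    · simp
    · filter_upwards [hzero] with t ht
      rw [integral_congr_ae (g := fun _ => (0 : ℝ))]
      · simp
      · filter_upwards [ht] with x hx
        simp [hx]
  exact norm_eq_zero.1 (pow_eq_zero_iff two_ne_zero |>.1 hnorm)

theorem eq_top_of_isClosed_of_inner_eq_zero {E : Type*} [NormedAddCommGroup E]
    [InnerProductSpace ℝ E] [CompleteSpace E] {V : Submodule ℝ E} (hV : IsClosed (V : Set E))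
    (h : ∀ f : E, (∀ v ∈ V, inner ℝ f v = 0) → f = 0) : V = ⊤ := by
  rw [← hV.submodule_topologicalClosure_eq, Submodule.topologicalClosure_eq_top_iff,
    Submodule.eq_bot_iff]
  intro f hf
  exact h f fun v hv => (Submodule.mem_orthogonal' V f).1 hf v hv

/-! ### Density of the data of classical solutions -/

namespace WaveSolution

variable (S : WaveSolution)

/-- `φ(·,t)` as an element of `L²(Ω)`. -/
def phiAt (t : ℝ) : L2Om := toOm (fun x => S.φ (x, t)) (continuous_slice_left S.hφ t)

/-- `G(·,t)` as an element of `L²(Ω)`. -/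
def GAt (t : ℝ) : L2Om := toOm (fun x => S.G (x, t)) (continuous_slice_left S.hG t)

/-- The data `(φ(·,0), G(·,0), F)` of a classical solution. -/
def data (T : ℝ) : L2Om × L2Om × L2Q T := (S.phiAt 0, S.GAt 0, toQ T S.F S.hF)

theorem phiAt_addSMul (c : ℝ) (S' : WaveSolution) (t : ℝ) :
    (S.addSMul c S').phiAt t = S.phiAt t + c • S'.phiAt t := rfl

theorem GAt_addSMul (c : ℝ) (S' : WaveSolution) (t : ℝ) :
    (S.addSMul c S').GAt t = S.GAt t + c • S'.GAt t := rfl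

theorem data_addSMul (c : ℝ) (S' : WaveSolution) (T : ℝ) :
    (S.addSMul c S').data T = S.data T + c • S'.data T := rfl

theorem data_zero (T : ℝ) : zero.data T = 0 := by
  have h := data_addSMul zero (-1) zero T
  have h2 : (zero.addSMul (-1) zero).data T = zero.data T := by
    unfold data phiAt GAt
    congr 2 <;> simp [addSMul, zero]
  rw [h2] at h
  simpa using h

/-- The data of classical solutions. -/
def dataSubmodule (T : ℝ) : Submodule ℝ (L2Om × L2Om × L2Q T) where
  carrier := range fun S : WaveSolution => S.data T
  zero_mem' := ⟨zero, data_zero T⟩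
  add_mem' := by
    rintro _ _ ⟨S, rfl⟩ ⟨S', rfl⟩
    exact ⟨S.addSMul 1 S', by simp [data_addSMul]⟩
  smul_mem' := by
    rintro c _ ⟨S, rfl⟩
    exact ⟨zero.addSMul c S, by simp [data_addSMul, data_zero]⟩

theorem mode_data_mem (T : ℝ) (n : ℕ) (α β : ℝ) {η : ℝ → ℝ} (hη : Continuous η) :
    ((α • toOm (fun x => Real.sin (freq n * x)) (by fun_prop),
      β • toOm (fun x => Real.cos (freq n * x)) (by fun_prop),
      toQ T (fun p => Real.sin (freq n * p.1) * η p.2) (by fun_prop)) : L2Om × L2Om × L2Q T)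
      ∈ dataSubmodule T := by
  have hn := (freq_pos n).ne'
  obtain ⟨b, b', hb, hb', h0, h1⟩ := exists_oscillator hn hη 0 α (-(β * freq n))
  refine ⟨mode n b b' η hη hb hb', ?_⟩
  refine Prod.ext ?_ (Prod.ext ?_ rfl)
  · apply Lp.ext
    refine (coeFn_toOm (continuous_slice_left (mode n b b' η hη hb hb').hφ 0)).trans ?_
    refine EventuallyEq.trans ?_ (Lp.coeFn_smul _ _).symm
    filter_upwards [coeFn_toOm (f := fun x => Real.sin (freq n * x)) (by fun_prop)] with x hx
    simp only [mode, h0, Pi.smul_apply, hx, smul_eq_mul]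
    ring
  · apply Lp.ext
    refine (coeFn_toOm (continuous_slice_left (mode n b b' η hη hb hb').hG 0)).trans ?_
    refine EventuallyEq.trans ?_ (Lp.coeFn_smul _ _).symm
    filter_upwards [coeFn_toOm (f := fun x => Real.cos (freq n * x)) (by fun_prop)] with x hx
    simp only [mode, h1, Pi.smul_apply, hx, smul_eq_mul]
    field_simp

theorem dataSubmodule_dense (T : ℝ) : (dataSubmodule T).topologicalClosure = ⊤ := by
  set V := (dataSubmodule T).topologicalClosure with hV
  have hVc : IsClosed (V : Set (L2Om × L2Om × L2Q T)) := Submodule.isClosed_topologicalClosure _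
  have hmode : ∀ (n : ℕ) (α β : ℝ) {η : ℝ → ℝ} (hη : Continuous η),
    ((α • toOm (fun x => Real.sin (freq n * x)) (by fun_prop),
      β • toOm (fun x => Real.cos (freq n * x)) (by fun_prop),
      toQ T (fun p => Real.sin (freq n * p.1) * η p.2) (by fun_prop)) : L2Om × L2Om × L2Q T)
      ∈ V := fun n α β η hη => Submodule.le_topologicalClosure _ (mode_data_mem T n α β hη)
  have hQ0 : ∀ n : ℕ, toQ T (fun p => Real.sin (freq n * p.1) * (fun _ => (0 : ℝ)) p.2)
      (by fun_prop) = 0 := by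
    intro n
    apply Lp.ext
    refine (coeFn_toQ _).trans ?_
    filter_upwards [Lp.coeFn_zero ℝ 2 (muQ T)] with x hx
    rw [hx]
    simp
  have h1 : V.comap (LinearMap.inl ℝ L2Om (L2Om × L2Q T)) = ⊤ := by
    refine eq_top_of_isClosed_of_inner_eq_zero
      (hVc.preimage (ContinuousLinearMap.inl ℝ L2Om (L2Om × L2Q T)).continuous) fun f hf => ?_
    apply Lp.eq_zero_iff_ae_eq_zero.2
    refine ae_eq_zero_of_integral_mul_sin f.integrable fun n => ?_
    have h2 := hf (toOm (fun x => Real.sin (freq n * x)) (by fun_prop)) (by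
      have h3 := hmode n 1 0 (η := fun _ => 0) continuous_const
      rw [hQ0, one_smul, zero_smul] at h3
      exact h3)
    rw [Lp_two_inner] at h2
    rw [← h2]
    refine integral_congr_ae ?_
    filter_upwards [coeFn_toOm (f := fun x => Real.sin (freq n * x)) (by fun_prop)] with x hx
    rw [hx]
  have h2 : V.comap ((LinearMap.inr ℝ L2Om (L2Om × L2Q T)).comp (LinearMap.inl ℝ L2Om (L2Q T)))
      = ⊤ := by
    refine eq_top_of_isClosed_of_inner_eq_zero
      (hVc.preimage ((ContinuousLinearMap.inr ℝ L2Om (L2Om × L2Q T)).comp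
        (ContinuousLinearMap.inl ℝ L2Om (L2Q T))).continuous) fun f hf => ?_
    apply Lp.eq_zero_iff_ae_eq_zero.2
    refine ae_eq_zero_of_integral_mul_cos f.integrable fun n => ?_
    have h2 := hf (toOm (fun x => Real.cos (freq n * x)) (by fun_prop)) (by
      have h3 := hmode n 0 1 (η := fun _ => 0) continuous_const
      rw [hQ0, one_smul, zero_smul] at h3
      exact h3)
    rw [Lp_two_inner] at h2
    rw [← h2]
    refine integral_congr_ae ?_
    filter_upwards [coeFn_toOm (f := fun x => Real.cos (freq n * x)) (by fun_prop)] with x hx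
    rw [hx]
  have h3 : V.comap ((LinearMap.inr ℝ L2Om (L2Om × L2Q T)).comp (LinearMap.inr ℝ L2Om (L2Q T)))
      = ⊤ := by
    refine eq_top_of_isClosed_of_inner_eq_zero
      (hVc.preimage ((ContinuousLinearMap.inr ℝ L2Om (L2Om × L2Q T)).comp
        (ContinuousLinearMap.inr ℝ L2Om (L2Q T))).continuous) fun f hf => ?_
    refine L2Q.eq_zero_of_integral_mul_sin f fun n η hη => ?_
    have h2 := hf (toQ T (fun p => Real.sin (freq n * p.1) * η p.2) (by fun_prop)) (by
      have h3 := hmode n 0 0 hη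
      rw [zero_smul, zero_smul] at h3
      exact h3)
    rw [Lp_two_inner] at h2
    rw [← h2]
    refine integral_congr_ae ?_
    filter_upwards [coeFn_toQ (T := T) (f := fun p => Real.sin (freq n * p.1) * η p.2)
      (by fun_prop)] with x hx
    rw [hx]
  rw [eq_top_iff]
  rintro ⟨f, g, F⟩ -
  have m1 : f ∈ V.comap (LinearMap.inl ℝ L2Om (L2Om × L2Q T)) := h1 ▸ Submodule.mem_top
  have m2 : g ∈ V.comap ((LinearMap.inr ℝ L2Om (L2Om × L2Q T)).comp
    (LinearMap.inl ℝ L2Om (L2Q T))) := h2 ▸ Submodule.mem_top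
  have m3 : F ∈ V.comap ((LinearMap.inr ℝ L2Om (L2Om × L2Q T)).comp
    (LinearMap.inr ℝ L2Om (L2Q T))) := h3 ▸ Submodule.mem_top
  simp only [Submodule.mem_comap, LinearMap.comp_apply, LinearMap.inl_apply,
    LinearMap.inr_apply] at m1 m2 m3
  simpa using V.add_mem (V.add_mem m1 m2) m3

end WaveSolution

end

noncomputable section

theorem CauchySeq.of_norm_sub_le {X Y : Type*} [NormedAddCommGroup X] [NormedAddCommGroup Y]
    {x : ℕ → X} {d : ℕ → Y} {K : ℝ} (hK : 0 ≤ K) (hd : CauchySeq d)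
    (h : ∀ j k, ‖x j - x k‖ ≤ K * ‖d j - d k‖) : CauchySeq x := by
  rw [Metric.cauchySeq_iff] at hd ⊢
  intro ε hε
  obtain ⟨N, hN⟩ := hd (ε / (K + 1)) (by positivity)
  refine ⟨N, fun j hj k hk => ?_⟩
  have h1 := hN j hj k hk
  rw [dist_eq_norm] at h1 ⊢
  calc ‖x j - x k‖ ≤ K * ‖d j - d k‖ := h j k
    _ ≤ K * (ε / (K + 1)) := by gcongr
    _ < ε := by
      rw [mul_div_assoc', div_lt_iff₀ (by positivity)]
      nlinarith

theorem continuous_toOm_slice {f : ℝ × ℝ → ℝ} (hf : Continuous f) :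
    Continuous fun t => toOm (fun x => f (x, t)) (continuous_slice_left hf t) := by
  rw [continuous_iff_continuousAt]
  intro s
  rw [ContinuousAt, tendsto_iff_norm_sub_tendsto_zero]
  have h1 : ∀ t, ‖toOm (fun x => f (x, t)) (continuous_slice_left hf t)
      - toOm (fun x => f (x, s)) (continuous_slice_left hf s)‖
      = Real.sqrt (∫ x in (0 : ℝ)..1, (f (x, t) - f (x, s)) ^ 2) := by
    intro t
    have h2 : Continuous fun x => f (x, t) - f (x, s) := by fun_prop
    rw [← norm_sq_toOm h2, Real.sqrt_sq (norm_nonneg _)]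
    rfl
  simp_rw [h1]
  have h3 : Continuous fun t => Real.sqrt (∫ x in (0 : ℝ)..1, (f (x, t) - f (x, s)) ^ 2) :=
    (continuous_integral_slice_left (f := fun z => (f z - f (z.1, s)) ^ 2)
      (by fun_prop) 0 1).sqrt
  have h4 := h3.tendsto s
  simpa using h4

theorem inner_toOm_toOm {f g : ℝ → ℝ} (hf : Continuous f) (hg : Continuous g) :
    inner ℝ (toOm f hf) (toOm g hg) = ∫ x in (0 : ℝ)..1, f x * g x := by
  rw [Lp_two_inner, ← integral_muOm]
  refine integral_congr_ae ?_
  filter_upwards [coeFn_toOm hf, coeFn_toOm hg] with x h1 h2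
  rw [h1, h2]

theorem L2Om.eq_zero_of_inner_sin (f : L2Om)
    (h : ∀ n, inner ℝ (toOm (fun x => Real.sin (freq n * x)) (by fun_prop)) f = 0) : f = 0 := by
  apply Lp.eq_zero_iff_ae_eq_zero.2
  refine ae_eq_zero_of_integral_mul_sin f.integrable fun n => ?_
  rw [← h n, Lp_two_inner]
  refine integral_congr_ae ?_
  filter_upwards [coeFn_toOm (f := fun x => Real.sin (freq n * x)) (by fun_prop)] with x hx
  rw [hx, mul_comm]

/-- The fundamental theorem of calculus in `L²(Ω)`. -/
theorem toOm_slice_eq_add_integral {f p : ℝ × ℝ → ℝ} (hf : Continuous f) (hp : Continuous p)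
    (h : ∀ x t, HasDerivAt (fun s => f (x, s)) (p (x, t)) t) (t : ℝ) :
    toOm (fun x => f (x, t)) (continuous_slice_left hf t)
      = toOm (fun x => f (x, 0)) (continuous_slice_left hf 0)
        + ∫ s in (0 : ℝ)..t, toOm (fun x => p (x, s)) (continuous_slice_left hp s) := by
  rw [← sub_eq_zero]
  refine L2Om.eq_zero_of_inner_sin _ fun n => ?_
  have hc := continuous_toOm_slice hp
  rw [inner_sub_right, inner_add_right, inner_toOm_toOm, inner_toOm_toOm]
  have h1 : inner ℝ (toOm (fun x => Real.sin (freq n * x)) (by fun_prop))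
      (∫ s in (0 : ℝ)..t, toOm (fun x => p (x, s)) (continuous_slice_left hp s))
      = ∫ s in (0 : ℝ)..t, ∫ x in (0 : ℝ)..1, Real.sin (freq n * x) * p (x, s) := by
    rw [← innerSL_apply_apply ℝ, ← ContinuousLinearMap.intervalIntegral_comp_comm _
      (hc.intervalIntegrable _ _)]
    refine intervalIntegral.integral_congr fun s _ => ?_
    rw [innerSL_apply_apply, inner_toOm_toOm]
  rw [h1, intervalIntegral_swap (f := fun z => Real.sin (freq n * z.1) * p z) (by fun_prop),
    ← intervalIntegral.integral_add (Continuous.intervalIntegrable (by fun_prop) _ _)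
      ((continuous_integral_slice_right (f := fun z => Real.sin (freq n * z.1) * p z)
        (by fun_prop) 0 t).intervalIntegrable _ _), sub_eq_zero]
  refine intervalIntegral.integral_congr fun x _ => ?_
  simp only
  rw [intervalIntegral.integral_const_mul, intervalIntegral.integral_eq_sub_of_hasDerivAt
    (fun s _ => h x s) ((continuous_slice_right hp x).intervalIntegrable _ _)]
  ring

namespace WaveSolution

/-- `φ(1,·)` as an element of `L²(0,T)`. -/
def trace (S : WaveSolution) (T : ℝ) : L2T T :=
  toT T (fun t => S.φ (1, t)) (continuous_slice_right S.hφ 1)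

/-- `φ` as an element of `L²(Q_T)`. -/
def phiQ (S : WaveSolution) (T : ℝ) : L2Q T := toQ T S.φ S.hφ

theorem continuous_average (S : WaveSolution) (ε : ℝ) :
    Continuous fun t => ε⁻¹ * ∫ x in (1 - ε)..1, S.φ (x, t) :=
  continuous_const.mul (continuous_integral_slice_left S.hφ _ _)

/-- The averages of `φ` over `1 - ε < x < 1` as an element of `L²(0,T)`. -/
def average (S : WaveSolution) (T ε : ℝ) : L2T T :=
  toT T (fun t => ε⁻¹ * ∫ x in (1 - ε)..1, S.φ (x, t)) (S.continuous_average ε)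

theorem trace_addSMul (S S' : WaveSolution) (c T : ℝ) :
    (S.addSMul c S').trace T = S.trace T + c • S'.trace T := rfl

theorem phiQ_addSMul (S S' : WaveSolution) (c T : ℝ) :
    (S.addSMul c S').phiQ T = S.phiQ T + c • S'.phiQ T := rfl

theorem average_addSMul (S S' : WaveSolution) (c T ε : ℝ) :
    (S.addSMul c S').average T ε = S.average T ε + c • S'.average T ε := by
  have h : (fun t => ε⁻¹ * ∫ x in (1 - ε)..1, (S.addSMul c S').φ (x, t))
      = fun t => ε⁻¹ * (∫ x in (1 - ε)..1, S.φ (x, t))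
        + c * (ε⁻¹ * ∫ x in (1 - ε)..1, S'.φ (x, t)) := by
    ext t
    have h1 : ∫ x in (1 - ε)..1, (S.addSMul c S').φ (x, t)
        = (∫ x in (1 - ε)..1, S.φ (x, t)) + c * ∫ x in (1 - ε)..1, S'.φ (x, t) := by
      simp only [addSMul]
      rw [intervalIntegral.integral_add
        ((continuous_slice_left S.hφ t).intervalIntegrable _ _)
        (((continuous_slice_left S'.hφ t).const_mul c).intervalIntegrable _ _),
        intervalIntegral.integral_const_mul]
    rw [h1]
    ring
  unfold average
  rw [← toT_add_smul (S.continuous_average ε) (S'.continuous_average ε) c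
    (by rw [← h]; exact (S.addSMul c S').continuous_average ε)]
  congr 1

/-- The stability constant of the wave equation on `(0,T)`. -/
def stabConst (T : ℝ) : ℝ := Real.sqrt (3 * ((4 * T + 6) * Real.exp T))

theorem stabConst_nonneg (T : ℝ) : 0 ≤ stabConst T := Real.sqrt_nonneg _

theorem stabConst_sq {T : ℝ} (hT : 0 ≤ T) :
    stabConst T ^ 2 = 3 * ((4 * T + 6) * Real.exp T) := Real.sq_sqrt (by positivity)

variable (S : WaveSolution)

theorem norm_sq_phiAt_add (t : ℝ) : ‖S.phiAt t‖ ^ 2 + ‖S.GAt t‖ ^ 2 = S.energy t := by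
  have hφ := S.hφ; have hG := S.hG
  unfold phiAt GAt energy
  rw [norm_sq_toOm, norm_sq_toOm, intervalIntegral.integral_add
    (Continuous.intervalIntegrable (by fun_prop) _ _)
    (Continuous.intervalIntegrable (by fun_prop) _ _)]

theorem energy_add_le_data {T : ℝ} (hT : 0 ≤ T) :
    S.energy 0 + (∫ t in (0 : ℝ)..T, ∫ x in (0 : ℝ)..1, S.F (x, t) ^ 2) ≤ 3 * ‖S.data T‖ ^ 2 := by
  have hF2 : Continuous fun z => S.F z ^ 2 := S.hF.pow 2
  have h1 : ‖S.phiAt 0‖ ≤ ‖S.data T‖ := norm_fst_le (S.data T)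
  have h2 : ‖S.GAt 0‖ ≤ ‖S.data T‖ := (norm_fst_le (S.data T).2).trans (norm_snd_le (S.data T))
  have h3 : ‖toQ T S.F S.hF‖ ≤ ‖S.data T‖ :=
    (norm_snd_le (S.data T).2).trans (norm_snd_le (S.data T))
  rw [← norm_sq_phiAt_add, ← integral_muQ_eq_interval hT hF2, ← norm_sq_toQ S.hF]
  have k1 := pow_le_pow_left₀ (norm_nonneg _) h1 2
  have k2 := pow_le_pow_left₀ (norm_nonneg _) h2 2
  have k3 := pow_le_pow_left₀ (norm_nonneg _) h3 2
  linarith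

theorem le_stabConst_mul {T a N : ℝ} (hT : 0 ≤ T)
    (hN : 0 ≤ N) (h : a ^ 2 ≤ (4 * T + 6) * Real.exp T * (3 * N ^ 2)) : a ≤ stabConst T * N := by
  refine (le_abs_self a).trans (abs_le_of_sq_le_sq ?_ (mul_nonneg (stabConst_nonneg T) hN))
  rw [mul_pow, stabConst_sq hT]
  linarith

theorem energy_le_data {T t : ℝ} (hT : 0 ≤ T) (ht : t ∈ Icc 0 T) :
    S.energy t ≤ Real.exp T * (3 * ‖S.data T‖ ^ 2) :=
  (S.energy_le ht).trans (mul_le_mul_of_nonneg_left (S.energy_add_le_data hT) (Real.exp_pos T).le)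

theorem norm_phiAt_le {T t : ℝ} (hT : 0 ≤ T) (ht : t ∈ Icc 0 T) :
    ‖S.phiAt t‖ ≤ stabConst T * ‖S.data T‖ := by
  refine le_stabConst_mul hT (norm_nonneg _) ?_
  have h1 := S.energy_le_data hT ht
  rw [← norm_sq_phiAt_add] at h1
  have h2 : 0 ≤ Real.exp T * (3 * ‖S.data T‖ ^ 2) := by positivity
  nlinarith [sq_nonneg ‖S.GAt t‖]

theorem norm_GAt_le {T t : ℝ} (hT : 0 ≤ T) (ht : t ∈ Icc 0 T) :
    ‖S.GAt t‖ ≤ stabConst T * ‖S.data T‖ := by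
  refine le_stabConst_mul hT (norm_nonneg _) ?_
  have h1 := S.energy_le_data hT ht
  rw [← norm_sq_phiAt_add] at h1
  have h2 : 0 ≤ Real.exp T * (3 * ‖S.data T‖ ^ 2) := by positivity
  nlinarith [sq_nonneg ‖S.phiAt t‖]

theorem norm_phiQ_le {T : ℝ} (hT : 0 ≤ T) : ‖S.phiQ T‖ ≤ stabConst T * ‖S.data T‖ := by
  refine le_stabConst_mul hT (norm_nonneg _) ?_
  have hφ2 : Continuous fun z => S.φ z ^ 2 := S.hφ.pow 2
  have h2 : 0 ≤ Real.exp T * (3 * ‖S.data T‖ ^ 2) := by positivity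
  unfold phiQ
  rw [norm_sq_toQ, integral_muQ_eq_interval hT hφ2]
  calc ∫ t in (0 : ℝ)..T, ∫ x in (0 : ℝ)..1, S.φ (x, t) ^ 2
      ≤ ∫ t in (0 : ℝ)..T, Real.exp T * (3 * ‖S.data T‖ ^ 2) := by
        refine intervalIntegral.integral_mono_on hT
          ((continuous_integral_slice_left hφ2 0 1).intervalIntegrable _ _)
          intervalIntegrable_const fun t ht => ?_
        have h1 := S.energy_le_data hT ht
        rw [← norm_sq_phiAt_add] at h1
        rw [← norm_sq_toOm (continuous_slice_left S.hφ t)]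
        have h3 : ‖S.phiAt t‖ ^ 2 = ‖toOm (fun x => S.φ (x, t)) (continuous_slice_left S.hφ t)‖ ^ 2 :=
          rfl
        linarith [sq_nonneg ‖S.GAt t‖]
    _ = T * (Real.exp T * (3 * ‖S.data T‖ ^ 2)) := by
        rw [intervalIntegral.integral_const, sub_zero, smul_eq_mul]
    _ ≤ _ := by nlinarith

theorem integral_sq_slice_le_data {T x : ℝ} (hT : 0 ≤ T) (hx0 : 1 / 2 ≤ x) (hx1 : x ≤ 1) :
    ∫ t in (0 : ℝ)..T, S.φ (x, t) ^ 2 ≤ (4 * T + 6) * Real.exp T * (3 * ‖S.data T‖ ^ 2) :=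
  (S.integral_sq_slice_le hT hx0 hx1).trans
    (mul_le_mul_of_nonneg_left (S.energy_add_le_data hT) (by positivity))

theorem norm_trace_le {T : ℝ} (hT : 0 ≤ T) : ‖S.trace T‖ ≤ stabConst T * ‖S.data T‖ := by
  refine le_stabConst_mul hT (norm_nonneg _) ?_
  unfold trace
  rw [norm_sq_toT hT]
  exact S.integral_sq_slice_le_data hT (by norm_num) le_rfl

theorem norm_average_le {T ε : ℝ} (hT : 0 ≤ T) (hε : 0 < ε) (hε' : ε ≤ 1 / 2) :
    ‖S.average T ε‖ ≤ stabConst T * ‖S.data T‖ := by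
  refine le_stabConst_mul hT (norm_nonneg _) ?_
  have hφ2 : Continuous fun z => S.φ z ^ 2 := S.hφ.pow 2
  unfold average
  rw [norm_sq_toT hT]
  calc ∫ t in (0 : ℝ)..T, (ε⁻¹ * ∫ x in (1 - ε)..1, S.φ (x, t)) ^ 2
      ≤ ∫ t in (0 : ℝ)..T, ε⁻¹ * ∫ x in (1 - ε)..1, S.φ (x, t) ^ 2 := by
        refine intervalIntegral.integral_mono_on hT
          (((S.continuous_average ε).pow 2).intervalIntegrable _ _)
          ((continuous_const.mul
            (continuous_integral_slice_left hφ2 _ _)).intervalIntegrable _ _) fun t _ => ?_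
        have h1 := sq_intervalIntegral_le_mul (continuous_slice_left S.hφ t)
          (c := 1 - ε) (d := 1) (by linarith)
        rw [sub_sub_cancel] at h1
        calc (ε⁻¹ * ∫ x in (1 - ε)..1, S.φ (x, t)) ^ 2
            = ε⁻¹ ^ 2 * (∫ x in (1 - ε)..1, S.φ (x, t)) ^ 2 := by ring
          _ ≤ ε⁻¹ ^ 2 * (ε * ∫ x in (1 - ε)..1, S.φ (x, t) ^ 2) := by gcongr
          _ = _ := by field_simp
    _ = ε⁻¹ * ∫ x in (1 - ε)..1, ∫ t in (0 : ℝ)..T, S.φ (x, t) ^ 2 := by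
        rw [intervalIntegral.integral_const_mul, intervalIntegral_swap hφ2]
    _ ≤ ε⁻¹ * ∫ x in (1 - ε)..1, (4 * T + 6) * Real.exp T * (3 * ‖S.data T‖ ^ 2) := by
        gcongr
        refine intervalIntegral.integral_mono_on (by linarith)
          ((continuous_integral_slice_right hφ2 _ _).intervalIntegrable _ _)
          intervalIntegrable_const fun x hx => ?_
        exact S.integral_sq_slice_le_data hT (by linarith [hx.1]) hx.2
    _ = _ := by
        rw [intervalIntegral.integral_const, sub_sub_cancel, smul_eq_mul]
        field_simp

theorem tendsto_average {T : ℝ} (hT : 0 ≤ T) :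
    Tendsto (fun ε => S.average T ε) (𝓝[>] 0) (𝓝 (S.trace T)) := by
  obtain ⟨M, hM⟩ := (isCompact_Icc.prod isCompact_Icc :
    IsCompact (Icc (0 : ℝ) 1 ×ˢ Icc (0 : ℝ) T)).exists_bound_of_continuousOn S.hq.continuousOn
  have hM0 : 0 ≤ M := (norm_nonneg _).trans (hM (0, 0) ⟨by simp, by simp [hT]⟩)
  have hlip : ∀ t ∈ Icc 0 T, ∀ x ∈ Icc (0 : ℝ) 1, |S.φ (x, t) - S.φ (1, t)| ≤ M * (1 - x) := by
    intro t ht x hx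
    have h1 := intervalIntegral.integral_eq_sub_of_hasDerivAt (a := x) (b := 1)
      (fun y _ => S.φ_dx y t) ((continuous_slice_left S.hq t).intervalIntegrable _ _)
    rw [abs_sub_comm, ← h1, ← Real.norm_eq_abs]
    have h2 := intervalIntegral.norm_integral_le_of_norm_le_const (a := x) (b := 1) (C := M)
      (f := fun y => S.q (y, t)) (fun y hy => by
        rw [uIoc_of_le hx.2] at hy
        exact hM (y, t) ⟨⟨hx.1.trans hy.1.le, hy.2⟩, ht⟩)
    rwa [abs_of_nonneg (by linarith [hx.2])] at h2
  have hpt : ∀ ε, 0 < ε → ε ≤ 1 → ∀ t ∈ Icc 0 T,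
      |ε⁻¹ * (∫ x in (1 - ε)..1, S.φ (x, t)) + (-1) * S.φ (1, t)| ≤ M * ε := by
    intro ε hε hε1 t ht
    have h1 : ε⁻¹ * (∫ x in (1 - ε)..1, S.φ (x, t)) + (-1) * S.φ (1, t)
        = ε⁻¹ * ∫ x in (1 - ε)..1, (S.φ (x, t) - S.φ (1, t)) := by
      rw [intervalIntegral.integral_sub ((continuous_slice_left S.hφ t).intervalIntegrable _ _)
        intervalIntegrable_const, intervalIntegral.integral_const]
      simp only [sub_sub_cancel, smul_eq_mul]
      field_simp
      ring
    have h2 := intervalIntegral.norm_integral_le_of_norm_le_const (a := 1 - ε) (b := 1)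
      (C := M * ε) (f := fun x => S.φ (x, t) - S.φ (1, t)) (fun x hx => by
        rw [uIoc_of_le (by linarith)] at hx
        refine (hlip t ht x ⟨by linarith [hx.1], hx.2⟩).trans ?_
        gcongr
        linarith [hx.1])
    rw [sub_sub_cancel, abs_of_pos hε, Real.norm_eq_abs] at h2
    rw [h1, abs_mul, abs_of_pos (inv_pos.2 hε)]
    calc ε⁻¹ * |∫ x in (1 - ε)..1, (S.φ (x, t) - S.φ (1, t))| ≤ ε⁻¹ * (M * ε * ε) := by gcongr
      _ = M * ε := by field_simp
  rw [tendsto_iff_norm_sub_tendsto_zero]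
  have hlim : Tendsto (fun ε : ℝ => Real.sqrt T * (M * ε)) (𝓝[>] 0) (𝓝 0) := by
    have : Tendsto (fun ε : ℝ => Real.sqrt T * (M * ε)) (𝓝 0) (𝓝 (Real.sqrt T * (M * 0))) :=
      (continuous_const.mul (continuous_const.mul continuous_id)).tendsto 0
    rw [mul_zero, mul_zero] at this
    exact this.mono_left nhdsWithin_le_nhds
  refine squeeze_zero' (Eventually.of_forall fun _ => norm_nonneg _) ?_ hlim
  filter_upwards [self_mem_nhdsWithin,
    mem_nhdsWithin_of_mem_nhds (Iic_mem_nhds (zero_lt_one' ℝ))] with ε hε hε1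
  have hc : Continuous fun t => ε⁻¹ * (∫ x in (1 - ε)..1, S.φ (x, t)) + (-1) * S.φ (1, t) :=
    (S.continuous_average ε).add (continuous_const.mul (continuous_slice_right S.hφ 1))
  have h1 : S.average T ε - S.trace T = toT T _ hc := by
    rw [toT_add_smul (S.continuous_average ε) (continuous_slice_right S.hφ 1), sub_eq_add_neg,
      neg_one_smul]
    rfl
  have hε0 : 0 < ε := hε
  rw [h1]
  refine (le_abs_self _).trans (abs_le_of_sq_le_sq ?_ (by positivity))
  rw [norm_sq_toT hT, mul_pow, Real.sq_sqrt hT]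
  calc ∫ t in (0 : ℝ)..T, (ε⁻¹ * (∫ x in (1 - ε)..1, S.φ (x, t)) + (-1) * S.φ (1, t)) ^ 2
      ≤ ∫ t in (0 : ℝ)..T, (M * ε) ^ 2 := by
        refine intervalIntegral.integral_mono_on hT ((hc.pow 2).intervalIntegrable _ _)
          intervalIntegrable_const fun t ht => ?_
        exact sq_le_sq' (abs_le.1 (hpt ε hε0 hε1 t ht)).1 (abs_le.1 (hpt ε hε0 hε1 t ht)).2
    _ = T * (M * ε) ^ 2 := by simp

/-- The time derivative of a classical solution in `H⁻¹₍₀₎(Ω)`. -/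
theorem L2toHm1_phiAt (t : ℝ) :
    L2toHm1 (S.phiAt t) = L2toHm1 (S.phiAt 0) + ∫ s in (0 : ℝ)..t, dxDual (S.GAt s) := by
  have h1 : S.phiAt t = S.phiAt 0 + ∫ s in (0 : ℝ)..t,
      toOm (fun x => S.p (x, s)) (continuous_slice_left S.hp s) :=
    toOm_slice_eq_add_integral S.hφ S.hp S.φ_dt t
  rw [h1, L2toHm1_eq, L2toHm1_eq, map_add, ← ContinuousLinearMap.intervalIntegral_comp_comm _
    ((continuous_toOm_slice S.hp).intervalIntegrable _ _)]
  congr 1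
  refine intervalIntegral.integral_congr fun s _ => ?_
  exact L2toHm1_toOm_eq_dxDual _ (fun x => S.G_dx x s) _ (S.G_one s)

theorem continuous_phiAt : Continuous S.phiAt := continuous_toOm_slice S.hφ

theorem continuous_GAt : Continuous S.GAt := continuous_toOm_slice S.hG

end WaveSolution

end

noncomputable section

/-! ### Limits of classical solutions -/

/-- The classical solutions `S k` converge to a solution with data `d`: `φ → Φ` and `G → Γ`
uniformly on `[0,T]` with values in `L²(Ω)`, `φ → ψ` in `L²(Q_T)` and `φ(1,·) → u` in `L²(0,T)`. -/
structure IsWaveLimit (T : ℝ) (d : L2Om × L2Om × L2Q T) (S : ℕ → WaveSolution)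
    (Φ Γ : ℝ → L2Om) (ψ : L2Q T) (u : L2T T) : Prop where
  data : Tendsto (fun k => (S k).data T) atTop (𝓝 d)
  phi : TendstoUniformlyOn (fun k => (S k).phiAt) Φ atTop (Icc 0 T)
  G : TendstoUniformlyOn (fun k => (S k).GAt) Γ atTop (Icc 0 T)
  phiQ : Tendsto (fun k => (S k).phiQ T) atTop (𝓝 ψ)
  trace : Tendsto (fun k => (S k).trace T) atTop (𝓝 u)

theorem exists_tendstoUniformlyOn_of_norm_sub_le {X Y : Type*} [NormedAddCommGroup X]
    [CompleteSpace X] [NormedAddCommGroup Y] {f : ℕ → ℝ → X} {s : Set ℝ} {d : ℕ → Y} {K : ℝ}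
    (hK : 0 ≤ K) (hd : CauchySeq d) (h : ∀ j k, ∀ t ∈ s, ‖f j t - f k t‖ ≤ K * ‖d j - d k‖) :
    ∃ g : ℝ → X, TendstoUniformlyOn f g atTop s := by
  have hlim : ∀ t, ∃ x, t ∈ s → Tendsto (fun k => f k t) atTop (𝓝 x) := by
    intro t
    by_cases ht : t ∈ s
    · obtain ⟨x, hx⟩ := cauchySeq_tendsto_of_complete
        (CauchySeq.of_norm_sub_le hK hd fun j k => h j k t ht)
      exact ⟨x, fun _ => hx⟩
    · exact ⟨0, fun h => absurd h ht⟩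
  choose g hg using hlim
  refine ⟨g, UniformCauchySeqOn.tendstoUniformlyOn_of_tendsto ?_ fun t ht => hg t ht⟩
  rw [Metric.uniformCauchySeqOn_iff]
  rw [Metric.cauchySeq_iff] at hd
  intro ε hε
  obtain ⟨N, hN⟩ := hd (ε / (K + 1)) (by positivity)
  refine ⟨N, fun j hj k hk t ht => ?_⟩
  have h1 := hN j hj k hk
  rw [dist_eq_norm] at h1 ⊢
  calc ‖f j t - f k t‖ ≤ K * ‖d j - d k‖ := h j k t ht
    _ ≤ K * (ε / (K + 1)) := by gcongr
    _ < ε := by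
      rw [mul_div_assoc', div_lt_iff₀ (by positivity)]
      nlinarith

namespace WaveSolution

variable (S S' : WaveSolution) {T : ℝ}

theorem data_sub : (S.addSMul (-1) S').data T = S.data T - S'.data T := by
  rw [data_addSMul, neg_one_smul, sub_eq_add_neg]

theorem norm_phiAt_sub_le (hT : 0 ≤ T) {t : ℝ} (ht : t ∈ Icc 0 T) :
    ‖S.phiAt t - S'.phiAt t‖ ≤ stabConst T * ‖S.data T - S'.data T‖ := by
  have h := (S.addSMul (-1) S').norm_phiAt_le hT ht
  rwa [phiAt_addSMul, neg_one_smul, ← sub_eq_add_neg, data_sub] at h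

theorem norm_GAt_sub_le (hT : 0 ≤ T) {t : ℝ} (ht : t ∈ Icc 0 T) :
    ‖S.GAt t - S'.GAt t‖ ≤ stabConst T * ‖S.data T - S'.data T‖ := by
  have h := (S.addSMul (-1) S').norm_GAt_le hT ht
  rwa [GAt_addSMul, neg_one_smul, ← sub_eq_add_neg, data_sub] at h

theorem norm_phiQ_sub_le (hT : 0 ≤ T) :
    ‖S.phiQ T - S'.phiQ T‖ ≤ stabConst T * ‖S.data T - S'.data T‖ := by
  have h := (S.addSMul (-1) S').norm_phiQ_le hT
  rwa [phiQ_addSMul, neg_one_smul, ← sub_eq_add_neg, data_sub] at h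

theorem norm_trace_sub_le (hT : 0 ≤ T) :
    ‖S.trace T - S'.trace T‖ ≤ stabConst T * ‖S.data T - S'.data T‖ := by
  have h := (S.addSMul (-1) S').norm_trace_le hT
  rwa [trace_addSMul, neg_one_smul, ← sub_eq_add_neg, data_sub] at h

theorem norm_average_sub_le (hT : 0 ≤ T) {ε : ℝ} (hε : 0 < ε) (hε' : ε ≤ 1 / 2) :
    ‖S.average T ε - S'.average T ε‖ ≤ stabConst T * ‖S.data T - S'.data T‖ := by
  have h := (S.addSMul (-1) S').norm_average_le hT hε hε'
  rwa [average_addSMul, neg_one_smul, ← sub_eq_add_neg, data_sub] at h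

end WaveSolution

open WaveSolution in
theorem exists_isWaveLimit {T : ℝ} (hT : 0 ≤ T) (d : L2Om × L2Om × L2Q T) :
    ∃ S Φ Γ ψ u, IsWaveLimit T d S Φ Γ ψ u := by
  have hd : d ∈ closure (dataSubmodule T : Set (L2Om × L2Om × L2Q T)) := by
    rw [← Submodule.topologicalClosure_coe, dataSubmodule_dense]
    trivial
  obtain ⟨e, he, hlim⟩ := mem_closure_iff_seq_limit.1 hd
  choose S hS using he
  have hdata : Tendsto (fun k => (S k).data T) atTop (𝓝 d) := hlim.congr fun k => (hS k).symm
  have hc := hdata.cauchySeq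
  have hK := stabConst_nonneg T
  obtain ⟨Φ, hΦ⟩ := exists_tendstoUniformlyOn_of_norm_sub_le (f := fun k => (S k).phiAt)
    (s := Icc 0 T) hK hc fun j k t ht => (S j).norm_phiAt_sub_le (S k) hT ht
  obtain ⟨Γ, hΓ⟩ := exists_tendstoUniformlyOn_of_norm_sub_le (f := fun k => (S k).GAt)
    (s := Icc 0 T) hK hc fun j k t ht => (S j).norm_GAt_sub_le (S k) hT ht
  obtain ⟨ψ, hψ⟩ := cauchySeq_tendsto_of_complete
    (CauchySeq.of_norm_sub_le hK hc fun j k => (S j).norm_phiQ_sub_le (S k) hT)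
  obtain ⟨u, hu⟩ := cauchySeq_tendsto_of_complete
    (CauchySeq.of_norm_sub_le hK hc fun j k => (S j).norm_trace_sub_le (S k) hT)
  exact ⟨S, Φ, Γ, ψ, u, hdata, hΦ, hΓ, hψ, hu⟩

theorem L2Q.memLp_slice {T : ℝ} (f : L2Q T) :
    ∀ᵐ t ∂(muT T), MemLp (fun x => f (x, t)) 2 muOm := by
  have : IsFiniteMeasure (muQ T) := by rw [muQ_eq_prod]; infer_instance
  have h1 : Integrable (f : ℝ × ℝ → ℝ) (muOm.prod (muT T)) := by
    rw [← muQ_eq_prod]; exact (Lp.memLp f).integrable (by norm_num)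
  have h2 : Integrable (fun p => f p ^ 2) (muOm.prod (muT T)) := by
    rw [← muQ_eq_prod]; exact (Lp.memLp f).integrable_sq
  filter_upwards [h1.prod_left_ae, h2.prod_left_ae] with t ht1 ht2
  exact (memLp_two_iff_integrable_sq ht1.aestronglyMeasurable).2 ht2

theorem intervalIntegral_near_one_congr {f g : ℝ → ℝ} (h : f =ᵐ[muOm] g) {ε : ℝ} (hε : 0 < ε)
    (hε' : ε ≤ 1) : ∫ x in (1 - ε)..1, f x = ∫ x in (1 - ε)..1, g x := by
  rw [intervalIntegral.integral_of_le (by linarith), intervalIntegral.integral_of_le (by linarith),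
    integral_Ioc_eq_integral_Ioo, integral_Ioc_eq_integral_Ioo]
  exact integral_congr_ae (ae_mono
    (Measure.restrict_mono (Ioo_subset_Ioo_left (by linarith)) le_rfl) h)

theorem continuous_intervalIntegral_near_one {ε : ℝ} (hε : 0 < ε) (hε' : ε ≤ 1) :
    Continuous fun f : L2Om => ∫ x in (1 - ε)..1, f x := by
  have hs : MeasurableSet (Ioo (1 - ε) 1) := measurableSet_Ioo
  have h : (fun f : L2Om => ∫ x in (1 - ε)..1, f x)
      = fun f : L2Om => inner ℝ (indicatorConstLp 2 hs (measure_ne_top muOm _) (1 : ℝ)) f := by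
    ext f
    rw [L2.inner_indicatorConstLp_one, Measure.restrict_restrict hs,
      inter_eq_left.2 (Ioo_subset_Ioo_left (by linarith)),
      intervalIntegral.integral_of_le (by linarith), integral_Ioc_eq_integral_Ioo]
  rw [h]
  fun_prop

namespace IsWaveLimit

open WaveSolution

variable {T : ℝ} {d : L2Om × L2Om × L2Q T} {S : ℕ → WaveSolution} {Φ Γ : ℝ → L2Om} {ψ : L2Q T}
  {u : L2T T}

theorem phi_zero (h : IsWaveLimit T d S Φ Γ ψ u) (hT : 0 ≤ T) : Φ 0 = d.1 :=
  tendsto_nhds_unique (h.phi.tendsto_at ⟨le_rfl, hT⟩)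
    ((continuous_fst.tendsto d).comp h.data)

theorem G_zero (h : IsWaveLimit T d S Φ Γ ψ u) (hT : 0 ≤ T) : Γ 0 = d.2.1 :=
  tendsto_nhds_unique (h.G.tendsto_at ⟨le_rfl, hT⟩)
    (((continuous_fst.comp continuous_snd).tendsto d).comp h.data)

theorem continuousOn_phi (h : IsWaveLimit T d S Φ Γ ψ u) : ContinuousOn Φ (Icc 0 T) :=
  h.phi.continuousOn (Eventually.of_forall fun k => (S k).continuous_phiAt.continuousOn).frequently

theorem continuousOn_G (h : IsWaveLimit T d S Φ Γ ψ u) : ContinuousOn Γ (Icc 0 T) :=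
  h.G.continuousOn (Eventually.of_forall fun k => (S k).continuous_GAt.continuousOn).frequently

theorem ae_eq_slice (h : IsWaveLimit T d S Φ Γ ψ u) :
    ∀ᵐ t ∂(muT T), (Φ t : ℝ → ℝ) =ᵐ[muOm] fun x => ψ (x, t) := by
  set v : ℕ → L2Q T := fun k => (S k).phiQ T - ψ with hv
  set g : ℕ → ℝ → ℝ := fun k t => ∫ x, v k (x, t) ^ 2 ∂muOm with hg
  have hsq : ∀ k, Integrable (fun p => v k p ^ 2) (muQ T) := fun k => (Lp.memLp (v k)).integrable_sq
  have hgi : ∀ k, Integrable (g k) (muT T) := by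
    intro k
    have h1 : Integrable (fun p => v k p ^ 2) (muOm.prod (muT T)) := by
      rw [← muQ_eq_prod]; exact hsq k
    exact h1.integral_prod_right
  have hgn : ∀ k t, 0 ≤ g k t := fun k t => integral_nonneg fun _ => sq_nonneg _
  have hnorm : ∀ k, eLpNorm (g k - 0) 1 (muT T) = ENNReal.ofReal (‖v k‖ ^ 2) := by
    intro k
    rw [sub_zero, eLpNorm_one_eq_lintegral_enorm, ← ofReal_integral_norm_eq_lintegral_enorm (hgi k),
      Lp_two_norm_sq, integral_muQ_eq_iterated (hsq k)]
    congr 1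
    refine integral_congr_ae (Eventually.of_forall fun t => ?_)
    exact Real.norm_of_nonneg (hgn k t)
  have htend : Tendsto (fun k => eLpNorm (g k - 0) 1 (muT T)) atTop (𝓝 0) := by
    simp_rw [hnorm]
    have h1 : Tendsto (fun k => ‖v k‖ ^ 2) atTop (𝓝 0) := by
      have h2 := (tendsto_iff_norm_sub_tendsto_zero.1 h.phiQ).pow 2
      simpa using h2
    simpa using ENNReal.tendsto_ofReal h1
  obtain ⟨ns, hns, hae⟩ := (tendstoInMeasure_of_tendsto_eLpNorm one_ne_zero
    (fun k => (hgi k).aestronglyMeasurable) aestronglyMeasurable_zero htend).exists_seq_tendsto_ae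
  have hcoe : ∀ᵐ t ∂(muT T), ∀ k, ∀ᵐ x ∂muOm, v k (x, t) = (S k).φ (x, t) - ψ (x, t) := by
    refine ae_all_iff.2 fun k => ae_muQ_slice (P := fun p => v k p = (S k).φ p - ψ p) ?_
    filter_upwards [Lp.coeFn_sub ((S k).phiQ T) ψ, coeFn_toQ (T := T) (S k).hφ] with p h1 h2
    rw [h1, Pi.sub_apply]
    congr 1
  filter_upwards [hae, hcoe, ψ.memLp_slice, ae_restrict_mem measurableSet_Ioo]
    with t h1 h2 h3 h4
  have hdist : ∀ k, ‖(S k).phiAt t - h3.toLp‖ ^ 2 = g k t := by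
    intro k
    rw [Lp_two_norm_sq]
    refine integral_congr_ae ?_
    filter_upwards [h2 k, Lp.coeFn_sub ((S k).phiAt t) (h3.toLp _), h3.coeFn_toLp,
      coeFn_toOm (continuous_slice_left (S k).hφ t)] with x k1 k2 k3 k4
    have k5 : (S k).phiAt t x = (S k).φ (x, t) := k4
    rw [k1, k2, Pi.sub_apply, k3, k5]
  have hlim1 : Tendsto (fun i => (S (ns i)).phiAt t) atTop (𝓝 (h3.toLp _)) := by
    rw [tendsto_iff_norm_sub_tendsto_zero]
    have h5 := (Real.continuous_sqrt.tendsto 0).comp h1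
    rw [Real.sqrt_zero] at h5
    refine h5.congr fun i => ?_
    rw [Function.comp_apply, ← hdist, Real.sqrt_sq (norm_nonneg _)]
  have hlim2 : Tendsto (fun i => (S (ns i)).phiAt t) atTop (𝓝 (Φ t)) :=
    (h.phi.tendsto_at ⟨h4.1.le, h4.2.le⟩).comp hns.tendsto_atTop
  rw [tendsto_nhds_unique hlim2 hlim1]
  exact h3.coeFn_toLp

theorem L2toHm1_phi (h : IsWaveLimit T d S Φ Γ ψ u) {t : ℝ} (ht : t ∈ Icc 0 T) :
    L2toHm1 (Φ t) = L2toHm1 (Φ 0) + ∫ s in (0 : ℝ)..t, dxDual (Γ s) := by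
  have hsub : uIcc 0 t ⊆ Icc 0 T := by
    rw [uIcc_of_le ht.1]; exact Icc_subset_Icc_right ht.2
  have h1 : ∀ s ∈ Icc 0 T, Tendsto (fun k => L2toHm1 ((S k).phiAt s)) atTop (𝓝 (L2toHm1 (Φ s))) :=
    fun s hs => ((pairing H10.toL2).continuous.tendsto _).comp (h.phi.tendsto_at hs)
  have h2 : Tendsto (fun k => ∫ s in (0 : ℝ)..t, dxDual ((S k).GAt s)) atTop
      (𝓝 (∫ s in (0 : ℝ)..t, dxDual (Γ s))) := by
    refine TendstoUniformlyOn.tendsto_intervalIntegral_of_continuousOn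
      (F := fun k s => dxDual ((S k).GAt s))
      (Eventually.of_forall fun k => (dxDual.continuous.comp (S k).continuous_GAt).continuousOn) ?_
    exact dxDual.uniformContinuous.comp_tendstoUniformlyOn (h.G.mono hsub)
  refine tendsto_nhds_unique (h1 t ht) ?_
  refine ((h1 0 ⟨le_rfl, ht.1.trans ht.2⟩).add h2).congr fun k => ?_
  exact ((S k).L2toHm1_phiAt t).symm

theorem isTimeRepresentative (h : IsWaveLimit T d S Φ Γ ψ u) (hT : 0 ≤ T) :
    IsTimeRepresentative T ψ Φ fun t => dxDual (Γ t) where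
  ae_eq := h.ae_eq_slice
  continuousOn := h.continuousOn_phi
  hasDeriv := by
    intro t ht
    have hext : Continuous fun s => dxDual (IccExtend hT ((Icc 0 T).domRestrict Γ) s) :=
      dxDual.continuous.comp (h.continuousOn_G.domRestrict.Icc_extend')
    have hval : ∀ s ∈ Icc 0 T, IccExtend hT ((Icc 0 T).domRestrict Γ) s = Γ s :=
      fun s hs => by rw [IccExtend_of_mem _ _ hs]; rfl
    have h1 : HasDerivAt (fun s => L2toHm1 (Φ 0)
        + ∫ r in (0 : ℝ)..s, dxDual (IccExtend hT ((Icc 0 T).domRestrict Γ) r)) (dxDual (Γ t)) t := by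
      rw [← hval t ht]
      exact (intervalIntegral.integral_hasDerivAt_right (hext.intervalIntegrable _ _)
        (hext.stronglyMeasurableAtFilter _ _) hext.continuousAt).const_add _
    refine h1.hasDerivWithinAt.congr_of_mem (fun s hs => ?_) ht
    rw [h.L2toHm1_phi hs]
    congr 1
    refine intervalIntegral.integral_congr fun r hr => ?_
    rw [uIcc_of_le hs.1] at hr
    rw [hval r ⟨hr.1, hr.2.trans hs.2⟩]
  continuousOn_deriv := dxDual.continuous.comp_continuousOn h.continuousOn_G

theorem exists_average (h : IsWaveLimit T d S Φ Γ ψ u) (hT : 0 ≤ T) {ε : ℝ} (hε : 0 < ε)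
    (hε' : ε ≤ 1 / 2) :
    ∃ v : L2T T, (v : ℝ → ℝ) =ᵐ[muT T] (fun t => ε⁻¹ * ∫ x in (1 - ε)..1, ψ (x, t)) ∧
      ∀ k, ‖v - (S k).average T ε‖ ≤ stabConst T * ‖d - (S k).data T‖ := by
  obtain ⟨v, hv⟩ := cauchySeq_tendsto_of_complete
    (CauchySeq.of_norm_sub_le (stabConst_nonneg T) h.data.cauchySeq
      fun j k => (S j).norm_average_sub_le (S k) hT hε hε')
  refine ⟨v, ?_, fun k => ?_⟩
  · obtain ⟨ns, hns, hae⟩ := (tendstoInMeasure_of_tendsto_Lp hv).exists_seq_tendsto_ae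
    have hcoe : ∀ᵐ t ∂(muT T), ∀ k, (S k).average T ε t
        = ε⁻¹ * ∫ x in (1 - ε)..1, (S k).φ (x, t) :=
      ae_all_iff.2 fun k => coeFn_toT ((S k).continuous_average ε)
    filter_upwards [hae, hcoe, h.ae_eq_slice, ae_restrict_mem measurableSet_Ioo]
      with t h1 h2 h3 h4
    have hε1 : ε ≤ 1 := by linarith
    have h5 : Tendsto (fun i => ε⁻¹ * ∫ x in (1 - ε)..1, (S (ns i)).phiAt t x) atTop
        (𝓝 (ε⁻¹ * ∫ x in (1 - ε)..1, Φ t x)) :=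
      (((continuous_intervalIntegral_near_one hε hε1).tendsto _).comp
        ((h.phi.tendsto_at ⟨h4.1.le, h4.2.le⟩).comp hns.tendsto_atTop)).const_mul _
    rw [intervalIntegral_near_one_congr h3 hε hε1] at h5
    refine tendsto_nhds_unique h1 (h5.congr fun i => ?_)
    rw [h2]
    exact congrArg (ε⁻¹ * ·) (intervalIntegral_near_one_congr
      (coeFn_toOm (continuous_slice_left (S (ns i)).hφ t)) hε hε1)
  · refine le_of_tendsto_of_tendsto' ((hv.sub_const _).norm)
      (((h.data.sub_const _).norm).const_mul _) fun j => ?_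
    exact (S j).norm_average_sub_le (S k) hT hε hε'

theorem isTraceAtOne (h : IsWaveLimit T d S Φ Γ ψ u) (hT : 0 ≤ T) : IsTraceAtOne T ψ u := by
  unfold IsTraceAtOne
  rw [ENNReal.tendsto_nhds_zero]
  intro δ hδ
  obtain ⟨r, hr0, hrδ⟩ : ∃ r : ℝ, 0 < r ∧ ENNReal.ofReal r ≤ δ := by
    rcases eq_or_ne δ ∞ with rfl | hne
    · exact ⟨1, one_pos, le_top⟩
    · exact ⟨δ.toReal, ENNReal.toReal_pos hδ.ne' hne, ENNReal.ofReal_toReal_le⟩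
  have hK := stabConst_nonneg T
  have hk : Tendsto (fun k => stabConst T * ‖d - (S k).data T‖ + ‖(S k).trace T - u‖) atTop
      (𝓝 0) := by
    have h1 : Tendsto (fun k => ‖d - (S k).data T‖) atTop (𝓝 0) := by
      simp_rw [norm_sub_rev d]
      exact tendsto_iff_norm_sub_tendsto_zero.1 h.data
    simpa using (h1.const_mul (stabConst T)).add (tendsto_iff_norm_sub_tendsto_zero.1 h.trace)
  obtain ⟨k, hk⟩ := (hk.eventually (gt_mem_nhds (half_pos hr0))).exists
  have hav := (tendsto_iff_norm_sub_tendsto_zero.1 ((S k).tendsto_average hT)).eventually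
    (gt_mem_nhds (half_pos hr0))
  filter_upwards [hav, self_mem_nhdsWithin,
    mem_nhdsWithin_of_mem_nhds (Iic_mem_nhds (show (0 : ℝ) < 1 / 2 by norm_num))] with ε h1 h2 h3
  obtain ⟨v, hv, hvk⟩ := h.exists_average hT h2 h3
  have h4 : eLpNorm (fun t => ε⁻¹ * (∫ x in (1 - ε)..1, ψ (x, t)) - u t) 2 (muT T)
      = ENNReal.ofReal ‖v - u‖ := by
    rw [Lp.norm_def, ENNReal.ofReal_toReal (Lp.eLpNorm_ne_top _)]
    refine eLpNorm_congr_ae ?_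
    filter_upwards [hv, Lp.coeFn_sub v u] with t k1 k2
    rw [k2, Pi.sub_apply, k1]
  rw [h4]
  refine le_trans (ENNReal.ofReal_le_ofReal ?_) hrδ
  have h5 : v - u = (v - (S k).average T ε) + ((S k).average T ε - (S k).trace T)
      + ((S k).trace T - u) := by abel
  rw [h5]
  refine (norm_add₃_le).trans ?_
  linarith [hvk k]

end IsWaveLimit

end

noncomputable section

/-! ### The multiplication operator of a bounded potential -/

theorem LinfQ.ae_abs_le {T : ℝ} (A : LinfQ T) : ∀ᵐ p ∂(muQ T), |A p| ≤ ‖A‖ := by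
  have h1 : ∀ᵐ p ∂(muQ T), ‖A p‖ₑ ≤ eLpNormEssSup A (muQ T) := ae_le_eLpNormEssSup
  filter_upwards [h1] with p hp
  rw [← eLpNorm_exponent_top] at hp
  rw [Lp.norm_def, ← Real.norm_eq_abs, ← toReal_enorm]
  exact ENNReal.toReal_mono (Lp.eLpNorm_ne_top A) hp

/-- Multiplication by `A ∈ L^∞(Q_T)` on `L²(Q_T)`. -/
def potential {T : ℝ} (A : LinfQ T) : L2Q T →L[ℝ] L2Q T :=
  LinearMap.mkContinuous
    { toFun := fun f => (A • f : L2Q T)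
      map_add' := fun f g => Lp.add_smul A f g
      map_smul' := fun c f => (Lp.smul_comm c A f).symm } ‖A‖ fun f => Lp.norm_smul_le A f

theorem coeFn_potential {T : ℝ} (A : LinfQ T) (f : L2Q T) :
    (potential A f : ℝ × ℝ → ℝ) =ᵐ[muQ T] fun p => A p * f p :=
  Lp.coeFn_lpSMul (r := 2) A f

theorem inner_potential {T : ℝ} (A : LinfQ T) (f g : L2Q T) :
    inner ℝ f (potential A g) = inner ℝ (potential A f) g := by
  rw [Lp_two_inner, Lp_two_inner]
  refine integral_congr_ae ?_
  filter_upwards [coeFn_potential A f, coeFn_potential A g] with p h1 h2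
  rw [h1, h2]
  ring

theorem inner_toQ_toQ {T : ℝ} {f g : ℝ × ℝ → ℝ} (hf : Continuous f) (hg : Continuous g) :
    inner ℝ (toQ T f hf) (toQ T g hg) = ∫ p, f p * g p ∂(muQ T) := by
  rw [Lp_two_inner]
  refine integral_congr_ae ?_
  filter_upwards [coeFn_toQ hf, coeFn_toQ hg] with x h1 h2
  rw [h1, h2]

theorem L2Om.integral_mul_toOm (f : L2Om) {g : ℝ → ℝ} (hg : Continuous g) :
    inner ℝ f (toOm g hg) = ∫ x, f x * g x ∂muOm := by
  rw [Lp_two_inner]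
  exact integral_congr_ae ((coeFn_toOm hg).mono fun x hx => by simp only [hx])

theorem L2Q.integral_mul_toQ {T : ℝ} (f : L2Q T) {g : ℝ × ℝ → ℝ} (hg : Continuous g) :
    inner ℝ f (toQ T g hg) = ∫ p, f p * g p ∂(muQ T) := by
  rw [Lp_two_inner]
  exact integral_congr_ae ((coeFn_toQ hg).mono fun x hx => by simp only [hx])

/-! ### Backward solutions with separated variables -/

theorem exists_sineMode (n : ℕ) : ∃ s : H10,
    H10.dx s = toOm (fun x => freq n * Real.cos (freq n * x)) (by fun_prop) ∧
      H10.toL2 s = toOm (fun x => Real.sin (freq n * x)) (by fun_prop) := by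
  have hc : Continuous fun x => freq n * Real.cos (freq n * x) := by fun_prop
  obtain ⟨s, hs⟩ := H10.dx_surjective (toOm _ hc)
  refine ⟨s, hs, Lp.ext ?_⟩
  filter_upwards [H10.toL2_ae s, coeFn_toOm (f := fun x => Real.sin (freq n * x)) (by fun_prop),
    ae_restrict_mem measurableSet_Ioo] with x h1 h2 hx
  rw [h1, h2, hs, L2Om.primitive_congr (coeFn_toOm hc) hx]
  have hd : ∀ y ∈ uIcc 0 x,
      HasDerivAt (fun r => Real.sin (freq n * r)) (freq n * Real.cos (freq n * y)) y := by
    intro y _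
    convert! ((hasDerivAt_id' y).const_mul (freq n)).sin using 1
    ring
  rw [intervalIntegral.integral_eq_sub_of_hasDerivAt hd (hc.intervalIntegrable _ _)]
  simp

theorem inner_cos_dx (n : ℕ) (z : H10) :
    inner ℝ (toOm (fun x => freq n * Real.cos (freq n * x)) (by fun_prop)) (H10.dx z)
      = freq n ^ 2 * inner ℝ (toOm (fun x => Real.sin (freq n * x)) (by fun_prop))
        (H10.toL2 z) := by
  have hp : Continuous fun x => -(freq n ^ 2) * Real.sin (freq n * x) := by fun_prop
  have hd : ∀ x, HasDerivAt (fun r => freq n * Real.cos (freq n * r))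
      (-(freq n ^ 2) * Real.sin (freq n * x)) x := by
    intro x
    convert! (((hasDerivAt_id' x).const_mul (freq n)).cos).const_mul (freq n) using 1
    ring
  have h := DFunLike.congr_fun
    (L2toHm1_toOm_eq_dxDual hp hd (by fun_prop) (by simp [cos_freq])) z
  rw [dxDual_apply, ← Lp_two_inner] at h
  have h2 : toOm (fun x => -(freq n ^ 2) * Real.sin (freq n * x)) hp
      = (-(freq n ^ 2)) • toOm (fun x => Real.sin (freq n * x)) (by fun_prop) := rfl
  rw [h2, L2toHm1_eq, pairing_apply, real_inner_smul_left] at h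
  linarith

theorem isBackwardWeakSolution_mode {T : ℝ} (A : LinfQ T) (n : ℕ) {a a' η : ℝ → ℝ}
    (hη : Continuous η) (ha : ∀ t, HasDerivAt a (a' t) t)
    (ha' : ∀ t, HasDerivAt a' (η t - freq n ^ 2 * a t) t) (haT : a T = 0) (haT' : a' T = 0)
    (hac : Continuous a) {s : H10}
    (hs : H10.dx s = toOm (fun x => freq n * Real.cos (freq n * x)) (by fun_prop))
    (hs' : H10.toL2 s = toOm (fun x => Real.sin (freq n * x)) (by fun_prop)) :
    IsBackwardWeakSolution T A
      (toQ T (fun p => Real.sin (freq n * p.1) * η p.2) (by fun_prop)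
        + potential A (toQ T (fun p => Real.sin (freq n * p.1) * a p.2) (by fun_prop)))
      (fun t => a t • s) (fun t => a' t • H10.toL2 s)
      (fun t => (η t - freq n ^ 2 * a t) • L2toHm1 (H10.toL2 s)) := by
  have hac' : Continuous a' := continuous_iff_continuousAt.2 fun t => (ha' t).continuousAt
  have hw2 : Continuous fun t => (η t - freq n ^ 2 * a t) • L2toHm1 (H10.toL2 s) := by fun_prop
  refine ⟨by fun_prop, fun t _ => ?_, by fun_prop, hw2.memLp_muT T 2, fun t _ => ?_, ?_,
    by simp [haT], by simp [haT']⟩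
  · simp only [map_smul]
    exact ((ha t).smul_const _).hasDerivWithinAt
  · have hd : ∀ r ∈ uIcc 0 t, HasDerivAt (fun r => a' r • L2toHm1 (H10.toL2 s))
        ((η r - freq n ^ 2 * a r) • L2toHm1 (H10.toL2 s)) r := fun r _ =>
      HasDerivAt.smul_const (F := Hm1) (ha' r) (L2toHm1 (H10.toL2 s))
    rw [intervalIntegral.integral_eq_sub_of_hasDerivAt hd (hw2.intervalIntegrable _ _)]
    simp only [L2toHm1_eq, map_smul]
    abel
  · have hη' : Continuous fun p : ℝ × ℝ => Real.sin (freq n * p.1) * η p.2 := by fun_prop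
    have ha'' : Continuous fun p : ℝ × ℝ => Real.sin (freq n * p.1) * a p.2 := by fun_prop
    have hg := ae_muQ_slice (T := T) ((Lp.coeFn_add (toQ T _ hη')
      (potential A (toQ T _ ha''))).and ((coeFn_toQ (T := T) hη').and
        ((coeFn_potential A (toQ T _ ha'')).and ((coeFn_toQ (T := T) ha'').and A.ae_abs_le))))
    filter_upwards [hg] with t ht z
    have hsin : Continuous fun x => Real.sin (freq n * x) := by fun_prop
    have hz : Integrable (fun x => Real.sin (freq n * x) * H10.toL2 z x) muOm :=
      ((hsin.memLp_muOm 2).integrable_mul (Lp.memLp (H10.toL2 z)))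
    have hAz : Integrable (fun x => A (x, t) * (Real.sin (freq n * x) * H10.toL2 z x)) muOm := by
      refine hz.bdd_mul (c := ‖A‖) ?_ (ht.mono fun x hx => hx.2.2.2.2)
      exact ((Lp.stronglyMeasurable A).comp_measurable (by fun_prop)).aestronglyMeasurable
    have e1 : ∫ x, H10.dx (a t • s) x * H10.dx z x ∂muOm
        = a t * (freq n ^ 2 * ∫ x, Real.sin (freq n * x) * H10.toL2 z x ∂muOm) := by
      rw [← Lp_two_inner, map_smul, real_inner_smul_left, hs, inner_cos_dx, real_inner_comm,
        L2Om.integral_mul_toOm]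
      simp_rw [mul_comm (Real.sin _)]
    have e2 : ∫ x, A (x, t) * H10.toL2 (a t • s) x * H10.toL2 z x ∂muOm
        = a t * ∫ x, A (x, t) * (Real.sin (freq n * x) * H10.toL2 z x) ∂muOm := by
      rw [← integral_const_mul]
      refine integral_congr_ae ?_
      rw [map_smul, hs']
      filter_upwards [Lp.coeFn_smul (a t) (toOm _ hsin), coeFn_toOm hsin] with x h1 h2
      rw [h1, Pi.smul_apply, h2, smul_eq_mul]
      ring
    have e3 : ((η t - freq n ^ 2 * a t) • L2toHm1 (H10.toL2 s)) z
        = (η t - freq n ^ 2 * a t) * ∫ x, Real.sin (freq n * x) * H10.toL2 z x ∂muOm := by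
      rw [_root_.smul_apply, smul_eq_mul, L2toHm1_eq, pairing_apply, hs',
        real_inner_comm, L2Om.integral_mul_toOm]
      simp_rw [mul_comm (Real.sin _)]
    rw [e1, e2, e3]
    have e4 : ∫ x, (toQ T (fun p => Real.sin (freq n * p.1) * η p.2) hη'
        + potential A (toQ T (fun p => Real.sin (freq n * p.1) * a p.2) ha'') : L2Q T) (x, t)
          * H10.toL2 z x ∂muOm
        = ∫ x, (η t * (Real.sin (freq n * x) * H10.toL2 z x)
          + a t * (A (x, t) * (Real.sin (freq n * x) * H10.toL2 z x))) ∂muOm := by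
      refine integral_congr_ae ?_
      filter_upwards [ht] with x hx
      rw [hx.1, Pi.add_apply, hx.2.1, hx.2.2.1, hx.2.2.2.1]
      ring
    rw [e4, integral_add (hz.const_mul _) (hAz.const_mul _), integral_const_mul,
      integral_const_mul]
    ring

/-! ### Green's formula for limits of classical solutions -/

namespace IsWaveLimit

variable {T : ℝ} {d : L2Om × L2Om × L2Q T} {S : ℕ → WaveSolution} {Φ Γ : ℝ → L2Om} {ψ : L2Q T}
  {u : L2T T}

/-- An identity of Green type that holds for all classical solutions passes to the limit. -/
theorem inner_eq_of_classical (h : IsWaveLimit T d S Φ Γ ψ u) {k w : ℝ × ℝ → ℝ} {α β : ℝ → ℝ}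
    (hk : Continuous k) (hw : Continuous w) (hα : Continuous α) (hβ : Continuous β)
    (hS : ∀ S : WaveSolution, ∫ z, S.φ z * k z ∂(muQ T) = (∫ z, S.F z * w z ∂(muQ T))
      - (∫ x in (0 : ℝ)..1, S.φ (x, 0) * α x) - ∫ x in (0 : ℝ)..1, S.G (x, 0) * β x) :
    inner ℝ ψ (toQ T k hk)
      = inner ℝ d.2.2 (toQ T w hw) - inner ℝ d.1 (toOm α hα) - inner ℝ d.2.1 (toOm β hβ) := by
  have hd := h.data
  have h1 : Tendsto (fun k => ((S k).data T).1) atTop (𝓝 d.1) :=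
    (continuous_fst.tendsto d).comp hd
  have h2 : Tendsto (fun k => ((S k).data T).2.1) atTop (𝓝 d.2.1) :=
    ((continuous_fst.comp continuous_snd).tendsto d).comp hd
  have h3 : Tendsto (fun k => ((S k).data T).2.2) atTop (𝓝 d.2.2) :=
    ((continuous_snd.comp continuous_snd).tendsto d).comp hd
  refine tendsto_nhds_unique (h.phiQ.inner tendsto_const_nhds)
    ((((h3.inner tendsto_const_nhds).sub (h1.inner tendsto_const_nhds)).sub
      (h2.inner tendsto_const_nhds)).congr fun j => ?_)
  change inner ℝ (toQ T (S j).F (S j).hF) (toQ T w hw) - inner ℝ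
      (toOm _ (continuous_slice_left (S j).hφ 0)) (toOm α hα)
    - inner ℝ (toOm _ (continuous_slice_left (S j).hG 0)) (toOm β hβ) = inner ℝ (toQ T (S j).φ (S j).hφ) (toQ T k hk)
  rw [inner_toQ_toQ, inner_toQ_toQ, inner_toOm_toOm, inner_toOm_toOm, hS]

end IsWaveLimit

end

noncomputable section

theorem hasDerivAt_slices {f : ℝ × ℝ → ℝ} (hf : Differentiable ℝ f) (x t : ℝ) :
    HasDerivAt (fun s => f (s, t)) (fderiv ℝ f (x, t) (1, 0)) x ∧
      HasDerivAt (fun s => f (x, s)) (fderiv ℝ f (x, t) (0, 1)) t :=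
  ⟨(hf (x, t)).hasFDerivAt.comp_hasDerivAt x
      ((hasDerivAt_id' x).prodMk (hasDerivAt_const x t)),
    (hf (x, t)).hasFDerivAt.comp_hasDerivAt t
      ((hasDerivAt_const t x).prodMk (hasDerivAt_id' t))⟩

theorem iteratedDeriv_two_eq {f f' : ℝ → ℝ} {x c : ℝ} (h : ∀ y, HasDerivAt f (f' y) y)
    (h' : HasDerivAt f' c x) : iteratedDeriv 2 f x = c := by
  rw [iteratedDeriv_succ, iteratedDeriv_one, funext fun y => (h y).deriv]
  exact h'.deriv

namespace IsWaveLimit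

variable {T : ℝ} {d : L2Om × L2Om × L2Q T} {S : ℕ → WaveSolution} {Φ Γ : ℝ → L2Om} {ψ : L2Q T}
  {u : L2T T}

theorem inner_mode (h : IsWaveLimit T d S Φ Γ ψ u) (hT : 0 ≤ T) (n : ℕ) {a a' η : ℝ → ℝ}
    (hη : Continuous η) (ha : ∀ t, HasDerivAt a (a' t) t)
    (ha' : ∀ t, HasDerivAt a' (η t - freq n ^ 2 * a t) t) (haT : a T = 0) (haT' : a' T = 0)
    (hac : Continuous a) :
    inner ℝ ψ (toQ T (fun p => Real.sin (freq n * p.1) * η p.2) (by fun_prop))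
      = inner ℝ d.2.2 (toQ T (fun p => Real.sin (freq n * p.1) * a p.2) (by fun_prop))
        - a' 0 * inner ℝ d.1 (toOm (fun x => Real.sin (freq n * x)) (by fun_prop))
        - a 0 * inner ℝ d.2.1 (toOm (fun x => freq n * Real.cos (freq n * x)) (by fun_prop)) := by
  have hac' : Continuous a' := continuous_iff_continuousAt.2 fun t => (ha' t).continuousAt
  have hs : ∀ x, HasDerivAt (fun r => Real.sin (freq n * r)) (freq n * Real.cos (freq n * x)) x := by
    intro x
    convert! ((hasDerivAt_id' x).const_mul (freq n)).sin using 1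
    ring
  have hc : ∀ x, HasDerivAt (fun r => freq n * Real.cos (freq n * r))
      (-(freq n ^ 2 * Real.sin (freq n * x))) x := by
    intro x
    convert! (((hasDerivAt_id' x).const_mul (freq n)).cos).const_mul (freq n) using 1
    ring
  have key := h.inner_eq_of_classical (k := fun p => Real.sin (freq n * p.1) * η p.2)
    (w := fun p => Real.sin (freq n * p.1) * a p.2)
    (α := fun x => a' 0 * Real.sin (freq n * x))
    (β := fun x => a 0 * (freq n * Real.cos (freq n * x)))
    (by fun_prop) (by fun_prop) (by fun_prop) (by fun_prop) fun S => by
      have hg := S.green hT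
        (w := fun p => Real.sin (freq n * p.1) * a p.2)
        (wt := fun p => Real.sin (freq n * p.1) * a' p.2)
        (wx := fun p => freq n * Real.cos (freq n * p.1) * a p.2)
        (wtt := fun p => Real.sin (freq n * p.1) * (η p.2 - freq n ^ 2 * a p.2))
        (wtx := fun p => freq n * Real.cos (freq n * p.1) * a' p.2)
        (wxx := fun p => -(freq n ^ 2 * Real.sin (freq n * p.1)) * a p.2)
        (by fun_prop) (by fun_prop) (by fun_prop) (by fun_prop) (by fun_prop) (by fun_prop)
        (fun x t => (hs x).mul_const (a t)) (fun x t => (ha' t).const_mul (Real.sin (freq n * x)))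
        (fun x t => (hs x).mul_const (a' t))
        (fun x t => (ha t).const_mul (freq n * Real.cos (freq n * x)))
        (fun x t => (hc x).mul_const (a t)) (by simp) (by simp) (by simp [cos_freq])
        (by simp [haT']) (by simp [haT])
      convert hg using 3
      · ring
      · simp_rw [mul_comm (a' 0)]
      · simp_rw [mul_comm (a 0)]
  have h1 : toOm (fun x => a' 0 * Real.sin (freq n * x)) (by fun_prop)
      = a' 0 • toOm (fun x => Real.sin (freq n * x)) (by fun_prop) := rfl
  have h2 : toOm (fun x => a 0 * (freq n * Real.cos (freq n * x))) (by fun_prop)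
      = a 0 • toOm (fun x => freq n * Real.cos (freq n * x)) (by fun_prop) := rfl
  rwa [h1, h2, real_inner_smul_right, real_inner_smul_right] at key

/-- A transposition solution is the limit of classical solutions with source `B - A φ`. -/
theorem eq_of_isTranspositionSolution {A : LinfQ T} {B φ : L2Q T} {φ₀ G₀ : L2Om} (hT : 0 ≤ T)
    (h : IsWaveLimit T (φ₀, G₀, B - potential A φ) S Φ Γ ψ u)
    (hφ : IsTranspositionSolution T A B φ₀ (dxDual G₀) φ) : ψ = φ := by
  refine sub_eq_zero.1 (L2Q.eq_zero_of_integral_mul_sin _ fun n η hη => ?_)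
  obtain ⟨a, a', ha, ha', haT, haT'⟩ := exists_oscillator (freq_pos n).ne' hη T 0 0
  have hac : Continuous a := continuous_iff_continuousAt.2 fun t => (ha t).continuousAt
  obtain ⟨s, hs, hs'⟩ := exists_sineMode n
  have h1 := hφ _ _ _ _ (isBackwardWeakSolution_mode A n hη ha ha' haT haT' hac hs hs')
  have h2 := h.inner_mode hT n hη ha ha' haT haT' hac
  have hw : Continuous fun p : ℝ × ℝ => Real.sin (freq n * p.1) * a p.2 := by fun_prop
  have hB : ∫ t, ∫ x, B (x, t) * H10.toL2 (a t • s) x ∂muOm ∂(muT T)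
      = inner ℝ B (toQ T _ hw) := by
    have hi : Integrable (fun p => B p * (Real.sin (freq n * p.1) * a p.2)) (muQ T) :=
      (Lp.memLp B).integrable_mul (hw.memLp_muQ T 2)
    rw [L2Q.integral_mul_toQ, integral_muQ_eq_iterated hi]
    refine integral_congr_ae (Eventually.of_forall fun t => integral_congr_ae ?_)
    rw [map_smul, hs']
    filter_upwards [Lp.coeFn_smul (a t) (toOm (fun x => Real.sin (freq n * x)) (by fun_prop)),
      coeFn_toOm (f := fun x => Real.sin (freq n * x)) (by fun_prop)] with x k1 k2
    rw [k1, Pi.smul_apply, k2, smul_eq_mul, mul_comm (a t)]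
  rw [hB, ← Lp_two_inner, ← Lp_two_inner, inner_add_right, inner_potential, dxDual_apply,
    ← Lp_two_inner, map_smul, real_inner_smul_right, real_inner_smul_right, hs, hs'] at h1
  rw [inner_sub_left] at h2
  rw [← L2Q.integral_mul_toQ (ψ - φ) (g := fun p => Real.sin (freq n * p.1) * η p.2) (by fun_prop),
    inner_sub_left, h2]
  simp only
  linarith

theorem isWaveOperator {A : LinfQ T} {B : L2Q T} (hT : 0 ≤ T)
    (h : IsWaveLimit T d S Φ Γ ψ u) (hd : d.2.2 = B - potential A ψ) :
    IsWaveOperator T A ψ B := by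
  intro θ hθ _ hsupp
  have hfd : ContDiff ℝ ∞ (fderiv ℝ θ) := hθ.fderiv_right (by norm_cast)
  have hDx : ContDiff ℝ ∞ fun z => fderiv ℝ θ z (1, 0) := hfd.clm_apply contDiff_const
  have hDt : ContDiff ℝ ∞ fun z => fderiv ℝ θ z (0, 1) := hfd.clm_apply contDiff_const
  have hD : ∀ {f : ℝ × ℝ → ℝ} (v : ℝ × ℝ), ContDiff ℝ ∞ f →
      Continuous fun z => fderiv ℝ f z v := fun v hf =>
    (hf.continuous_fderiv (by simp)).clm_apply continuous_const
  have sl : ∀ {f : ℝ × ℝ → ℝ} (_ : ContDiff ℝ ∞ f) (x t : ℝ), _ := fun hf x t =>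
    hasDerivAt_slices (hf.differentiable (by simp)) x t
  have happ : ∀ (v z : ℝ × ℝ),
      fderiv ℝ (fun z => fderiv ℝ θ z v) z = (fderiv ℝ (fderiv ℝ θ) z).flip v := by
    intro v z
    have h1 := (hfd.differentiable (by simp) z).hasFDerivAt.clm_apply
      (hasFDerivAt_const v z)
    rw [h1.fderiv]
    ext <;> simp
  have hsymm : ∀ z, fderiv ℝ (fun z => fderiv ℝ θ z (0, 1)) z (1, 0)
      = fderiv ℝ (fun z => fderiv ℝ θ z (1, 0)) z (0, 1) := by
    intro z
    rw [happ, happ]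
    exact second_derivative_symmetric (fun y => (hθ.differentiable (by simp) y).hasFDerivAt)
      (hfd.differentiable (by simp) z).hasFDerivAt (1, 0) (0, 1)
  have hout : ∀ z : ℝ × ℝ, z ∉ Ioo (0 : ℝ) 1 ×ˢ Ioo 0 T → θ z = 0 ∧ fderiv ℝ θ z = 0 :=
    fun z hz => ⟨image_eq_zero_of_notMem_tsupport fun h' => hz (hsupp h'),
      fderiv_of_notMem_tsupport ℝ fun h' => hz (hsupp h')⟩
  have ht0 : ∀ x, fderiv ℝ θ (x, 0) = 0 := fun x => (hout _ (by simp)).2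
  have hwxx := hD (1, 0) hDx
  have hwtt := hD (0, 1) hDt
  have hk : Continuous fun z => fderiv ℝ (fun z => fderiv ℝ θ z (0, 1)) z (0, 1)
      - fderiv ℝ (fun z => fderiv ℝ θ z (1, 0)) z (1, 0) := hwtt.sub hwxx
  have key := h.inner_eq_of_classical (α := fun _ => 0) (β := fun _ => 0) hk hθ.continuous
    continuous_const continuous_const fun S => by
      have hg := S.green hT hθ.continuous hDt.continuous hDx.continuous hwtt (hD (0, 1) hDx) hwxx
        (fun x t => (sl hθ x t).1) (fun x t => (sl hDt x t).2)
        (fun x t => by rw [← hsymm]; exact (sl hDt x t).1) (fun x t => (sl hDx x t).2)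
        (fun x t => (sl hDx x t).1) (fun t => (hout _ (by simp)).1)
        (fun t => by rw [(hout (0, t) (by simp)).2]; rfl)
        (fun t => by rw [(hout (1, t) (by simp)).2]; rfl)
        (fun x => by rw [(hout (x, T) (by simp)).2]; rfl)
        (fun x => by rw [(hout (x, T) (by simp)).2]; rfl)
      rw [hg]
      simp [ht0]
  have hz : toOm (fun _ => (0 : ℝ)) continuous_const = 0 := rfl
  rw [hz, inner_zero_right, inner_zero_right, sub_zero, sub_zero, hd, inner_sub_left,
    ← inner_potential] at key
  have hsum : inner ℝ ψ (toQ T _ hk + potential A (toQ T θ hθ.continuous))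
      = inner ℝ B (toQ T θ hθ.continuous) := by
    rw [inner_add_right, key]
    ring
  rw [L2Q.integral_mul_toQ, Lp_two_inner] at hsum
  rw [← hsum]
  refine integral_congr_ae ?_
  filter_upwards [Lp.coeFn_add (toQ T _ hk) (potential A (toQ T θ hθ.continuous)),
    coeFn_toQ (T := T) hk, coeFn_potential A (toQ T θ hθ.continuous),
    coeFn_toQ (T := T) hθ.continuous] with p h1 h2 h3 h4
  rw [h1, Pi.add_apply, h2, h3, h4,
    iteratedDeriv_two_eq (fun s => (sl hθ p.1 s).2) (sl hDt p.1 p.2).2,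
    iteratedDeriv_two_eq (fun s => (sl hθ s p.2).1) (sl hDx p.1 p.2).1]

/-- Observability passes to limits of classical solutions. -/
theorem observability (h : IsWaveLimit T d S Φ Γ ψ u) {A : LinfQ T} (hT : 0 ≤ T) {K : ℝ}
    (hK : ∀ (S : WaveSolution) (b : ℝ × ℝ → ℝ), Integrable (fun z => b z ^ 2) (muQ T) →
      (∀ᵐ z ∂(muQ T), |S.F z| ≤ ‖A‖ * |S.φ z| + |b z|) →
      S.energy 0 ≤ K * ((∫ t in (0 : ℝ)..T, S.φ (1, t) ^ 2) + ∫ z, b z ^ 2 ∂(muQ T))) :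
    ‖d.1‖ ^ 2 + ‖d.2.1‖ ^ 2 ≤ K * (‖u‖ ^ 2 + ‖d.2.2 + potential A ψ‖ ^ 2) := by
  have hd := h.data
  have h1 : Tendsto (fun k => ((S k).data T).1) atTop (𝓝 d.1) :=
    (continuous_fst.tendsto d).comp hd
  have h2 : Tendsto (fun k => ((S k).data T).2.1) atTop (𝓝 d.2.1) :=
    ((continuous_fst.comp continuous_snd).tendsto d).comp hd
  have h3 : Tendsto (fun k => ((S k).data T).2.2) atTop (𝓝 d.2.2) :=
    ((continuous_snd.comp continuous_snd).tendsto d).comp hd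
  have h4 : Tendsto (fun k => potential A ((S k).phiQ T)) atTop (𝓝 (potential A ψ)) :=
    ((potential A).continuous.tendsto ψ).comp h.phiQ
  refine le_of_tendsto_of_tendsto' ((h1.norm.pow 2).add (h2.norm.pow 2))
    (((h.trace.norm.pow 2).add ((h3.add h4).norm.pow 2)).const_mul K) fun k => ?_
  set b : L2Q T := toQ T (S k).F (S k).hF + potential A ((S k).phiQ T) with hb
  have hbound : ∀ᵐ z ∂(muQ T), |(S k).F z| ≤ ‖A‖ * |(S k).φ z| + |b z| := by
    filter_upwards [Lp.coeFn_add (toQ T (S k).F (S k).hF) (potential A ((S k).phiQ T)),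
      coeFn_toQ (T := T) (S k).hF, coeFn_potential A ((S k).phiQ T), coeFn_toQ (T := T) (S k).hφ,
      A.ae_abs_le] with z k1 k2 k3 k4 k5
    have k6 : b z = (S k).F z + A z * (S k).φ z := by
      rw [hb, k1, Pi.add_apply, k2, k3]
      exact congrArg (fun y => (S k).F z + A z * y) k4
    have k7 : (S k).F z = b z - A z * (S k).φ z := by rw [k6]; ring
    rw [k7]
    refine (abs_sub _ _).trans ?_
    rw [abs_mul, add_comm]
    gcongr
  have hobs := hK (S k) b (Lp.memLp b).integrable_sq hbound
  rw [← WaveSolution.norm_sq_phiAt_add, ← Lp_two_norm_sq,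
    ← norm_sq_toT hT (continuous_slice_right (S k).hφ 1)] at hobs
  exact hobs

end IsWaveLimit

end

theorem theorem1 (T : ℝ) (hT : 2 < T) :
    ∃ C : ℝ, 0 < C ∧
      ∀ (A : LinfQ T) (B : L2Q T) (φ₀ : L2Om) (φ₁ : Hm1) (φ : L2Q T),
        IsTranspositionSolution T A B φ₀ φ₁ φ →
          ∃ (Φ : ℝ → L2Om) (Φ' : ℝ → Hm1) (u : L2T T),
            IsTimeRepresentative T φ Φ Φ' ∧ Φ 0 = φ₀ ∧ Φ' 0 = φ₁ ∧
            IsTraceAtOne T φ u ∧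
            IsWaveOperator T A φ B ∧
            ‖Φ 0‖ ^ 2 + ‖Φ' 0‖ ^ 2
              ≤ C * Real.exp (C * Real.sqrt ‖A‖) * (‖u‖ ^ 2 + ‖B‖ ^ 2) := by
  obtain ⟨C, hC, hobs⟩ := WaveSolution.observability hT
  have hT0 : 0 ≤ T := by linarith
  refine ⟨C, hC, fun A B φ₀ φ₁ φ hφ => ?_⟩
  obtain ⟨G₀, rfl⟩ := dxDual_surjective φ₁
  obtain ⟨S, Φ, Γ, ψ, u, h⟩ := exists_isWaveLimit hT0 (φ₀, G₀, B - potential A φ)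
  obtain rfl := h.eq_of_isTranspositionSolution hT0 hφ
  have hΦ : Φ 0 = φ₀ := h.phi_zero hT0
  have hΓ : Γ 0 = G₀ := h.G_zero hT0
  refine ⟨Φ, fun t => dxDual (Γ t), u, h.isTimeRepresentative hT0, hΦ, congrArg dxDual hΓ,
    h.isTraceAtOne hT0, h.isWaveOperator hT0 rfl, ?_⟩
  have hle := h.observability (A := A) hT0 fun S => hobs S ‖A‖ (norm_nonneg A)
  simp only [sub_add_cancel] at hle
  simp only [hΦ, hΓ]
  refine le_trans ?_ hle
  gcongr
  exact norm_dxDual_le G₀
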